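/- **Conventions.** A $C^*$-algebra is simple if it is nonzero and has no closed two-sided ideals other than $0$ and itself. An interval algebra is a $C^*$-algebra of the form $C([0,1])\otimes E$ with $E$ a finite-dimensional $C^*$-algebra. Let $A$ be a simple unital $C^*$-algebra. We write $\mathrm{TR}(A)\le 1$ if for every finite $F\subseteq A$, every $\varepsilon>0$ and every nonzero positive $x\in A$ there are a nonzero projection $p\in A$, an interval algebra $B$ and a unital $*$-homomorphism $\varphi\colon B\to pAp$ such that (1) $\|ap-pa\|<\varepsilon$ for all $a\in F$; (2) $\mathrm{dist}(pap,\varphi(B))<\varepsilon$ for all $a\in F$; (3) $1-p$ is Murray–von Neumann equivalent to a projection in $\overline{xAx}$. We write $\mathrm{TR}(A)=0$ if the same holds with $B$ a finite-dimensional $C^*$-algebra instead of an interval algebra. Let $G$ be a second-countable compact (Hausdorff) group and $\alpha\colon G\to\mathrm{Aut}(A)$ an action such that $g\mapsto\alpha_g(a)$ is continuous for each $a\in A$. Put $A_\infty=\ell^\infty(\mathbb N,A)/c_0(\mathbb N,A)$, with quotient map $\eta_A$, and let $A_{\infty,\alpha}\subseteq A_\infty$ be the image under $\eta_A$ of those bounded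 sequences on which the entrywise action of $G$ is norm-continuous. For an $\alpha$-invariant $C^*$-subalgebra $D\subseteq A$ (not necessarily containing the unit), let $\mathrm{Ann}(D,A_\infty)=\{x\in A_\infty: xd=dx=0 \text{ for all } d\in D\}$, let $F(D,A)=(A_\infty\cap D')/\mathrm{Ann}(D,A_\infty)$ with its induced $G$-action $F(\alpha)$, and let $F_\alpha(D,A)\subseteq F(D,A)$ be the image of $A_{\infty,\alpha}\cap D'$. The action $\alpha$ has the Rokhlin property if for every separable $\alpha$-invariant $C^*$-subalgebra $D\subseteq A$ there is a unital $*$-homomorphism $C(G)\to F_\alpha(D,A)$ that is equivariant for left translation on $C(G)$ and $F(\alpha)$ on $F_\alpha(D,A)$. **Theorem.** Let $A$ be a unital, separable, simple $C^*$-algebra with $\mathrm{TR}(A)\le 1$, let $G$ be a second-countable compact group, and let $\alpha\colon G\to\mathrm{Aut}(A)$ be a continuous action with the Rokhlin property. Then the fixed point algebra $A^\alpha$ is a unital, separable, simple $C^*$-algebra with $\mathrm{TR}(A^\alpha)\le\mathrm{TR}(A)$; that is, $\mathrm{TR}(A^\alpha)\le 1$, and $\mathrm{TR}(A^\alpha)=0$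 if $\mathrm{TR}(A)=0$. If $G$ is finite, then the crossed product $A\rtimes_\alpha G$ is likewise unital, separable and simple, with $\mathrm{TR}(A\rtimes_\alpha G)\le 1$, and with $\mathrm{TR}(A\rtimes_\alpha G)=0$ if $\mathrm{TR}(A)=0$. -/

import Mathlib

open Filter Topology
open scoped BoundedContinuousFunction

namespace RokhlinAction

noncomputable section

/-! ### Quotients of `*`-algebras by self-adjoint two-sided ideals -/

section StarQuotient

/-- An ideal that is closed under the involution. -/
class IsStarClosed {R : Type*} [Ring R] [StarRing R] (I : Ideal R) : Prop where
  star_mem : ∀ x ∈ I, star x ∈ I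

variable {R S : Type*} [Ring R] [StarRing R] [Ring S] [StarRing S]

/-- The involution `[x]* = [x*]` on `R / I`. -/
instance instStarQuotient (I : Ideal R) [IsStarClosed I] : Star (R ⧸ I) where
  star := Quotient.map' star fun a b h => by
    rw [Submodule.quotientRel_def] at h ⊢
    simpa using IsStarClosed.star_mem _ h

theorem star_mk (I : Ideal R) [I.IsTwoSided] [IsStarClosed I] (x : R) :
    star (Ideal.Quotient.mk I x) = Ideal.Quotient.mk I (star x) := rfl

instance instStarRingQuotient (I : Ideal R) [I.IsTwoSided] [IsStarClosed I] :
    StarRing (R ⧸ I) where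
  star_involutive x := by
    obtain ⟨x, rfl⟩ := Ideal.Quotient.mk_surjective x
    rw [star_mk, star_mk, star_star]
  star_mul x y := by
    obtain ⟨x, rfl⟩ := Ideal.Quotient.mk_surjective x
    obtain ⟨y, rfl⟩ := Ideal.Quotient.mk_surjective y
    rw [← map_mul, star_mk, star_mul, map_mul]
    rfl
  star_add x y := by
    obtain ⟨x, rfl⟩ := Ideal.Quotient.mk_surjective x
    obtain ⟨y, rfl⟩ := Ideal.Quotient.mk_surjective y
    rw [← map_add, star_mk, star_add, map_add]
    rfl

variable [Algebra ℂ R] [Algebra ℂ S]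

instance instStarModuleQuotient [StarModule ℂ R] (I : Ideal R) [I.IsTwoSided] [IsStarClosed I] :
    StarModule ℂ (R ⧸ I) where
  star_smul c x := by
    obtain ⟨x, rfl⟩ := Ideal.Quotient.mk_surjective x
    change Ideal.Quotient.mk I (star (c • x)) = _
    rw [star_smul]
    rfl

/-- The quotient map `R → R / I` as a unital `*`-homomorphism. -/
def quotMk (I : Ideal R) [I.IsTwoSided] [IsStarClosed I] : R →⋆ₐ[ℂ] R ⧸ I :=
  { Ideal.Quotient.mkₐ ℂ I with map_star' := fun _ => rfl }

/-- The `*`-homomorphism `R / I → S / J` induced by a `*`-homomorphism that maps `I` into `J`. -/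
def quotMap (I : Ideal R) [I.IsTwoSided] [IsStarClosed I] (J : Ideal S) [J.IsTwoSided]
    [IsStarClosed J] (f : R →⋆ₐ[ℂ] S) (hf : ∀ x ∈ I, f x ∈ J) : (R ⧸ I) →⋆ₐ[ℂ] (S ⧸ J) :=
  { Ideal.Quotient.liftₐ I ((Ideal.Quotient.mkₐ ℂ J).comp f.toAlgHom)
      (fun x hx => Ideal.Quotient.eq_zero_iff_mem.2 (hf x hx)) with
    map_star' := fun x => by
      obtain ⟨x, rfl⟩ := Ideal.Quotient.mk_surjective x
      change Ideal.Quotient.mk J (f (star x)) = star (Ideal.Quotient.mk J (f x))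
      rw [map_star, star_mk] }

end StarQuotient

/-! ### Sequence algebras -/

section Sequences

variable (A : Type*) [CStarAlgebra A]

/-- The ideal `c₀(ℕ, A)` in `ℓ^∞(ℕ, A)`; the latter is `ℕ →ᵇ A`. -/
def c0 : Ideal (ℕ →ᵇ A) where
  carrier := {a | Tendsto (fun n => ‖a n‖) atTop (𝓝 0)}
  zero_mem' := by simp
  add_mem' {a b} ha hb := by
    refine squeeze_zero (fun _ => norm_nonneg _) (fun n => norm_add_le (a n) (b n)) ?_
    simpa using Tendsto.add ha hb
  smul_mem' c a ha := by
    refine squeeze_zero (fun _ => norm_nonneg _) (fun n => ?_)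
      (by simpa using Tendsto.const_mul ‖c‖ ha)
    exact (norm_mul_le (c n) (a n)).trans
      (mul_le_mul_of_nonneg_right (c.norm_coe_le_norm n) (norm_nonneg _))

instance c0_isTwoSided : (c0 A).IsTwoSided where
  mul_mem_of_left {a} b ha := by
    refine squeeze_zero (fun _ => norm_nonneg _) (fun n => ?_)
      (by simpa using Tendsto.mul_const ‖b‖ ha)
    exact (norm_mul_le (a n) (b n)).trans
      (mul_le_mul_of_nonneg_left (b.norm_coe_le_norm n) (norm_nonneg _))

instance c0_isStarClosed : IsStarClosed (c0 A) where
  star_mem a ha := by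
    change Tendsto (fun n => ‖star (a n)‖) atTop (𝓝 0)
    simp only [norm_star]
    exact ha

/-- `A_∞ = ℓ^∞(ℕ, A) / c₀(ℕ, A)`. -/
abbrev SeqAlg : Type _ := (ℕ →ᵇ A) ⧸ c0 A

/-- The quotient map `η_A : ℓ^∞(ℕ, A) → A_∞`. -/
def eta : (ℕ →ᵇ A) →⋆ₐ[ℂ] SeqAlg A := quotMk (c0 A)

variable {A}

/-- The image in `A_∞` of the constant sequence `a`. -/
def diag (a : A) : SeqAlg A := eta A (BoundedContinuousFunction.const ℕ a)

theorem diag_star (a : A) : diag (star a) = star (diag a) := by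
  rw [diag, diag, ← map_star]
  rfl

variable (D : NonUnitalStarSubalgebra ℂ A)

/-- The relative commutant `A_∞ ∩ D'`. -/
def commutant : StarSubalgebra ℂ (SeqAlg A) :=
  StarSubalgebra.centralizer ℂ (diag '' (D : Set A))

theorem mem_commutant_iff (x : SeqAlg A) :
    x ∈ commutant D ↔ ∀ d ∈ D, diag d * x = x * diag d := by
  rw [commutant, StarSubalgebra.mem_centralizer_iff]
  constructor
  · intro h d hd
    exact (h _ ⟨d, hd, rfl⟩).1
  · rintro h _ ⟨d, hd, rfl⟩
    refine ⟨h d hd, ?_⟩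
    rw [← diag_star]
    exact h _ (star_mem hd)

/-- The annihilator `Ann(D, A_∞)` of `D` in `A_∞`, as an ideal in `A_∞ ∩ D'`. -/
def ann : Ideal (commutant D) where
  carrier := {x | ∀ d ∈ D, (x : SeqAlg A) * diag d = 0 ∧ diag d * (x : SeqAlg A) = 0}
  zero_mem' := by simp
  add_mem' {x y} hx hy d hd := by
    simp [add_mul, mul_add, (hx d hd).1, (hx d hd).2, (hy d hd).1, (hy d hd).2]
  smul_mem' c x hx d hd := by
    have hc := (mem_commutant_iff D _).1 c.2 d hd
    refine ⟨?_, ?_⟩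
    · change ((c : SeqAlg A) * (x : SeqAlg A)) * diag d = 0
      rw [mul_assoc, (hx d hd).1, mul_zero]
    · change diag d * ((c : SeqAlg A) * (x : SeqAlg A)) = 0
      rw [← mul_assoc, hc, mul_assoc, (hx d hd).2, mul_zero]

instance ann_isTwoSided : (ann D).IsTwoSided where
  mul_mem_of_left {x} c hx d hd := by
    have hc := (mem_commutant_iff D _).1 c.2 d hd
    refine ⟨?_, ?_⟩
    · change ((x : SeqAlg A) * (c : SeqAlg A)) * diag d = 0
      rw [mul_assoc, ← hc, ← mul_assoc, (hx d hd).1, zero_mul]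
    · change diag d * ((x : SeqAlg A) * (c : SeqAlg A)) = 0
      rw [← mul_assoc, (hx d hd).2, zero_mul]

instance ann_isStarClosed : IsStarClosed (ann D) where
  star_mem x hx d hd := by
    have h := hx (star d) (star_mem hd)
    refine ⟨?_, ?_⟩
    · change star (x : SeqAlg A) * diag d = 0
      rw [← star_star d, diag_star, ← star_mul, h.2, star_zero]
    · change diag d * star (x : SeqAlg A) = 0
      rw [← star_star d, diag_star, ← star_mul, h.1, star_zero]

/-- `F(D, A) = (A_∞ ∩ D') / Ann(D, A_∞)`. -/
abbrev CentralSeq : Type _ := commutant D ⧸ ann D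

/-- The quotient map `κ_{D,A} : A_∞ ∩ D' → F(D, A)`. -/
def kappa : commutant D →⋆ₐ[ℂ] CentralSeq D := quotMk (ann D)

end Sequences

/-! ### Actions on sequence algebras and the Rokhlin property -/

section Actions

variable {A G : Type*} [CStarAlgebra A] [Group G]

/-- The automorphism of `ℓ^∞(ℕ, A)` that applies `σ` in every entry. -/
def seqMap (σ : A ≃⋆ₐ[ℂ] A) : (ℕ →ᵇ A) →⋆ₐ[ℂ] (ℕ →ᵇ A) where
  toFun a := BoundedContinuousFunction.ofNormedAddCommGroupDiscrete (fun n => σ (a n)) ‖a‖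
    (fun n => by rw [StarAlgEquiv.norm_map]; exact a.norm_coe_le_norm n)
  map_one' := by ext n; simp
  map_mul' a b := by ext n; simp
  map_zero' := by ext n; simp
  map_add' a b := by ext n; simp
  commutes' c := by
    ext n
    simp [Algebra.algebraMap_eq_smul_one]
  map_star' a := by ext n; simp [map_star]

/-- The automorphism of `A_∞` induced by `σ`. -/
def seqAlgMap (σ : A ≃⋆ₐ[ℂ] A) : SeqAlg A →⋆ₐ[ℂ] SeqAlg A :=
  quotMap (c0 A) (c0 A) (seqMap σ) fun a ha => by
    change Tendsto (fun n => ‖σ (a n)‖) atTop (𝓝 0)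
    simp only [StarAlgEquiv.norm_map]
    exact ha

theorem seqAlgMap_diag (σ : A ≃⋆ₐ[ℂ] A) (a : A) : seqAlgMap σ (diag a) = diag (σ a) := rfl

variable (α : G →* (A ≃⋆ₐ[ℂ] A)) (D : NonUnitalStarSubalgebra ℂ A)

/-- `D` is invariant under the action `α`. -/
def IsInvariant : Prop := ∀ g : G, ∀ d ∈ D, α g d ∈ D

theorem apply_apply_inv (g : G) (a : A) : α g (α g⁻¹ a) = a := by
  rw [← StarAlgEquiv.mul_apply, ← map_mul, mul_inv_cancel, map_one, StarAlgEquiv.one_apply]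

variable {α D}

/-- The action induced by `α` on `A_∞ ∩ D'`. -/
def commutantAct (hD : IsInvariant α D) (g : G) : commutant D →⋆ₐ[ℂ] commutant D :=
  StarAlgHom.codRestrict ((seqAlgMap (α g)).comp (commutant D).subtype) (commutant D) fun x => by
    rw [mem_commutant_iff]
    intro d hd
    have h := congrArg (seqAlgMap (α g))
      ((mem_commutant_iff D _).1 x.2 (α g⁻¹ d) (hD g⁻¹ d hd))
    rw [map_mul, map_mul, seqAlgMap_diag, apply_apply_inv] at h
    exact h

/-- The action `F(α)` induced by `α` on `F(D, A)`. -/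
def centralSeqAct (hD : IsInvariant α D) (g : G) : CentralSeq D →⋆ₐ[ℂ] CentralSeq D :=
  quotMap (ann D) (ann D) (commutantAct hD g) fun x hx d hd => by
    have h := hx (α g⁻¹ d) (hD g⁻¹ d hd)
    have h1 := congrArg (seqAlgMap (α g)) h.1
    have h2 := congrArg (seqAlgMap (α g)) h.2
    rw [map_mul, seqAlgMap_diag, apply_apply_inv, map_zero] at h1 h2
    exact ⟨h1, h2⟩

variable [TopologicalSpace G] (α D)

/-- `ℓ^∞_α(ℕ, A)`: the bounded sequences on which the entrywise action is norm-continuous. -/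
def contSeq : StarSubalgebra ℂ (ℕ →ᵇ A) where
  carrier := {a | Continuous fun g => seqMap (α g) a}
  mul_mem' {a b} ha hb := by
    change Continuous fun g => seqMap (α g) (a * b)
    simp only [map_mul]
    exact Continuous.mul ha hb
  add_mem' {a b} ha hb := by
    change Continuous fun g => seqMap (α g) (a + b)
    simp only [map_add]
    exact Continuous.add ha hb
  algebraMap_mem' c := by
    change Continuous fun g => seqMap (α g) (algebraMap ℂ _ c)
    simp only [AlgHomClass.commutes]
    exact continuous_const
  star_mem' {a} ha := by
    change Continuous fun g => seqMap (α g) (star a)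
    simp only [map_star]
    exact Continuous.star ha

/-- `A_{∞,α} = η_A(ℓ^∞_α(ℕ, A))`. -/
def contSeqAlg : StarSubalgebra ℂ (SeqAlg A) := (contSeq α).map (eta A)

/-- `F_α(D, A) = κ_{D,A}(A_{∞,α} ∩ D')`, a unital `*`-subalgebra of `F(D, A)`. -/
def contCentralSeq : StarSubalgebra ℂ (CentralSeq D) :=
  ((contSeqAlg α).comap (commutant D).subtype).map (kappa D)

variable [IsTopologicalGroup G]

/-- Left translation on `C(G)`: `(Lt_g f)(h) = f(g⁻¹ h)`. -/
def leftTranslate (g : G) (f : C(G, ℂ)) : C(G, ℂ) :=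
  f.comp ⟨fun h => g⁻¹ * h, continuous_const_mul g⁻¹⟩

/-- The Rokhlin property: for every separable `α`-invariant `C*`-subalgebra `D` of `A` there is a
unital equivariant `*`-homomorphism `(C(G), Lt) → (F_α(D, A), F(α))`. -/
def HasRokhlinProperty : Prop :=
  ∀ D : NonUnitalStarSubalgebra ℂ A, IsClosed (D : Set A) →
    TopologicalSpace.IsSeparable (D : Set A) → ∀ hD : IsInvariant α D,
      ∃ φ : C(G, ℂ) →⋆ₐ[ℂ] contCentralSeq α D, ∀ (g : G) (f : C(G, ℂ)),
        (φ (leftTranslate g f) : CentralSeq D) = centralSeqAct hD g (φ f : CentralSeq D)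

end Actions

/-! ### The fixed point algebra -/

section FixedPoints

variable {A G : Type*} [CStarAlgebra A] [Group G] (α : G →* (A ≃⋆ₐ[ℂ] A))

/-- The fixed point algebra `A^α`. -/
def fixedPoints : StarSubalgebra ℂ A where
  carrier := {a | ∀ g, α g a = a}
  mul_mem' {a b} ha hb g := by rw [map_mul, ha g, hb g]
  add_mem' {a b} ha hb g := by rw [map_add, ha g, hb g]
  algebraMap_mem' c g := by simp [Algebra.algebraMap_eq_smul_one]
  star_mem' {a} ha g := by rw [map_star, ha g]

instance isClosed_fixedPoints : IsClosed (fixedPoints α : Set A) := by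
  have h : (fixedPoints α : Set A) = ⋂ g, {a | α g a = a} := by
    ext a
    simp [fixedPoints]
  rw [h]
  exact isClosed_iInter fun g =>
    isClosed_eq ((AddMonoidHomClass.isometry_of_norm (α g) (StarAlgEquiv.norm_map (α g))).continuous)
      continuous_id

end FixedPoints

/-! ### Crossed products by finite groups -/

section CrossedProducts

variable {A G : Type*} [CStarAlgebra A] [Group G]

/-- The crossed product `A ⋊_α G` by a finite group: functions `f : G → A` (written
`∑ g, f g • u_g`) with the twisted convolution product and involution. -/
@[nolint unusedArguments]
def CrossedProduct (_α : G →* (A ≃⋆ₐ[ℂ] A)) : Type _ := G → A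

namespace CrossedProduct

variable {α : G →* (A ≃⋆ₐ[ℂ] A)}

instance : AddCommGroup (CrossedProduct α) := inferInstanceAs (AddCommGroup (G → A))

instance : Module ℂ (CrossedProduct α) := inferInstanceAs (Module ℂ (G → A))

@[ext] theorem ext {x y : CrossedProduct α} (h : ∀ g, x g = y g) : x = y := funext h

theorem add_apply (x y : CrossedProduct α) (g : G) : (x + y) g = x g + y g := rfl

theorem smul_apply (c : ℂ) (x : CrossedProduct α) (g : G) : (c • x) g = c • x g := rfl

/-- `x*(g) = α_g(x(g⁻¹)*)`. -/
instance : Star (CrossedProduct α) where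
  star x := fun g => α g (star (x g⁻¹))

theorem star_apply (x : CrossedProduct α) (g : G) : star x g = α g (star (x g⁻¹)) := rfl

/-- The regular representation of `A ⋊_α G` by `G × G`-matrices over `A`:
`(a u_g) ξ (s) = α_{s⁻¹}(a) ξ(g⁻¹ s)`. -/
def regRep (x : CrossedProduct α) : CStarMatrix G G A :=
  CStarMatrix.ofMatrix fun s t => α s⁻¹ (x (s * t⁻¹))

theorem regRep_apply (x : CrossedProduct α) (s t : G) :
    regRep x s t = α s⁻¹ (x (s * t⁻¹)) := rfl

theorem regRep_injective : Function.Injective (regRep : CrossedProduct α → CStarMatrix G G A) := by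
  intro x y h
  ext g
  have := congrFun (congrFun h 1) g⁻¹
  simpa [regRep_apply] using this

theorem regRep_add (x y : CrossedProduct α) : regRep (x + y) = regRep x + regRep y := by
  ext s t
  simp [regRep_apply, add_apply]

theorem regRep_smul (c : ℂ) (x : CrossedProduct α) : regRep (c • x) = c • regRep x := by
  ext s t
  simp [regRep_apply, smul_apply]

theorem regRep_zero : regRep (0 : CrossedProduct α) = 0 := by
  simpa using regRep_smul (0 : ℂ) (0 : CrossedProduct α)

theorem regRep_star (x : CrossedProduct α) : regRep (star x) = star (regRep x) := by
  ext s t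
  rw [CStarMatrix.star_apply, regRep_apply, regRep_apply, star_apply, ← map_star,
    ← StarAlgEquiv.mul_apply, ← map_mul]
  simp

section One

variable [DecidableEq G]

/-- The unit is `u_1`. -/
instance : One (CrossedProduct α) where
  one := fun g => if g = 1 then 1 else 0

theorem one_apply (g : G) : (1 : CrossedProduct α) g = if g = 1 then 1 else 0 := rfl

theorem regRep_one : regRep (1 : CrossedProduct α) = 1 := by
  ext s t
  rw [regRep_apply, one_apply, CStarMatrix.one_apply]
  by_cases h : s = t
  · simp [h]
  · simp [h, mul_inv_eq_one]

end One

variable [Fintype G]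

/-- `(x * y)(g) = ∑ h, x(h) α_h(y(h⁻¹ g))`. -/
instance : Mul (CrossedProduct α) where
  mul x y := fun g => ∑ h, x h * α h (y (h⁻¹ * g))

theorem mul_apply (x y : CrossedProduct α) (g : G) :
    (x * y) g = ∑ h, x h * α h (y (h⁻¹ * g)) := rfl

theorem regRep_mul (x y : CrossedProduct α) : regRep (x * y) = regRep x * regRep y := by
  ext s t
  rw [CStarMatrix.mul_apply, regRep_apply, mul_apply, map_sum]
  refine Fintype.sum_bijective (fun h => h⁻¹ * s)
    ((Group.mulRight_bijective s).comp inv_involutive.bijective) _ _ fun h => ?_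
  rw [regRep_apply, regRep_apply, map_mul, ← StarAlgEquiv.mul_apply, ← map_mul]
  simp [mul_assoc]

variable [DecidableEq G]

instance : Ring (CrossedProduct α) where
  __ := (inferInstance : AddCommGroup (CrossedProduct α))
  left_distrib x y z := regRep_injective (by
    simp only [regRep_mul, regRep_add, mul_add])
  right_distrib x y z := regRep_injective (by
    simp only [regRep_mul, regRep_add, add_mul])
  zero_mul x := regRep_injective (by simp only [regRep_mul, regRep_zero, zero_mul])
  mul_zero x := regRep_injective (by simp only [regRep_mul, regRep_zero, mul_zero])
  mul_assoc x y z := regRep_injective (by simp only [regRep_mul, mul_assoc])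
  one_mul x := regRep_injective (by simp only [regRep_mul, regRep_one, one_mul])
  mul_one x := regRep_injective (by simp only [regRep_mul, regRep_one, mul_one])

instance : StarRing (CrossedProduct α) where
  star_involutive x := regRep_injective (by simp only [regRep_star, star_star])
  star_mul x y := regRep_injective (by simp only [regRep_star, regRep_mul, star_mul])
  star_add x y := regRep_injective (by simp only [regRep_star, regRep_add, star_add])

instance : Algebra ℂ (CrossedProduct α) :=
  Algebra.ofModule
    (fun c x y => regRep_injective (by simp only [regRep_mul, regRep_smul, smul_mul_assoc]))
    (fun c x y => regRep_injective (by simp only [regRep_mul, regRep_smul, mul_smul_comm]))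

instance : StarModule ℂ (CrossedProduct α) where
  star_smul c x := regRep_injective (by simp only [regRep_star, regRep_smul, star_smul])

variable (α) in
/-- The regular representation as a unital `*`-homomorphism. -/
def regRepHom : CrossedProduct α →⋆ₐ[ℂ] CStarMatrix G G A where
  toFun := regRep
  map_one' := regRep_one
  map_mul' := regRep_mul
  map_zero' := regRep_zero
  map_add' := regRep_add
  commutes' c := by
    rw [Algebra.algebraMap_eq_smul_one, Algebra.algebraMap_eq_smul_one, regRep_smul, regRep_one]
  map_star' := regRep_star

/-- The `C*`-algebra structure of the matrices over `A`. -/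
@[reducible]
def matrixCStarAlgebra (G A : Type*) [CStarAlgebra A] [Fintype G] [DecidableEq G] :
    CStarAlgebra (CStarMatrix G G A) :=
  letI := CStarAlgebra.spectralOrder A
  letI := CStarAlgebra.spectralOrderedRing A
  CStarMatrix.instCStarAlgebra

instance : NormedRing (CrossedProduct α) :=
  letI := matrixCStarAlgebra G A
  NormedRing.induced _ _ (regRepHom α) regRep_injective

instance : NormedAlgebra ℂ (CrossedProduct α) :=
  letI := matrixCStarAlgebra G A
  NormedAlgebra.induced ℂ _ _ (regRepHom α)

theorem isClosed_range_regRep :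
    IsClosed (Set.range (regRep : CrossedProduct α → CStarMatrix G G A)) := by
  have h : Set.range (regRep : CrossedProduct α → CStarMatrix G G A) =
      ⋂ s : G, ⋂ t : G, {M | M s t = α s⁻¹ (M 1 (t * s⁻¹))} := by
    ext M
    simp only [Set.mem_range, Set.mem_iInter, Set.mem_ofPred_eq]
    constructor
    · rintro ⟨x, rfl⟩ s t
      simp [regRep_apply]
    · intro h
      refine ⟨fun g => M 1 g⁻¹, ?_⟩
      ext s t
      change α s⁻¹ (M 1 (s * t⁻¹)⁻¹) = M s t
      rw [h s t, mul_inv_rev, inv_inv]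
  have hc : ∀ s t : G, Continuous fun M : CStarMatrix G G A => M s t := fun s t =>
    (continuous_apply t).comp (continuous_apply s)
  rw [h]
  exact isClosed_iInter fun s => isClosed_iInter fun t => isClosed_eq (hc s t)
    (((AddMonoidHomClass.isometry_of_norm (α s⁻¹)
      (StarAlgEquiv.norm_map (α s⁻¹))).continuous).comp (hc 1 (t * s⁻¹)))

instance : CompleteSpace (CrossedProduct α) := by
  have hu : IsUniformInducing (regRep : CrossedProduct α → CStarMatrix G G A) := ⟨rfl⟩
  exact (completeSpace_iff_isComplete_range hu).2 isClosed_range_regRep.isComplete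

/-- The finite crossed product as a `C*`-algebra; its norm is that of the regular representation
(a `*`-algebra that is complete in a `C*`-norm has no other `C*`-norm). -/
instance : CStarAlgebra (CrossedProduct α) where
  norm_mul_self_le x := by
    let _ := matrixCStarAlgebra G A
    change ‖regRep x‖ * ‖regRep x‖ ≤ ‖regRep (star x * x)‖
    rw [regRep_mul, regRep_star]
    exact CStarRing.norm_mul_self_le (regRep x)

end CrossedProduct

end CrossedProducts

/-! ### Simplicity and tracial rank -/

section TracialRank

/-- A `C*`-algebra is simple if it is nonzero and has no closed two-sided ideals besides `0` and
itself. -/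
def IsSimpleCStar (A : Type*) [CStarAlgebra A] : Prop :=
  Nontrivial A ∧ ∀ I : TwoSidedIdeal A, IsClosed (I : Set A) → I = ⊥ ∨ I = ⊤

/-- Approximation data for `F`, `ε`, `x`: a nonzero projection `p`, given as `φ 1` for a
`*`-homomorphism `φ : B → A` (that is, a unital `*`-homomorphism `φ : B → p A p`), with
`‖a p - p a‖ < ε` and `dist (p a p, φ(B)) < ε` for `a ∈ F`, such that `1 - p` is Murray-von Neumann
equivalent to a projection in the closure of `x A x`. -/
def IsTracialApprox {A B : Type*} [CStarAlgebra A] [CStarAlgebra B]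
    (F : Finset A) (ε : ℝ) (x : A) (p : A) (φ : B →⋆ₙₐ[ℂ] A) : Prop :=
  IsStarProjection p ∧ p ≠ 0 ∧ φ 1 = p ∧
  (∀ a ∈ F, ‖a * p - p * a‖ < ε) ∧
  (∀ a ∈ F, ∃ b : B, ‖p * a * p - φ b‖ < ε) ∧
  ∃ q : A, IsStarProjection q ∧ q ∈ closure {y | ∃ a : A, y = x * a * x} ∧
    ∃ v : A, star v * v = 1 - p ∧ v * star v = q

/-- `TR(A) ≤ 1`: for all finite `F`, `ε > 0` and all nonzero positive `x` there is a tracial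
approximation by an interval algebra `C([0,1]) ⊗ E = C([0,1], E)` with `E` finite dimensional. -/
def TracialRankLEOne (A : Type*) [CStarAlgebra A] : Prop :=
  ∀ (F : Finset A) (ε : ℝ), 0 < ε → ∀ x : A, (∃ y : A, x = star y * y) → x ≠ 0 →
    ∃ (E : Type) (_ : CStarAlgebra E) (_ : FiniteDimensional ℂ E) (p : A)
      (φ : C(unitInterval, E) →⋆ₙₐ[ℂ] A), IsTracialApprox F ε x p φ

/-- `TR(A) = 0`: as above, with a finite dimensional `C*`-algebra in place of the interval
algebra. -/
def TracialRankZero (A : Type*) [CStarAlgebra A] : Prop :=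
  ∀ (F : Finset A) (ε : ℝ), 0 < ε → ∀ x : A, (∃ y : A, x = star y * y) → x ≠ 0 →
    ∃ (E : Type) (_ : CStarAlgebra E) (_ : FiniteDimensional ℂ E) (p : A)
      (φ : E →⋆ₙₐ[ℂ] A), IsTracialApprox F ε x p φ

end TracialRank

end

end RokhlinAction

namespace RokhlinAction

noncomputable section

/-! ### The sequence algebra as a `C*`-algebra -/

section SeqAlgNorm

variable {A : Type*} [CStarAlgebra A]

/-! Call a unital `*`-homomorphism `ι : B → R` sequentially split if there is `ψ : R → B_∞` with `ψ
(ι b) = diag b`. The inclusion `A^α → A` and, for finite `G`, the regular representation `A ⋊ G →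
M_G(A)` are sequentially split, and simplicity and tracial rank pass from a simple `R` down to `B`.

Permanence. Let `φ : D → R` and `p = φ 1` be a tracial approximation in `R`. Finite-dimensional
algebras and interval algebras have stable relations, so `ψ ∘ φ : D → B_∞` lifts to `ℓ^∞(ℕ, B)`
(`exists_finiteDim_lift`, `exists_interval_lift`), and suitable late entries of the lift are
approximations in `B`. The partial isometry that compares `1 - p` with a projection in the closure
of `x R x` is pushed into `x B` by an approximate unit and made exact by a polar decomposition
(`polar_corner`). See `exists_isTracialApprox_of_sequentiallySplit`, and
`isSimpleRing_of_sequentiallySplit` for simplicity.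

Fixed points. As `A` is unital and separable, the Rokhlin property with `D = A` gives an equivariant
`φ : C(G) → A_∞ ∩ A'`. Together with the constant sequences it extends to `C(G, A)`; applied to the
orbit function `g ↦ α_g(a)` it yields an invariant element of `A_∞`, equal to `diag a` when `a` is
fixed (`exists_invariant_splitting`). Haar averaging represents these elements by sequences in
`A^α`.

Crossed products. The point masses on a finite `G` give projections `p g` in `A_∞ ∩ A'` that `G`
permutes. The elements `p s * u_(s t⁻¹)` are matrix units commuting with `∑ p s * α_s(a)`, and so
define the splitting on `M_G(A)` (`exists_sequentialSplitting_regRepHom`). It remains to bound the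
tracial rank of `M_G(A)`. Amplifying an approximation of `A` leaves `|G|` copies of `1 - p`, which
must fit orthogonally below a given nonzero positive matrix. This works if every `y ≠ 0` admits
`|G|` nonzero elements of `y A` with orthogonal ranges. If that failed for nontrivial `G`, then `A`
would have a minimal projection, the Rokhlin projections would be scalar sequences, and scalars are
fixed by `α`, which contradicts the permutation of the `p g` (`exists_orthogonal_pair`). -/

theorem mem_c0_iff {x : ℕ →ᵇ A} : x ∈ c0 A ↔ Tendsto (fun n => ‖x n‖) atTop (𝓝 0) := Iff.rfl

theorem eta_eq_zero_iff {x : ℕ →ᵇ A} :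
    eta A x = 0 ↔ Tendsto (fun n => ‖x n‖) atTop (𝓝 0) :=
  Ideal.Quotient.eq_zero_iff_mem

theorem eta_surjective : Function.Surjective (eta A) := Ideal.Quotient.mk_surjective

theorem eta_eq_iff {x y : ℕ →ᵇ A} :
    eta A x = eta A y ↔ Tendsto (fun n => ‖x n - y n‖) atTop (𝓝 0) := by
  rw [← sub_eq_zero, ← map_sub, eta_eq_zero_iff]
  rfl

/-- Bounded sequences from a bound on the entries. -/
def bddSeq (x : ℕ → A) (C : ℝ) (h : ∀ n, ‖x n‖ ≤ C) : ℕ →ᵇ A :=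
  BoundedContinuousFunction.ofNormedAddCommGroupDiscrete x C h

@[simp] theorem bddSeq_apply (x : ℕ → A) (C : ℝ) (h : ∀ n, ‖x n‖ ≤ C) (n : ℕ) :
    bddSeq x C h n = x n := rfl

/-- This makes the quotient seminorm of `A_∞` a norm. -/
theorem isClosed_c0 : IsClosed (c0 A : Set (ℕ →ᵇ A)) := by
  rw [← isSeqClosed_iff_isClosed]
  intro u x hu hx
  change Tendsto (fun n => ‖x n‖) atTop (𝓝 0)
  rw [Metric.tendsto_atTop]
  intro ε hε
  obtain ⟨k, hk⟩ := ((tendsto_iff_norm_sub_tendsto_zero.1 hx).eventually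
    (gt_mem_nhds (half_pos hε))).exists
  obtain ⟨N, hN⟩ := Metric.tendsto_atTop.1 (mem_c0_iff.1 (hu k)) _ (half_pos hε)
  refine ⟨N, fun n hn => ?_⟩
  have h1 := hN n hn
  rw [Real.dist_0_eq_abs, abs_norm] at h1 ⊢
  have h2 : ‖u k n - x n‖ ≤ ‖u k - x‖ := (u k - x).norm_coe_le_norm n
  have h3 : ‖x n‖ ≤ ‖u k n‖ + ‖u k n - x n‖ := by
    have := norm_sub_le (u k n) (u k n - x n)
    rwa [sub_sub_cancel] at this
  linarith

instance : IsClosed (c0 A : Set (ℕ →ᵇ A)) := isClosed_c0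

/-- Some representative of the class has norm below `r`, and it differs from `x` by a null sequence.
With `norm_eta_le` this identifies the quotient norm as the upper limit of `‖x n‖`; strict estimates
in `A_∞` thereby become estimates on all late entries. -/
theorem eventually_norm_lt {x : ℕ →ᵇ A} {r : ℝ} (h : ‖eta A x‖ < r) : ∀ᶠ n in atTop, ‖x n‖ < r := by
  obtain ⟨m, hm, hmr⟩ := Submodule.Quotient.norm_mk_lt (eta A x) (sub_pos.2 h)
  rw [add_sub_cancel] at hmr
  have h0 : eta A (x - m) = 0 := by
    rw [map_sub, sub_eq_zero]
    exact hm.symm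
  filter_upwards [(eta_eq_zero_iff.1 h0).eventually (gt_mem_nhds (sub_pos.2 hmr))] with n hn
  have h1 : ‖m n‖ ≤ ‖m‖ := m.norm_coe_le_norm n
  have h2 : ‖x n‖ ≤ ‖(x - m) n‖ + ‖m n‖ := by
    have := norm_add_le (x n - m n) (m n)
    rwa [sub_add_cancel] at this
  linarith

theorem norm_eta_le {x : ℕ →ᵇ A} {r : ℝ} (hr : 0 ≤ r) (h : ∀ᶠ n in atTop, ‖x n‖ ≤ r) :
    ‖eta A x‖ ≤ r := by
  obtain ⟨N, hN⟩ := eventually_atTop.1 h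
  let y : ℕ →ᵇ A := bddSeq (fun n => if N ≤ n then x n else 0) r fun n => by
    split_ifs with hn
    · exact hN n hn
    · simpa using hr
  have hy : eta A x = eta A y := by
    rw [eta_eq_iff]
    refine tendsto_const_nhds.congr' ?_
    filter_upwards [eventually_ge_atTop N] with n hn
    simp [y, hn]
  rw [hy]
  refine (Submodule.Quotient.norm_mk_le _ y).trans ?_
  exact (BoundedContinuousFunction.norm_le hr).2 fun n => by
    change ‖(if N ≤ n then x n else 0)‖ ≤ r
    split_ifs with hn
    · exact hN n hn
    · simpa using hr

/-- Submultiplicativity and the `C*`-inequality are read off from late entries up to an arbitrarily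
small error. -/
instance seqAlgCStarAlgebra : CStarAlgebra (SeqAlg A) where
  __ := (inferInstance : Ring (SeqAlg A))
  __ := (inferInstance : NormedAddCommGroup (SeqAlg A))
  __ := (inferInstance : Algebra ℂ (SeqAlg A))
  __ := (inferInstance : StarRing (SeqAlg A))
  __ := (inferInstance : StarModule ℂ (SeqAlg A))
  toCompleteSpace := inferInstance
  norm_smul_le c x := norm_smul_le c x
  norm_mul_le x y := by
    obtain ⟨x, rfl⟩ := eta_surjective x
    obtain ⟨y, rfl⟩ := eta_surjective y
    refine le_of_forall_pos_le_add fun ε hε => ?_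
    have hc : Tendsto (fun δ : ℝ => (‖eta A x‖ + δ) * (‖eta A y‖ + δ)) (𝓝[>] 0)
        (𝓝 (‖eta A x‖ * ‖eta A y‖)) := by
      have : Continuous fun δ : ℝ => (‖eta A x‖ + δ) * (‖eta A y‖ + δ) := by fun_prop
      simpa using this.continuousWithinAt (s := Set.Ioi (0 : ℝ)) (x := 0) |>.tendsto
    obtain ⟨δ, hδ, hδ0⟩ := ((hc.eventually (gt_mem_nhds (lt_add_of_pos_right _ hε))).and
      self_mem_nhdsWithin).exists
    have hδ0 : 0 < δ := hδ0
    refine le_trans ?_ hδ.le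
    change ‖eta A x * eta A y‖ ≤ _
    rw [← map_mul]
    refine norm_eta_le (by positivity) ?_
    filter_upwards [eventually_norm_lt (lt_add_of_pos_right ‖eta A x‖ hδ0),
      eventually_norm_lt (lt_add_of_pos_right ‖eta A y‖ hδ0)] with n hx hy
    exact (norm_mul_le (x n) (y n)).trans (by gcongr)
  norm_mul_self_le x := by
    obtain ⟨x, rfl⟩ := eta_surjective x
    refine le_of_forall_pos_le_add fun ε hε => ?_
    have h : ‖eta A x‖ ≤ √(‖star (eta A x) * eta A x‖ + ε) := by
      refine norm_eta_le (Real.sqrt_nonneg _) ?_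
      have h1 : ‖eta A (star x * x)‖ < ‖star (eta A x) * eta A x‖ + ε := by
        rw [map_mul, map_star]
        exact lt_add_of_pos_right _ hε
      filter_upwards [eventually_norm_lt h1] with n hn
      refine Real.le_sqrt_of_sq_le ?_
      rw [sq, ← CStarRing.norm_star_mul_self]
      exact hn.le
    calc ‖eta A x‖ * ‖eta A x‖ ≤ √(‖star (eta A x) * eta A x‖ + ε) *
          √(‖star (eta A x) * eta A x‖ + ε) := by gcongr
      _ = _ := Real.mul_self_sqrt (by positivity)

theorem norm_diag_le (a : A) : ‖diag a‖ ≤ ‖a‖ :=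
  norm_eta_le (norm_nonneg a) (Eventually.of_forall fun _ => le_rfl)

theorem norm_diag (a : A) : ‖diag a‖ = ‖a‖ := by
  refine le_antisymm (norm_diag_le a) (le_of_forall_gt fun r hr => ?_)
  obtain ⟨n, hn⟩ := (eventually_norm_lt hr).exists
  exact hn

/-- The embedding `A → A_∞` by constant sequences. -/
def diagHom (A : Type*) [CStarAlgebra A] : A →⋆ₐ[ℂ] SeqAlg A where
  toFun := diag
  map_one' := rfl
  map_mul' _ _ := rfl
  map_zero' := rfl
  map_add' _ _ := rfl
  commutes' _ := rfl
  map_star' := diag_star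

@[simp] theorem diagHom_apply (a : A) : diagHom A a = diag a := rfl

theorem diag_injective : Function.Injective (diag : A → SeqAlg A) := by
  intro a b h
  rw [← sub_eq_zero, ← norm_eq_zero, ← norm_diag]
  change ‖diagHom A (a - b)‖ = 0
  rw [map_sub, diagHom_apply, diagHom_apply, h, sub_self, norm_zero]

/-- Evaluation of bounded sequences at `n`. -/
def evalSeq (A : Type*) [CStarAlgebra A] (n : ℕ) : (ℕ →ᵇ A) →⋆ₐ[ℂ] A where
  toFun x := x n
  map_one' := rfl
  map_mul' _ _ := rfl
  map_zero' := rfl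
  map_add' _ _ := rfl
  commutes' _ := rfl
  map_star' _ := rfl

@[simp] theorem evalSeq_apply (n : ℕ) (x : ℕ →ᵇ A) : evalSeq A n x = x n := rfl

variable {B : Type*} [CStarAlgebra B]

/-- The entrywise application of a `*`-homomorphism to bounded sequences. -/
def seqHom (f : A →⋆ₐ[ℂ] B) : (ℕ →ᵇ A) →⋆ₐ[ℂ] (ℕ →ᵇ B) where
  toFun a := bddSeq (fun n => f (a n)) ‖a‖
    (fun n => (NonUnitalStarAlgHom.norm_apply_le f _).trans (a.norm_coe_le_norm n))
  map_one' := by ext n; simp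
  map_mul' a b := by ext n; simp
  map_zero' := by ext n; simp
  map_add' a b := by ext n; simp
  commutes' c := by
    ext n
    simp [Algebra.algebraMap_eq_smul_one]
  map_star' a := by ext n; simp [map_star]

@[simp] theorem seqHom_apply (f : A →⋆ₐ[ℂ] B) (a : ℕ →ᵇ A) (n : ℕ) : seqHom f a n = f (a n) := rfl

/-- The `*`-homomorphism `A_∞ → B_∞` induced by a `*`-homomorphism `A → B`. -/
def seqAlgHom (f : A →⋆ₐ[ℂ] B) : SeqAlg A →⋆ₐ[ℂ] SeqAlg B :=
  quotMap (c0 A) (c0 B) (seqHom f) fun a ha =>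
    squeeze_zero (fun _ => norm_nonneg _)
      (fun n => NonUnitalStarAlgHom.norm_apply_le f (a n)) ha

theorem seqAlgHom_eta (f : A →⋆ₐ[ℂ] B) (x : ℕ →ᵇ A) :
    seqAlgHom f (eta A x) = eta B (seqHom f x) := rfl

theorem seqAlgHom_diag (f : A →⋆ₐ[ℂ] B) (a : A) : seqAlgHom f (diag a) = diag (f a) := rfl

theorem seqAlgHom_injective (f : A →⋆ₐ[ℂ] B) (hf : Function.Injective f) :
    Function.Injective (seqAlgHom f) := by
  rw [injective_iff_map_eq_zero]
  intro x hx
  obtain ⟨x, rfl⟩ := eta_surjective x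
  rw [seqAlgHom_eta, eta_eq_zero_iff] at hx
  rw [eta_eq_zero_iff]
  refine hx.congr fun n => ?_
  exact NonUnitalStarAlgHom.norm_map f hf (x n)

end SeqAlgNorm

/-! ### Finite-dimensional `C*`-algebras -/

section FiniteDim

variable {E : Type*} [CStarAlgebra E]

/-- Spectral values are roots of the minimal polynomial. On a finite spectrum every function is
continuous, so the functional calculus supplies spectral projections. -/
theorem finite_spectrum_real [FiniteDimensional ℂ E] (y : E) : (spectrum ℝ y).Finite := by
  have : FiniteDimensional ℝ E := FiniteDimensional.complexToReal E
  have hy : IsIntegral ℝ y := Algebra.IsIntegral.isIntegral y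
  refine Set.Finite.subset ((minpoly ℝ y).rootSet_finite ℝ) fun t ht => ?_
  rw [Polynomial.mem_rootSet_of_ne (minpoly.ne_zero hy), Polynomial.coe_aeval_eq_eval]
  have h := spectrum.subset_polynomial_aeval y (minpoly ℝ y) ⟨t, ht, rfl⟩
  rw [minpoly.aeval] at h
  by_contra h0
  refine h ?_
  change IsUnit (algebraMap ℝ E _ - 0)
  rw [sub_zero]
  exact (IsUnit.mk0 _ h0).map (algebraMap ℝ E)

/-- A minimal projection: `e ≠ 0` and `e E e = ℂ e`. -/
structure IsMinimalProjection (e : E) : Prop where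
  isStarProjection : IsStarProjection e
  ne_zero : e ≠ 0
  corner : ∀ x : E, ∃ c : ℂ, e * x * e = c • e

/-- If the self-adjoint part of `f E f` consisted of multiples of `f`, real and imaginary parts
would make `f` minimal. Otherwise a spectral projection of a self-adjoint `y` in the corner that is
not a multiple of `f` is a proper subprojection. -/
theorem exists_projection_lt [FiniteDimensional ℂ E] {f : E} (hf : IsStarProjection f)
    (hf0 : f ≠ 0) (hmin : ¬ IsMinimalProjection f) :
    ∃ e : E, IsStarProjection e ∧ e ≠ 0 ∧ e ≠ f ∧ e * f = e ∧ f * e = e := by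
  have hff : f * f = f := hf.isIdempotentElem
  obtain ⟨y, hy, hfy, hyf, hyc⟩ : ∃ y : E, IsSelfAdjoint y ∧ f * y = y ∧ y * f = y ∧
      ∀ c : ℂ, y ≠ c • f := by
    by_contra! hcon
    refine hmin ⟨hf, hf0, fun x => ?_⟩
    have key : ∀ z : E, IsSelfAdjoint z → ∃ c : ℂ, f * z * f = c • f := fun z hz => by
      refine hcon (f * z * f) ?_ ?_ ?_
      · rw [isSelfAdjoint_iff, star_mul, star_mul, hf.isSelfAdjoint.star_eq, hz.star_eq, mul_assoc]
      · rw [← mul_assoc, ← mul_assoc, hff]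
      · rw [mul_assoc, hff]
    obtain ⟨a, ha⟩ := key _ (realPart x).2
    obtain ⟨b, hb⟩ := key _ (imaginaryPart x).2
    refine ⟨a + Complex.I * b, ?_⟩
    conv_lhs => rw [← realPart_add_I_smul_imaginaryPart x]
    rw [mul_add, add_mul, ha, mul_smul_comm, smul_mul_assoc, hb, smul_smul, add_smul]
  have hfin := finite_spectrum_real y
  -- The value must be nonzero: then the spectral projection is `t⁻¹` times its product with `y`,
  -- hence lies in the corner of `f`.
  obtain ⟨t, ht, ht0⟩ : ∃ t ∈ spectrum ℝ y, t ≠ 0 := by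
    by_contra! hcon
    refine hyc 0 ?_
    rw [zero_smul]
    exact CFC.eq_zero_of_spectrum_subset_zero (R := ℝ) y (fun t ht => hcon t ht) hy
  have hcont : ∀ g : ℝ → ℝ, ContinuousOn g (spectrum ℝ y) := fun g => hfin.continuousOn g
  let g : ℝ → ℝ := fun s => if s = t then 1 else 0
  have hgy : cfc g y * y = t • cfc g y := by
    conv_lhs => rw [← cfc_id' ℝ y hy]
    rw [← cfc_smul t g y (hcont _), cfc_id' ℝ y hy]
    conv_lhs => rw [← cfc_id' ℝ y hy, cfc_id' ℝ y hy]
    nth_rewrite 2 [← cfc_id' ℝ y hy]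
    rw [← cfc_mul g (fun s => s) y (hcont _) (hcont _)]
    refine cfc_congr fun s _ => ?_
    by_cases hs : s = t <;> simp [g, hs]
  have hgsa : IsSelfAdjoint (cfc g y) := cfc_predicate g y
  have hge : cfc g y * cfc g y = cfc g y := by
    rw [← cfc_mul g g y (hcont _) (hcont _)]
    refine cfc_congr fun s _ => ?_
    by_cases hs : s = t <;> simp [g, hs]
  have hef : cfc g y * f = cfc g y := by
    have h : (t • cfc g y) * f = t • cfc g y := by rw [← hgy, mul_assoc, hyf]
    rw [smul_mul_assoc] at h
    exact smul_right_injective E ht0 h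
  have hfe : f * cfc g y = cfc g y := by
    have := congrArg star hef
    rwa [star_mul, hf.isSelfAdjoint.star_eq, hgsa.star_eq] at this
  refine ⟨cfc g y, ⟨hge, hgsa⟩, ?_, ?_, hef, hfe⟩
  · intro h0
    rw [← cfc_const_zero ℝ y] at h0
    have := eqOn_of_cfc_eq_cfc h0 (hcont _) (hcont _) hy ht
    simp [g] at this
  · intro hgf
    refine hyc (t : ℂ) ?_
    rw [hgf, hfy] at hgy
    rw [hgy]
    exact (Complex.coe_smul t f).symm

/-- The corner `f E f`. -/
def cornerSubmodule (f : E) : Submodule ℂ E :=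
  LinearMap.range (LinearMap.mulLeft ℂ f ∘ₗ LinearMap.mulRight ℂ f)

theorem mem_cornerSubmodule {f x : E} (hf : f * f = f) :
    x ∈ cornerSubmodule f ↔ f * x * f = x := by
  constructor
  · rintro ⟨z, rfl⟩
    simp only [LinearMap.comp_apply, LinearMap.mulLeft_apply, LinearMap.mulRight_apply]
    rw [← mul_assoc f f, hf, mul_assoc, mul_assoc, hf]
  · intro h
    exact ⟨x, by simpa [mul_assoc] using h⟩

/-- Induction on the dimension of `f E f`: a projection that is not minimal splits as `e + (f - e)`,
and both summands have strictly smaller corners. -/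
theorem exists_minimal_decomposition [FiniteDimensional ℂ E] (f : E) (hf : IsStarProjection f) :
    ∃ s : Finset E, (∀ e ∈ s, IsMinimalProjection e) ∧
      (∀ e ∈ s, ∀ e' ∈ s, e ≠ e' → e * e' = 0) ∧ ∑ e ∈ s, e = f := by
  classical
  induction hn : Module.finrank ℂ (cornerSubmodule f) using Nat.strong_induction_on
    generalizing f with
  | _ n ih =>
  subst hn
  by_cases hf0 : f = 0
  · exact ⟨∅, by simp, by simp, by simp [hf0]⟩
  by_cases hmin : IsMinimalProjection f
  · exact ⟨{f}, by simpa using hmin, by simp, by simp⟩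
  obtain ⟨e, he, he0, hne, hef, hfe⟩ := exists_projection_lt hf hf0 hmin
  have hff : f * f = f := hf.isIdempotentElem
  have hee : e * e = e := he.isIdempotentElem
  have hlt : ∀ e : E, IsStarProjection e → e ≠ f → e * f = e → f * e = e →
      Module.finrank ℂ (cornerSubmodule e) < Module.finrank ℂ (cornerSubmodule f) := by
    intro e he hne hef hfe
    have hee : e * e = e := he.isIdempotentElem
    refine Submodule.finrank_lt_finrank_of_lt (lt_of_le_of_ne (fun x hx => ?_) fun heq => hne ?_)
    · rw [mem_cornerSubmodule hee] at hx
      rw [mem_cornerSubmodule hff, ← hx]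
      simp only [← mul_assoc, hfe]
      rw [mul_assoc _ e f, hef]
    · have : f ∈ cornerSubmodule e := heq ▸ (mem_cornerSubmodule hff).2 (by rw [hff, hff])
      rwa [mem_cornerSubmodule hee, hef, hee] at this
  have he' : IsStarProjection (f - e) := he.sub_of_mul_eq_left hf hef
  obtain ⟨s, hs, hso, hsum⟩ := ih _ (hlt e he hne hef hfe) e he rfl
  obtain ⟨s', hs', hso', hsum'⟩ := ih _ (hlt (f - e) he' (by simpa using he0)
    (by rw [sub_mul, hff, hef]) (by rw [mul_sub, hff, hfe])) (f - e) he' rfl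
  have hl : ∀ {s : Finset E} {f : E}, (∀ e ∈ s, IsMinimalProjection e) →
      (∀ e ∈ s, ∀ e' ∈ s, e ≠ e' → e * e' = 0) → ∑ e ∈ s, e = f → ∀ x ∈ s, x * f = x ∧ f * x = x := by
    rintro s f hs hso rfl x hx
    have hxx : x * x = x := (hs x hx).isStarProjection.isIdempotentElem
    rw [Finset.mul_sum, Finset.sum_mul, Finset.sum_eq_single_of_mem x hx,
      Finset.sum_eq_single_of_mem x hx]
    · exact ⟨hxx, hxx⟩
    · exact fun y hy hyx => hso y hy x hx hyx
    · exact fun y hy hyx => hso x hx y hy hyx.symm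
  have hort : e * (f - e) = 0 := by rw [mul_sub, hef, hee, sub_self]
  have hort' : (f - e) * e = 0 := by rw [sub_mul, hfe, hee, sub_self]
  have hss : ∀ x ∈ s, ∀ y ∈ s', x * y = 0 ∧ y * x = 0 := by
    intro x hx y hy
    obtain ⟨h1, h2⟩ := hl hs hso hsum x hx
    obtain ⟨h3, h4⟩ := hl hs' hso' hsum' y hy
    constructor
    · rw [← h1, ← h4, mul_assoc, ← mul_assoc e, hort, zero_mul, mul_zero]
    · rw [← h3, ← h2, mul_assoc, ← mul_assoc (f - e), hort', zero_mul, mul_zero]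
  have hdisj : Disjoint s s' := by
    rw [Finset.disjoint_left]
    intro x hx hx'
    have h := (hss x hx x hx').1
    rw [(hs x hx).isStarProjection.isIdempotentElem] at h
    exact (hs x hx).ne_zero h
  refine ⟨s ∪ s', ?_, ?_, ?_⟩
  · intro x hx
    rcases Finset.mem_union.1 hx with h | h
    exacts [hs x h, hs' x h]
  · intro x hx y hy hxy
    rcases Finset.mem_union.1 hx with h | h <;> rcases Finset.mem_union.1 hy with h' | h'
    exacts [hso x h y h' hxy, (hss x h y h').1, (hss y h' x h).2, hso' x h y h' hxy]
  · rw [Finset.sum_union hdisj, hsum, hsum', add_sub_cancel]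

/-- Matrix units of a finite-dimensional `C*`-algebra, in the form of partial isometries `v i` with
orthogonal ranges and with source projections `e (c i)`, such that the `v i * star (v j)` with
`c i = c j` span the algebra. -/
theorem exists_matrixUnits (E : Type*) [CStarAlgebra E] [FiniteDimensional ℂ E] :
    ∃ (κ : Type) (_ : Fintype κ) (_ : DecidableEq κ) (c : κ → κ) (e v : κ → E),
      (∀ i, IsStarProjection (e i)) ∧ (∀ i, e i ≠ 0) ∧
      (∀ i, star (v i) * v i = e (c i)) ∧ (∀ i j, i ≠ j → star (v i) * v j = 0) ∧
      (∀ x : E, x ∈ Submodule.span ℂ {y | ∃ i j, c i = c j ∧ y = v i * star (v j)}) := by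
  classical
  obtain ⟨s, hs, hso, hsum⟩ := exists_minimal_decomposition (1 : E) (IsStarProjection.one E)
  let κ := Fin s.card
  let e : κ → E := fun i => (s.equivFin.symm i : E)
  have hmin : ∀ i, IsMinimalProjection (e i) := fun i => hs _ (s.equivFin.symm i).2
  have hee : ∀ i, e i * e i = e i := fun i => (hmin i).isStarProjection.isIdempotentElem
  have hsa : ∀ i, star (e i) = e i := fun i => (hmin i).isStarProjection.isSelfAdjoint
  have hort : ∀ i j, i ≠ j → e i * e j = 0 := fun i j hij =>
    hso _ (s.equivFin.symm i).2 _ (s.equivFin.symm j).2 fun h =>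
      hij (s.equivFin.symm.injective (Subtype.ext h))
  have hone : ∑ i, e i = 1 := by
    rw [← hsum, ← Finset.sum_coe_sort s]
    exact s.equivFin.symm.sum_comp (fun x => (x : E))
  -- partial isometries between equivalent minimal projections
  have hiso : ∀ i j, (∃ z, e i * z * e j ≠ 0) →
      ∃ v, star v * v = e j ∧ v * star v = e i ∧ e i * v = v ∧ v * e j = v := by
    rintro i j ⟨z, hz⟩
    set w := e i * z * e j with hw
    have hiw : e i * w = w := by rw [hw, ← mul_assoc, ← mul_assoc, hee]
    have hwj : w * e j = w := by rw [hw, mul_assoc, hee]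
    obtain ⟨a, ha⟩ := (hmin j).corner (star w * w)
    obtain ⟨b, hb⟩ := (hmin i).corner (w * star w)
    have hjw : e j * star w = star w := by rw [← hsa j, ← star_mul, hwj]
    have hwi : star w * e i = star w := by rw [← hsa i, ← star_mul, hiw]
    rw [mul_assoc, mul_assoc, hwj, ← mul_assoc, hjw] at ha
    rw [mul_assoc, mul_assoc, hwi, ← mul_assoc, hiw] at hb
    have hnorm : ∀ k, ‖e k‖ = 1 := fun k => by
      have h1 : ‖e k‖ = ‖e k‖ * ‖e k‖ := by
        conv_lhs => rw [← hee k]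
        nth_rewrite 1 [← hsa k]
        rw [CStarRing.norm_star_mul_self]
      have h2 : ‖e k‖ ≠ 0 := norm_ne_zero_iff.2 (hmin k).ne_zero
      exact (mul_left_cancel₀ h2 (by rw [mul_one]; exact h1)).symm
    -- `a` is a positive real number
    have hab : a • w = b • w := by
      calc a • w = w * (a • e j) := by rw [mul_smul_comm, hwj]
        _ = (b • e i) * w := by rw [← ha, ← hb]; exact (mul_assoc w (star w) w).symm
        _ = b • w := by rw [smul_mul_assoc, hiw]
    have hab : a = b := smul_left_injective ℂ hz hab
    -- `star w * w = a • e j` is self-adjoint, so `a` is real; it is positive, so `a ≥ 0`; and `‖e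
    -- j‖ = 1` gives the modulus. Hence `‖w‖⁻¹ • w` is a partial isometry.
    have hapos : a = ((‖w‖ ^ 2 : ℝ) : ℂ) := by
      let _ := CStarAlgebra.spectralOrder E
      let _ := CStarAlgebra.spectralOrderedRing E
      have hre : (a.re : ℂ) = a := by
        have h := congrArg star ha
        rw [star_mul, star_star, star_smul, hsa, ha] at h
        have h2 := smul_left_injective ℂ (hmin j).ne_zero h
        exact Complex.conj_eq_iff_re.1 h2.symm
      have h0 : 0 ≤ a.re • e j := by
        have h1 : 0 ≤ star w * w := star_mul_self_nonneg w
        rwa [ha, ← hre, Complex.coe_smul] at h1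
      have hn : |a.re| = ‖w‖ ^ 2 := by
        have h1 := CStarRing.norm_star_mul_self (x := w)
        rw [ha, norm_smul, hnorm, mul_one, ← hre, Complex.norm_real] at h1
        rw [sq]
        exact h1
      have ha0 : 0 ≤ a.re := by
        by_contra hneg
        push Not at hneg
        have h1 : 0 ≤ (-a.re) • e j :=
          smul_nonneg (by linarith) (hmin j).isStarProjection.nonneg
        have h2 : a.re • e j = 0 := le_antisymm (by simpa using h1) h0
        rcases smul_eq_zero.1 h2 with h | h
        · exact hneg.ne h
        · exact (hmin j).ne_zero h
      rw [← hn, abs_of_nonneg ha0, hre]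
    have hw0 : (‖w‖ : ℂ) ≠ 0 := by
      rw [Complex.ofReal_ne_zero]
      exact norm_ne_zero_iff.2 hz
    refine ⟨(‖w‖ : ℂ)⁻¹ • w, ?_, ?_, ?_, ?_⟩
    · rw [star_smul, smul_mul_smul_comm, ha, smul_smul, hapos]
      simp only [star_inv₀, Complex.star_def, Complex.conj_ofReal]
      push_cast
      rw [sq]
      field_simp
      simp
    · rw [star_smul, smul_mul_smul_comm, hb, smul_smul, ← hab, hapos]
      simp only [star_inv₀, Complex.star_def, Complex.conj_ofReal]
      push_cast
      rw [sq]
      field_simp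
      simp
    · rw [mul_smul_comm, hiw]
    · rw [smul_mul_assoc, hwj]
  -- Two indices are related when their minimal projections lie in the same simple summand.
  -- Transitivity composes the partial isometries of `hiso`; the map `c` below picks a
  -- representative of each class.
  let r : Setoid κ :=
    { r := fun i j => ∃ z, e i * z * e j ≠ 0
      iseqv := by
        refine ⟨fun i => ⟨1, ?_⟩, ?_, ?_⟩
        · rw [mul_one, hee]
          exact (hmin i).ne_zero
        · rintro i j ⟨z, hz⟩
          refine ⟨star z, fun h => hz ?_⟩
          have := congrArg star h
          rwa [star_mul, star_mul, star_star, hsa, hsa, star_zero, ← mul_assoc] at this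
        · intro i j k hij hjk
          obtain ⟨v, hv1, hv2, hv3, hv4⟩ := hiso i j hij
          obtain ⟨w, hw1, hw2, hw3, hw4⟩ := hiso j k hjk
          refine ⟨v * w, fun h => (hmin k).ne_zero ?_⟩
          rw [← mul_assoc, hv3, mul_assoc, hw4] at h
          calc e k = star w * w := hw1.symm
            _ = star w * (e j * w) := by rw [hw3]
            _ = star w * star v * (v * w) := by
              rw [← hv1]
              simp only [mul_assoc]
            _ = 0 := by rw [h, mul_zero] }
  let c : κ → κ := fun i => (Quotient.mk r i).out
  have hc : ∀ i, r i (c i) := fun i => Setoid.symm (Quotient.mk_out (s := r) i)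
  choose v hv1 hv2 hv3 hv4 using fun i => hiso i (c i) (hc i)
  refine ⟨κ, inferInstance, inferInstance, c, e, v, fun i => (hmin i).isStarProjection,
    fun i => (hmin i).ne_zero, hv1, fun i j hij => ?_, fun x => ?_⟩
  · rw [← hv3 i, ← hv3 j, star_mul, hsa, mul_assoc, ← mul_assoc (e i), hort i j hij, zero_mul,
      mul_zero]
  · have hx : x = ∑ i, ∑ j, e i * x * e j := by
      simp_rw [← Finset.mul_sum, hone, mul_one, ← Finset.sum_mul, hone, one_mul]
    rw [hx]
    refine Submodule.sum_mem _ fun i _ => Submodule.sum_mem _ fun j _ => ?_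
    by_cases hij : e i * x * e j = 0
    · rw [hij]
      exact Submodule.zero_mem _
    -- A nonzero `e i * x * e j` puts `i` and `j` in one class, and `star (v i) * x * v j` then lies
    -- in the one-dimensional corner of `e (c i)`.
    · have hcij : c i = c j := congrArg Quotient.out (Quotient.sound (s := r) ⟨x, hij⟩)
      obtain ⟨a, ha⟩ := (hmin (c i)).corner (star (v i) * x * v j)
      have h1 : e (c i) * (star (v i) * x * v j) * e (c i) = star (v i) * x * v j := by
        rw [mul_assoc, mul_assoc, hcij, hv4, ← hcij, ← mul_assoc, ← hsa (c i), ← mul_assoc,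
          ← star_mul, hv4]
      rw [h1] at ha
      have h2 : e i * x * e j = a • (v i * star (v j)) := by
        calc e i * x * e j = v i * (star (v i) * x * v j) * star (v j) := by
              rw [← hv2 i, ← hv2 j]
              simp only [mul_assoc]
          _ = _ := by rw [ha, mul_smul_comm, hv4, smul_mul_assoc]
      rw [h2]
      exact Submodule.smul_mem _ _ (Submodule.subset_span ⟨i, j, hcij, rfl⟩)

end FiniteDim

/-! ### Lifting along `ℓ^∞ → ℓ^∞ / c₀` -/

section Polar

variable {A : Type*} [CStarAlgebra A]

theorem mul_eq_self_of_star_mul_self {v q : A} (hq : IsStarProjection q)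
    (hv : star v * v = q) : v * q = v := by
  rw [← sub_eq_zero, ← CStarRing.star_mul_self_eq_zero_iff]
  have hqq : q * q = q := hq.isIdempotentElem
  have h1 : star v * (v * q) = q := by rw [← mul_assoc, hv, hqq]
  have h2 : q * star v * v = q := by rw [mul_assoc, hv, hqq]
  have h3 : q * star v * (v * q) = q := by rw [mul_assoc, h1, hqq]
  rw [star_sub, star_mul, hq.isSelfAdjoint.star_eq, sub_mul, mul_sub, mul_sub, hv, h1, h2, h3]
  simp

theorem continuous_starAlgHom {B : Type*} [CStarAlgebra B] (φ : A →⋆ₐ[ℂ] B) : Continuous φ :=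
  (AddMonoidHomClass.lipschitz_of_bound φ 1 fun x => by
    simpa using NonUnitalStarAlgHom.norm_apply_le φ x).continuous

/-- The inverse square root of `y* y + (1 - f)`. -/
def invSqrtCorner (y f : A) : A := cfc (fun t : ℝ => (√t)⁻¹) (star y * y + (1 - f))

theorem spectrum_subset_of_norm_sub_one {b : A} {r : ℝ} (hb : ‖b - 1‖ ≤ r) :
    spectrum ℝ b ⊆ Set.Icc (1 - r) (1 + r) := by
  intro t ht
  have h : t - 1 ∈ spectrum ℝ (b - 1) := by
    have := spectrum.sub_singleton_eq (R := ℝ) b 1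
    rw [map_one] at this
    rw [← this]
    exact ⟨t, ht, 1, rfl, rfl⟩
  have h2 : ‖t - 1‖ ≤ r := by
    rcases subsingleton_or_nontrivial A with hA | hA
    · rw [Subsingleton.elim b 0, spectrum.of_subsingleton] at ht
      exact absurd ht (Set.notMem_empty t)
    · exact (spectrum.norm_le_norm_of_mem h).trans hb
  rw [Real.norm_eq_abs, abs_le] at h2
  exact ⟨by linarith [h2.1], by linarith [h2.2]⟩

/-- Adding `1 - f` to `star y * y` gives an element `b` within `1/2` of `1`, so `b` is positive and
invertible, and its inverse square root `z` commutes with `f`. Since `star y * y = b * f`, it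
follows that `z * (star y * y) * z = f`. An approximate partial isometry thus becomes one with
source projection exactly `f`. -/
theorem polar_corner {y f : A} (hf : IsStarProjection f) (hyf : y * f = y)
    (h : ‖star y * y - f‖ ≤ 1 / 2) :
    star (y * invSqrtCorner y f) * (y * invSqrtCorner y f) = f ∧
      Commute (invSqrtCorner y f) f := by
  have hff : f * f = f := hf.isIdempotentElem
  have hfs : star f = f := hf.isSelfAdjoint
  set b := star y * y + (1 - f) with hb
  have hbsa : IsSelfAdjoint b :=
    (IsSelfAdjoint.star_mul_self y).add ((IsSelfAdjoint.one A).sub hf.isSelfAdjoint)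
  have hfy : f * star y = star y := by
    rw [← hfs, ← star_mul, hyf]
  have hbf : b * f = star y * y := by
    rw [hb, add_mul, mul_assoc, hyf, sub_mul, one_mul, hff, sub_self, add_zero]
  have hfb : f * b = star y * y := by
    rw [hb, mul_add, ← mul_assoc, hfy, mul_sub, mul_one, hff, sub_self, add_zero]
  have hsp : spectrum ℝ b ⊆ Set.Icc (1 - 1 / 2) (1 + 1 / 2) := by
    refine spectrum_subset_of_norm_sub_one ?_
    rw [hb]
    convert h using 2
    abel
  have hpos : ∀ t ∈ spectrum ℝ b, 0 < t := fun t ht => by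
    have := (hsp ht).1
    linarith
  have hcont : ContinuousOn (fun t : ℝ => (√t)⁻¹) (spectrum ℝ b) :=
    Real.continuous_sqrt.continuousOn.inv₀ fun t ht => (Real.sqrt_pos.2 (hpos t ht)).ne'
  have hz : invSqrtCorner y f = cfc (fun t : ℝ => (√t)⁻¹) b := rfl
  have hcomm : Commute (invSqrtCorner y f) f := by
    rw [hz]
    exact Commute.cfc_real (show Commute b f from hbf.trans hfb.symm) _
  have hzs : star (invSqrtCorner y f) = invSqrtCorner y f :=
    (cfc_predicate (fun t : ℝ => (√t)⁻¹) b : IsSelfAdjoint _)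
  have hzbz : invSqrtCorner y f * b * invSqrtCorner y f = 1 := by
    rw [hz]
    nth_rewrite 2 [← cfc_id' ℝ b hbsa]
    rw [← cfc_mul _ _ b hcont (by fun_prop), ← cfc_mul (fun t : ℝ => (√t)⁻¹ * t) _ b (hcont.mul (by fun_prop)) hcont,
      ← cfc_const_one ℝ b]
    refine cfc_congr fun t ht => ?_
    have := Real.mul_self_sqrt (hpos t ht).le
    have h0 := (Real.sqrt_pos.2 (hpos t ht)).ne'
    field_simp
    rw [sq, this]
  refine ⟨?_, hcomm⟩
  calc star (y * invSqrtCorner y f) * (y * invSqrtCorner y f)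
      = invSqrtCorner y f * (star y * y) * invSqrtCorner y f := by
        rw [star_mul, hzs]
        simp only [mul_assoc]
    _ = invSqrtCorner y f * b * (f * invSqrtCorner y f) := by rw [← hbf]; simp only [mul_assoc]
    _ = invSqrtCorner y f * b * invSqrtCorner y f * f := by rw [← hcomm.eq, ← mul_assoc]
    _ = f := by rw [hzbz, one_mul]

/-- The polar correction is invisible in a quotient where `star y * y` already equals `f`: there `b`
becomes `1`. -/
theorem map_invSqrtCorner {B : Type*} [CStarAlgebra B] (φ : A →⋆ₐ[ℂ] B) {y f : A}
    (hf : IsStarProjection f) (h : ‖star y * y - f‖ ≤ 1 / 2) (hφ : φ (star y * y) = φ f) :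
    φ (invSqrtCorner y f) = 1 := by
  have hbsa : IsSelfAdjoint (star y * y + (1 - f)) :=
    (IsSelfAdjoint.star_mul_self y).add ((IsSelfAdjoint.one A).sub hf.isSelfAdjoint)
  have hsp : spectrum ℝ (star y * y + (1 - f)) ⊆ Set.Icc (1 - 1 / 2) (1 + 1 / 2) := by
    refine spectrum_subset_of_norm_sub_one ?_
    convert h using 2
    abel
  have hcont : ContinuousOn (fun t : ℝ => (√t)⁻¹) (spectrum ℝ (star y * y + (1 - f))) :=
    Real.continuous_sqrt.continuousOn.inv₀ fun t ht => by
      have := (hsp ht).1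
      exact (Real.sqrt_pos.2 (by linarith)).ne'
  have h1 : φ (star y * y + (1 - f)) = 1 := by
    rw [map_add, map_sub, map_one, hφ, add_sub_cancel]
  rw [invSqrtCorner]
  have hmap := StarAlgHomClass.map_cfc (S := ℂ) φ (fun t : ℝ => (√t)⁻¹) (star y * y + (1 - f)) hcont
    (continuous_starAlgHom φ) hbsa (hbsa.map φ)
  rw [hmap, h1, ← map_one (algebraMap ℝ B), cfc_algebraMap]
  simp

/-- At `t = 1/2` one has `|t² - t| = 1/4 > 1/8`, so the spectrum of `b` has a gap there and the step
function `g` is continuous on it. On the spectrum of the projection `π b`, which consists of `0` and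
`1` at most, `g` is the identity. -/
theorem exists_projection_map_eq {R Q : Type*} [CStarAlgebra R] [CStarAlgebra Q] (π : R →⋆ₐ[ℂ] Q)
    {b : R} (hbsa : IsSelfAdjoint b) (hN : ‖b * b - b‖ ≤ 1 / 8) (hp : IsStarProjection (π b)) :
    ∃ P : R, IsStarProjection P ∧ π P = π b := by
  have hsp : ∀ t ∈ spectrum ℝ b, |t * t - t| ≤ 1 / 8 := by
    intro t ht
    have h1 : (fun t : ℝ => t * t - t) t ∈ spectrum ℝ (b * b - b) := by
      have h2 : b * b - b = cfc (fun t : ℝ => t * t - t) b := by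
        rw [cfc_sub (fun t : ℝ => t * t) (fun t => t) b, cfc_mul (fun t : ℝ => t) (fun t => t) b,
          cfc_id' ℝ b hbsa]
      rw [h2, cfc_map_spectrum (fun t : ℝ => t * t - t) b hbsa]
      exact ⟨t, ht, rfl⟩
    rcases subsingleton_or_nontrivial R with hA | hA
    · rw [Subsingleton.elim b 0, spectrum.of_subsingleton] at ht
      exact absurd ht (Set.notMem_empty t)
    · exact (spectrum.norm_le_norm_of_mem h1).trans hN
  let g : ℝ → ℝ := fun t => if t ≤ 1 / 2 then 0 else 1
  have hcont : ContinuousOn g (spectrum ℝ b) := by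
    intro t ht
    have hne : t ≠ 1 / 2 := by
      rintro rfl
      have := hsp _ ht
      norm_num [abs_le] at this
    rcases lt_or_gt_of_ne hne with hlt | hgt
    · refine ContinuousAt.continuousWithinAt ?_
      refine (continuousAt_const (y := (0 : ℝ))).congr ?_
      filter_upwards [gt_mem_nhds hlt] with s hs
      simpa [g] using hs.le
    · refine ContinuousAt.continuousWithinAt ?_
      refine (continuousAt_const (y := (1 : ℝ))).congr ?_
      filter_upwards [lt_mem_nhds hgt] with s hs
      simpa [g] using hs
  refine ⟨cfc g b, ⟨?_, cfc_predicate g b⟩, ?_⟩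
  · change cfc g b * cfc g b = cfc g b
    rw [← cfc_mul g g b hcont hcont]
    refine cfc_congr fun t _ => ?_
    by_cases h : t ≤ 2⁻¹ <;> simp [g, h]
  · rw [StarAlgHomClass.map_cfc (S := ℂ) π g b hcont (continuous_starAlgHom π) hbsa
      (hbsa.map π)]
    conv_rhs => rw [← cfc_id' ℝ (π b) (hbsa.map π)]
    refine cfc_congr fun t ht => ?_
    rcases (isStarProjection_iff_spectrum_subset_and_isSelfAdjoint.1 hp).1 ht with h | h
    · simp [g, h]
    · rw [Set.mem_singleton_iff.1 h]
      norm_num [g]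

end Polar

/-! ### Truncation of sequences; lifting projections and partial isometries. -/

section Cut

variable {A : Type*} [CStarAlgebra A]

/-- The `*`-endomorphism of `ℓ^∞(ℕ, A)` that replaces the entries below `N` by zero. -/
def cut (A : Type*) [CStarAlgebra A] (N : ℕ) : (ℕ →ᵇ A) →⋆ₙₐ[ℂ] (ℕ →ᵇ A) where
  toFun x := bddSeq (fun n => if N ≤ n then x n else 0) ‖x‖ fun n => by
    split_ifs
    · exact x.norm_coe_le_norm n
    · simp
  map_smul' c x := by
    ext n
    by_cases h : N ≤ n <;> simp [h]
  map_zero' := by ext n; simp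
  map_add' x y := by
    ext n
    by_cases h : N ≤ n <;> simp [h]
  map_mul' x y := by
    ext n
    by_cases h : N ≤ n <;> simp [h]
  map_star' x := by
    ext n
    by_cases h : N ≤ n <;> simp [h]

theorem cut_apply (N : ℕ) (x : ℕ →ᵇ A) (n : ℕ) : cut A N x n = if N ≤ n then x n else 0 := rfl

theorem eta_cut (N : ℕ) (x : ℕ →ᵇ A) : eta A (cut A N x) = eta A x := by
  rw [eta_eq_iff]
  refine tendsto_const_nhds.congr' ?_
  filter_upwards [eventually_ge_atTop N] with n hn
  simp [cut_apply, hn]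

theorem norm_cut_le {N : ℕ} {x : ℕ →ᵇ A} {r : ℝ} (hr : 0 ≤ r) (h : ∀ n, N ≤ n → ‖x n‖ ≤ r) :
    ‖cut A N x‖ ≤ r :=
  (BoundedContinuousFunction.norm_le hr).2 fun n => by
    rw [cut_apply]
    split_ifs with hn
    · exact h n hn
    · simpa using hr

/-- Truncation leaves the class in `A_∞` unchanged and turns a relation that holds in `A_∞` into one
that holds in `ℓ^∞` up to a small norm error. -/
theorem exists_norm_cut_le {x : ℕ →ᵇ A} {r : ℝ} (hr : 0 < r) (h : eta A x = 0) :
    ∃ N, ‖cut A N x‖ ≤ r := by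
  obtain ⟨N, hN⟩ := eventually_atTop.1 (eventually_norm_lt (x := x) (r := r) (by simpa [h] using hr))
  exact ⟨N, norm_cut_le hr.le fun n hn => (hN n hn).le⟩

theorem exists_selfAdjoint_lift {h : SeqAlg A} (hh : IsSelfAdjoint h) :
    ∃ a : ℕ →ᵇ A, IsSelfAdjoint a ∧ eta A a = h := by
  obtain ⟨a, rfl⟩ := eta_surjective h
  refine ⟨(2⁻¹ : ℂ) • (a + star a), ?_, ?_⟩
  · rw [isSelfAdjoint_iff, star_smul, star_add, star_star, add_comm]
    simp
  · rw [map_smul, map_add, map_star, hh.star_eq, ← two_smul ℂ, smul_smul]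
    simp

theorem exists_projection_lift {p : SeqAlg A} (hp : IsStarProjection p) :
    ∃ P : ℕ →ᵇ A, IsStarProjection P ∧ eta A P = p := by
  obtain ⟨a, ha, rfl⟩ := exists_selfAdjoint_lift hp.isSelfAdjoint
  obtain ⟨N, hN⟩ := exists_norm_cut_le (x := a * a - a) (r := 1 / 8) (by norm_num) (by
    rw [map_sub, map_mul, hp.isIdempotentElem.eq, sub_self])
  rw [← eta_cut N] at hp ⊢
  rw [map_sub, map_mul] at hN
  exact exists_projection_map_eq (eta A) (ha.map (cut A N)) hN hp

/-- After truncation `star V * V` is within `1/2` of `f` in norm, so the polar correction applies;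
it does not change the class. -/
theorem exists_isometry_lift {V f : ℕ →ᵇ A} (hf : IsStarProjection f) (hV : V * f = V)
    (h : eta A (star V * V) = eta A f) :
    ∃ (N : ℕ) (z : ℕ →ᵇ A), eta A (cut A N V * z) = eta A V ∧
      star (cut A N V * z) * (cut A N V * z) = cut A N f := by
  obtain ⟨N, hN⟩ := exists_norm_cut_le (x := star V * V - f) (r := 1 / 2) (by norm_num) (by
    rw [map_sub, h, sub_self])
  rw [map_sub, map_mul, map_star] at hN
  have hf' : IsStarProjection (cut A N f) := hf.map (cut A N)
  refine ⟨N, invSqrtCorner (cut A N V) (cut A N f), ?_, ?_⟩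
  · rw [map_mul, map_invSqrtCorner (eta A) hf' hN, mul_one, eta_cut]
    rw [← map_star, ← map_mul, eta_cut, eta_cut, h]
  · exact (polar_corner hf' (by rw [← map_mul, hV]) hN).1

theorem cut_cut (N N' : ℕ) (x : ℕ →ᵇ A) : cut A N (cut A N' x) = cut A (max N N') x := by
  ext n
  simp only [cut_apply, max_le_iff]
  by_cases h : N ≤ n <;> by_cases h' : N' ≤ n <;> simp [h, h']

/-- Lifting of finite families of partial isometries with orthogonal ranges. -/
theorem exists_isometries_lift {κ : Type*} (v : κ → SeqAlg A)
    (f : κ → ℕ →ᵇ A) (hf : ∀ i, IsStarProjection (f i))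
    (hvf : ∀ i, star (v i) * v i = eta A (f i)) (hv : ∀ i j, i ≠ j → star (v i) * v j = 0)
    (s : Finset κ) :
    ∃ (N : ℕ) (V : κ → ℕ →ᵇ A), (∀ i ∈ s, eta A (V i) = v i) ∧
      (∀ i ∈ s, star (V i) * V i = cut A N (f i)) ∧
      (∀ i ∈ s, ∀ j ∈ s, i ≠ j → star (V i) * V j = 0) := by
  classical
  induction s using Finset.induction_on with
  | empty => exact ⟨0, 0, by simp, by simp, by simp⟩
  | insert i s hi ih =>
  obtain ⟨N, V, hV, hVV, hVo⟩ := ih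
  obtain ⟨a, ha⟩ := eta_surjective (v i)
  set g := ∑ j ∈ s, V j * star (V j) with hg
  have hgs : star g = g := by
    rw [hg, star_sum]
    exact Finset.sum_congr rfl fun j _ => by rw [star_mul, star_star]
  have hgV : ∀ j ∈ s, star (V j) * g = star (V j) := by
    intro j hj
    have hp : IsStarProjection (cut A N (f j)) := (hf j).map (cut A N)
    rw [hg, Finset.mul_sum, Finset.sum_eq_single_of_mem j hj]
    · rw [← mul_assoc, hVV j hj, ← hp.isSelfAdjoint.star_eq, ← star_mul,
        mul_eq_self_of_star_mul_self hp (hVV j hj)]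
    · intro k hk hkj
      rw [← mul_assoc, hVo j hj k hk hkj.symm, zero_mul]
  have hvfi : v i * eta A (f i) = v i := mul_eq_self_of_star_mul_self ((hf i).map (eta A)) (hvf i)
  have hgv : eta A g * v i = 0 := by
    rw [hg, map_sum, Finset.sum_mul]
    refine Finset.sum_eq_zero fun j hj => ?_
    rw [map_mul, map_star, hV j hj, mul_assoc, hv j i (fun h => hi (h ▸ hj)), mul_zero]
  -- Here `g` is the sum of the range projections lifted so far. Compressing by `1 - g` makes the
  -- new range exactly orthogonal to them, while the class stays `v i` because `g` annihilates `v i`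
  -- in the quotient.
  set W := (1 - g) * a * f i with hW
  have hWeta : eta A W = v i := by
    rw [hW, map_mul, map_mul, map_sub, map_one, ha, sub_mul, hgv, one_mul, sub_zero, hvfi]
  have hWf : W * f i = W := by
    rw [hW, mul_assoc, (hf i).isIdempotentElem.eq]
  obtain ⟨N', z, hz1, hz2⟩ := exists_isometry_lift (hf i) hWf (by
    rw [map_mul, map_star, hWeta, hvf])
  have hVW : ∀ j ∈ s, star (V j) * W = 0 := fun j hj => by
    rw [hW, ← mul_assoc, ← mul_assoc, mul_sub, mul_one, hgV j hj, sub_self, zero_mul, zero_mul]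
  -- The old isometries already carry the cutoff `N` and receive `N'`, the new one carries `N'` and
  -- receives `N`: all source projections end up cut at the maximum.
  set U := cut A N (cut A N' W * z) with hU
  have hVU : ∀ j ∈ s, star (cut A N' (V j)) * U = 0 := fun j hj => by
    rw [hU, map_mul, cut_cut, max_comm, ← cut_cut, ← mul_assoc, ← map_star, ← map_mul]
    have : star (V j) * cut A N W = 0 := by
      have h1 := congrArg (cut A N) (hVW j hj)
      ext n
      have h2 : (if N ≤ n then star (V j n) * W n else 0) = if N ≤ n then 0 else 0 :=
        DFunLike.congr_fun h1 n
      change star (V j n) * cut A N W n = 0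
      rw [cut_apply]
      by_cases hn : N ≤ n
      · rw [if_pos hn, if_pos hn] at h2
        rw [if_pos hn]
        exact h2
      · rw [if_neg hn, mul_zero]
    rw [this, map_zero, zero_mul]
  refine ⟨max N' N, fun j => if j = i then U else cut A N' (V j), ?_, ?_, ?_⟩
  · intro j hj
    by_cases hji : j = i
    · subst hji
      simp only [if_true]
      rw [hU, eta_cut, hz1, hWeta]
    · simp only [if_neg hji]
      rw [eta_cut, hV j ((Finset.mem_insert.1 hj).resolve_left hji)]
  · intro j hj
    by_cases hji : j = i
    · subst hji
      simp only [if_true]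
      rw [hU, ← map_star, ← map_mul, hz2, cut_cut, max_comm]
    · simp only [if_neg hji]
      rw [← map_star, ← map_mul, hVV j ((Finset.mem_insert.1 hj).resolve_left hji), cut_cut]
  · intro j hj k hk hjk
    by_cases hji : j = i <;> by_cases hki : k = i
    · exact absurd (hji.trans hki.symm) hjk
    · simp only [if_neg hki, if_pos hji]
      have := congrArg star (hVU k ((Finset.mem_insert.1 hk).resolve_left hki))
      rwa [star_mul, star_star, star_zero] at this
    · simp only [if_neg hji, if_pos hki]
      exact hVU j ((Finset.mem_insert.1 hj).resolve_left hji)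
    · simp only [if_neg hji, if_neg hki]
      rw [← map_star, ← map_mul, hVo j ((Finset.mem_insert.1 hj).resolve_left hji) k
        ((Finset.mem_insert.1 hk).resolve_left hki) hjk, map_zero]

end Cut

/-! ### Interval algebras lift along `ℓ^∞ → ℓ^∞ / c₀` -/

section Tensor

variable {X E : Type*} [TopologicalSpace X] [CStarAlgebra E]

/-- The elementary tensor `g ⊗ x ∈ C(X) ⊗ E = C(X, E)`. -/
def tmulFun (g : C(X, ℂ)) (x : E) : C(X, E) := ⟨fun t => g t • x, by fun_prop⟩

@[simp] theorem tmulFun_apply (g : C(X, ℂ)) (x : E) (t : X) : tmulFun g x t = g t • x := rfl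

theorem tmulFun_mul (g g' : C(X, ℂ)) (x x' : E) :
    tmulFun g x * tmulFun g' x' = tmulFun (g * g') (x * x') := by
  ext t
  simp [smul_smul, mul_comm]

theorem star_tmulFun (g : C(X, ℂ)) (x : E) : star (tmulFun g x) = tmulFun (star g) (star x) := by
  ext t
  simp

variable {U : Type*} [FiniteDimensional ℂ E] (b : Module.Basis U ℂ E)

/-- The coordinate functions of `f ∈ C(X, E)` in a basis of `E`. -/
def coordFun (u : U) : C(X, E) →ₗ[ℂ] C(X, ℂ) where
  toFun f := ⟨fun t => b.coord u (f t),
    (LinearMap.continuous_of_finiteDimensional (b.coord u)).comp f.continuous⟩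
  map_add' f g := by ext t; simp
  map_smul' c f := by ext t; simp

variable [Fintype U] in
theorem sum_coordFun (f : C(X, E)) : ∑ u, tmulFun (coordFun b u f) (b u) = f := by
  ext t
  rw [ContinuousMap.sum_apply]
  exact b.sum_repr (f t)

theorem coordFun_tmulFun (u : U) (g : C(X, ℂ)) (x : E) :
    coordFun b u (tmulFun g x) = b.coord u x • g := by
  ext t
  simp [coordFun, mul_comm]

variable [CompactSpace X] [Fintype U] {R : Type*} [CStarAlgebra R]

/-- The linear map `C(X, E) → R` given by a pair of linear maps on `C(X)` and `E`. -/
def tensorLinear (ρ : C(X, ℂ) →⋆ₐ[ℂ] R) (Θ : E →⋆ₙₐ[ℂ] R) : C(X, E) →ₗ[ℂ] R where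
  toFun f := ∑ u, ρ (coordFun b u f) * Θ (b u)
  map_add' f g := by simp [add_mul, Finset.sum_add_distrib]
  map_smul' c f := by simp [Finset.smul_sum]

theorem tensorLinear_tmulFun (ρ : C(X, ℂ) →⋆ₐ[ℂ] R) (Θ : E →⋆ₙₐ[ℂ] R) (g : C(X, ℂ)) (x : E) :
    tensorLinear b ρ Θ (tmulFun g x) = ρ g * Θ x := by
  change ∑ u, ρ (coordFun b u (tmulFun g x)) * Θ (b u) = _
  simp only [coordFun_tmulFun, map_smul, smul_mul_assoc]
  simp only [← mul_smul_comm, ← Finset.mul_sum, ← map_smul, ← map_sum]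
  congr 2
  exact b.sum_repr x

/-- The `*`-homomorphism `C(X, E) → R` given by commuting `*`-homomorphisms on `C(X)` and `E`. -/
def tensorHom (ρ : C(X, ℂ) →⋆ₐ[ℂ] R) (Θ : E →⋆ₙₐ[ℂ] R) (hc : ∀ g x, Commute (ρ g) (Θ x)) :
    C(X, E) →⋆ₙₐ[ℂ] R where
  toFun := tensorLinear b ρ Θ
  map_smul' := map_smul _
  map_zero' := map_zero _
  map_add' := map_add _
  map_mul' f f' := by
    rw [← sum_coordFun b f, ← sum_coordFun b f']
    simp only [Finset.sum_mul_sum, map_sum, tmulFun_mul, tensorLinear_tmulFun, map_mul]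
    refine Finset.sum_congr rfl fun u _ => Finset.sum_congr rfl fun u' _ => ?_
    rw [mul_assoc, mul_assoc, ← mul_assoc (ρ _) (Θ _) (Θ _), (hc _ _).eq, mul_assoc]
  map_star' f := by
    rw [← sum_coordFun b f]
    simp only [star_sum, map_sum, star_tmulFun, tensorLinear_tmulFun, map_star, star_mul]
    refine Finset.sum_congr rfl fun u _ => ?_
    rw [← map_star ρ, ← map_star Θ]
    exact (hc _ _).eq

end Tensor

/-! ### Lifting homomorphisms from finite-dimensional algebras and from interval algebras. -/

section Interval

/-- Stone–Weierstrass: the equalizer is a closed `*`-subalgebra that contains a function separating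
points. -/
theorem starAlgHom_unitInterval_ext {Q : Type*} [CStarAlgebra Q]
    {φ ψ : C(unitInterval, ℂ) →⋆ₐ[ℂ] Q}
    (h : φ ⟨fun t => ((t : ℝ) : ℂ), by fun_prop⟩ = ψ ⟨fun t => ((t : ℝ) : ℂ), by fun_prop⟩) :
    φ = ψ := by
  have htop := ContinuousMap.starSubalgebra_topologicalClosure_eq_top_of_separatesPoints
    (StarAlgHom.equalizer φ ψ) (by
      intro s t hst
      refine ⟨_, ⟨⟨fun t => ((t : ℝ) : ℂ), by fun_prop⟩, h, rfl⟩, fun h => hst ?_⟩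
      exact Subtype.ext (Complex.ofReal_injective h))
  have hcl : IsClosed (StarAlgHom.equalizer φ ψ : Set C(unitInterval, ℂ)) :=
    isClosed_eq (continuous_starAlgHom φ) (continuous_starAlgHom ψ)
  ext f
  have hf : f ∈ (StarAlgHom.equalizer φ ψ).topologicalClosure := htop ▸ StarSubalgebra.mem_top
  rw [← SetLike.mem_coe, StarSubalgebra.topologicalClosure_coe, hcl.closure_eq] at hf
  exact hf

/-- `C([0,1], E)` is generated by the constants `E` and the coordinate function, which commute. A
lift of `E` and a self-adjoint lift `H` of the coordinate function that commutes with it combine,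
through the functional calculus of `H`, to a lift of `θ`. -/
theorem exists_lift_of_commutant_lift {E R Q : Type*} [CStarAlgebra E] [FiniteDimensional ℂ E]
    [CStarAlgebra R] [CStarAlgebra Q] (π : R →⋆ₐ[ℂ] Q) (θ : C(unitInterval, E) →⋆ₙₐ[ℂ] Q)
    (Θ : E →⋆ₙₐ[ℂ] R) (hΘ : ∀ x, π (Θ x) = θ (tmulFun 1 x)) (H : R) (hH : IsSelfAdjoint H)
    (hHc : ∀ x, Commute H (Θ x))
    (hHθ : π H = θ (tmulFun ⟨fun t => ((t : ℝ) : ℂ), by fun_prop⟩ 1)) :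
    ∃ Ψ : C(unitInterval, E) →⋆ₙₐ[ℂ] R, ∀ f, π (Ψ f) = θ f := by
  -- The spectrum of `H` may leave `[0,1]`. Clamping it has no effect after `π`, because the
  -- spectrum of `π H` lies in `[0,1]`.
  let k : C(spectrum ℂ H, unitInterval) :=
    ⟨fun z => Set.projIcc (0 : ℝ) 1 zero_le_one (z : ℂ).re, by fun_prop⟩
  have hHn : IsStarNormal H := hH.isStarNormal
  let ρ : C(unitInterval, ℂ) →⋆ₐ[ℂ] R :=
    (cfcHom (R := ℂ) hHn).comp (ContinuousMap.compStarAlgHom' ℂ ℂ k)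
  have hρc : ∀ g x, Commute (ρ g) (Θ x) := fun g x =>
    Commute.cfcHom hHn (hHc x) (by rw [hH.star_eq]; exact hHc x) _
  -- the unital extension of `g ↦ θ (g ⊗ 1)`
  let φ : C(unitInterval, ℂ) →⋆ₐ[ℂ] Q :=
    { toFun := fun g => θ (tmulFun g 1) + g 0 • (1 - θ (tmulFun 1 1))
      map_one' := by simp
      map_mul' := fun g g' => by
        have h1 : θ (tmulFun g 1) * θ (tmulFun 1 1) = θ (tmulFun g 1) := by
          rw [← map_mul, tmulFun_mul, mul_one, mul_one]
        have h2 : θ (tmulFun 1 1) * θ (tmulFun g' 1) = θ (tmulFun g' 1) := by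
          rw [← map_mul, tmulFun_mul, one_mul, mul_one]
        have h3 : θ (tmulFun 1 (1 : E)) * θ (tmulFun 1 1) = θ (tmulFun 1 1) := by
          rw [← map_mul, tmulFun_mul, one_mul, mul_one]
        have h4 : θ (tmulFun (g * g') 1) = θ (tmulFun g 1) * θ (tmulFun g' 1) := by
          rw [← map_mul, tmulFun_mul, mul_one]
        rw [h4]
        simp only [add_mul, mul_add, mul_sub, sub_mul, smul_mul_assoc, mul_smul_comm, h1, h2, h3,
          mul_one, one_mul, smul_sub, smul_add, sub_self, add_zero, smul_smul,
          ContinuousMap.mul_apply]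
        rw [mul_comm (g' 0)]
        abel
      map_zero' := by
        have : tmulFun (0 : C(unitInterval, ℂ)) (1 : E) = 0 := by ext; simp
        simp [this]
      map_add' := fun g g' => by
        have : tmulFun (g + g') (1 : E) = tmulFun g 1 + tmulFun g' 1 := by ext; simp [add_smul]
        rw [this, map_add, ContinuousMap.add_apply, add_smul]
        abel
      commutes' := fun c => by
        have : tmulFun (algebraMap ℂ C(unitInterval, ℂ) c) (1 : E) = c • tmulFun 1 1 := by
          ext; simp
        have h0 : algebraMap ℂ C(unitInterval, ℂ) c 0 = c := by simp
        rw [this, map_smul, h0, smul_sub,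
          add_sub_cancel, Algebra.algebraMap_eq_smul_one]
      map_star' := fun g => by
        have : tmulFun (star g) (1 : E) = star (tmulFun g 1) := by rw [star_tmulFun, star_one]
        rw [this, map_star, star_add, star_smul, star_sub, star_one, ← map_star θ (tmulFun 1 1),
          star_tmulFun, star_one, star_one, ContinuousMap.star_apply] }
  let T : C(unitInterval, ℂ) := ⟨fun t => ((t : ℝ) : ℂ), by fun_prop⟩
  have hφT : φ T = π H := by
    rw [hHθ]
    change θ (tmulFun T 1) + T 0 • (1 - θ (tmulFun 1 1)) = _
    -- The unital extension acts on the complement of `θ (1 ⊗ 1)` by evaluation at `0`, so the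
    -- coordinate function acquires no extra term there.
    have : T 0 = 0 := by simp [T]
    rw [this, zero_smul, add_zero]
  have hcomp : (π.comp ρ) = φ := by
    refine starAlgHom_unitInterval_ext ?_
    change π (cfcHom hHn (T.comp k)) = φ T
    have h1 : cfcHom hHn (T.comp k) =
        cfc (fun z : ℂ => ((Set.projIcc (0 : ℝ) 1 zero_le_one z.re : ℝ) : ℂ)) H := by
      rw [cfc_apply _ H hHn (by fun_prop)]
      rfl
    rw [h1, StarAlgHomClass.map_cfc (S := ℂ) π _ H (by fun_prop) (continuous_starAlgHom π) hHn
      (hH.map π).isStarNormal, hφT]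
    conv_rhs => rw [← cfc_id' ℂ (π H) (hH.map π).isStarNormal]
    refine cfc_congr fun z hz => ?_
    rw [← hφT] at hz
    have hz' := AlgHom.spectrum_apply_subset φ T hz
    rw [ContinuousMap.spectrum_eq_range] at hz'
    obtain ⟨t, rfl⟩ := hz'
    change ((Set.projIcc (0 : ℝ) 1 zero_le_one ((t : ℝ) : ℂ).re : ℝ) : ℂ) = ((t : ℝ) : ℂ)
    rw [Complex.ofReal_re, Set.projIcc_val]
  let b := Module.finBasis ℂ E
  refine ⟨tensorHom b ρ Θ hρc, fun f => ?_⟩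
  rw [← sum_coordFun b f, map_sum, map_sum, map_sum]
  refine Finset.sum_congr rfl fun u _ => ?_
  change π (tensorLinear b ρ Θ _) = _
  rw [tensorLinear_tmulFun, map_mul, hΘ]
  have h1 := DFunLike.congr_fun hcomp (coordFun b u f)
  change π (ρ _) = θ _ + _ • (1 - θ _) at h1
  have h2 : θ (tmulFun 1 1) * θ (tmulFun 1 (b u)) = θ (tmulFun 1 (b u)) := by
    rw [← map_mul, tmulFun_mul, one_mul, one_mul]
  rw [h1, add_mul, smul_mul_assoc, sub_mul, one_mul, h2, sub_self, smul_zero, add_zero, ← map_mul,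
    tmulFun_mul, mul_one, one_mul]

/-- Partial isometries `v i` that generate matrix units are lifted to `V i` satisfying the same
relations, and `v i * star (v j) ↦ V i * star (V j)` is the lift `Θ`. The second clause, lifting a
self-adjoint element of the commutant into the commutant of `Θ`, is what the interval case needs. -/
theorem exists_finiteDim_lift {E B : Type*} [CStarAlgebra E] [FiniteDimensional ℂ E]
    [CStarAlgebra B] (θ : E →⋆ₙₐ[ℂ] SeqAlg B) :
    ∃ Θ : E →⋆ₙₐ[ℂ] (ℕ →ᵇ B), (∀ x, eta B (Θ x) = θ x) ∧
      ∀ h : SeqAlg B, IsSelfAdjoint h → (∀ x, Commute h (θ x)) → h * θ 1 = h →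
        ∃ H : ℕ →ᵇ B, IsSelfAdjoint H ∧ (∀ x, Commute H (Θ x)) ∧ eta B H = h := by
  obtain ⟨κ, _, _, c, e, v, he, he0, hvv, hvo, hspan⟩ := exists_matrixUnits E
  have hve : ∀ i, v i * e (c i) = v i := fun i => mul_eq_self_of_star_mul_self (he _) (hvv i)
  have hev : ∀ i, e (c i) * star (v i) = star (v i) := fun i => by
    rw [← (he _).isSelfAdjoint.star_eq, ← star_mul, hve]
  let U := {p : κ × κ // c p.1 = c p.2}
  let w : U → E := fun p => v p.1.1 * star (v p.1.2)
  -- Multiplying by `star (v i)` on the left and `v j` on the right isolates one coefficient. Being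
  -- a basis, the `w` allow `L` to be defined by its values on them.
  have hli : LinearIndependent ℂ w := by
    rw [Fintype.linearIndependent_iff]
    rintro g hg ⟨⟨i, j⟩, hij⟩
    have h1 := congrArg (fun x => star (v i) * x * v j) hg
    simp only [Finset.mul_sum, Finset.sum_mul, mul_zero, zero_mul] at h1
    rw [Finset.sum_eq_single ⟨⟨i, j⟩, hij⟩] at h1
    · have h2 : star (v i) * (g ⟨⟨i, j⟩, hij⟩ • w ⟨⟨i, j⟩, hij⟩) * v j =
          g ⟨⟨i, j⟩, hij⟩ • e (c i) := by
        simp only [w, mul_smul_comm, smul_mul_assoc]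
        have hij' : c i = c j := hij
        rw [← mul_assoc, hvv, mul_assoc, hvv, ← hij', (he _).isIdempotentElem.eq]
      rw [h2] at h1
      exact (smul_eq_zero.1 h1).resolve_right (he0 _)
    · rintro ⟨⟨k, l⟩, hkl⟩ _ hne
      simp only [w, mul_smul_comm, smul_mul_assoc]
      by_cases hik : i = k
      · have hlj : l ≠ j := by
          rintro rfl
          subst hik
          exact hne rfl
        rw [← mul_assoc, mul_assoc, hvo l j hlj, mul_zero, smul_zero]
      · rw [← mul_assoc, hvo i k hik, zero_mul, zero_mul, smul_zero]
    · simp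
  have hw : ⊤ ≤ Submodule.span ℂ (Set.range w) := by
    intro x _
    refine Submodule.span_mono ?_ (hspan x)
    rintro _ ⟨i, j, hij, rfl⟩
    exact ⟨⟨⟨i, j⟩, hij⟩, rfl⟩
  let b : Module.Basis U ℂ E := Module.Basis.mk hli hw
  -- lifts of the partial isometries
  choose f hf hfe using fun i => exists_projection_lift ((he i).map θ)
  obtain ⟨N, V, hV, hVV, hVo⟩ := exists_isometries_lift (fun i => θ (v i)) (fun i => f (c i))
    (fun i => hf _) (fun i => by rw [← map_star, ← map_mul, hvv, hfe])
    (fun i j hij => by rw [← map_star, ← map_mul, hvo i j hij, map_zero]) Finset.univ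
  simp only [Finset.mem_univ, true_imp_iff] at hV hVV hVo
  set q : κ → ℕ →ᵇ B := fun i => cut B N (f i) with hq
  have hqp : ∀ i, IsStarProjection (q i) := fun i => (hf i).map (cut B N)
  have hVq : ∀ i, V i * q (c i) = V i := fun i => mul_eq_self_of_star_mul_self (hqp _) (hVV i)
  have hqV : ∀ i, q (c i) * star (V i) = star (V i) := fun i => by
    rw [← (hqp _).isSelfAdjoint.star_eq, ← star_mul, hVq]
  let L : E →ₗ[ℂ] (ℕ →ᵇ B) := b.constr ℂ fun p => V p.1.1 * star (V p.1.2)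
  have hL : ∀ i j, c i = c j → L (v i * star (v j)) = V i * star (V j) := by
    intro i j hij
    have h1 : b ⟨⟨i, j⟩, hij⟩ = v i * star (v j) := by
      rw [Module.Basis.mk_apply]
    rw [← h1, Module.Basis.constr_basis]
  have hLmul : ∀ x y, L (x * y) = L x * L y := by
    intro x y
    induction hspan x using Submodule.span_induction with
    | zero => simp
    | add x x' _ _ hx hx' => rw [add_mul, map_add, map_add, hx, hx', add_mul]
    | smul a x _ hx => rw [smul_mul_assoc, map_smul, map_smul, hx, smul_mul_assoc]
    | mem x hx =>
      obtain ⟨i, j, hij, rfl⟩ := hx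
      induction hspan y using Submodule.span_induction with
      | zero => simp
      | add x x' _ _ hx hx' => rw [mul_add, map_add, map_add, hx, hx', mul_add]
      | smul a x _ hx => rw [mul_smul_comm, map_smul, map_smul, hx, mul_smul_comm]
      | mem y hy =>
        obtain ⟨k, l, hkl, rfl⟩ := hy
        rw [hL i j hij, hL k l hkl]
        by_cases hjk : j = k
        · subst hjk
          have h1 : v i * star (v j) * (v j * star (v l)) = v i * star (v l) := by
            rw [mul_assoc, ← mul_assoc (star (v j)), hvv, hkl, hev]
          have h2 : V i * star (V j) * (V j * star (V l)) = V i * star (V l) := by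
            rw [mul_assoc, ← mul_assoc (star (V j)), hVV]
            change V i * (q (c j) * _) = _
            rw [hkl, hqV]
          rw [h1, h2, hL i l (hij.trans hkl)]
        · have h1 : v i * star (v j) * (v k * star (v l)) = 0 := by
            rw [mul_assoc, ← mul_assoc (star (v j)), hvo j k hjk, zero_mul, mul_zero]
          have h2 : V i * star (V j) * (V k * star (V l)) = 0 := by
            rw [mul_assoc, ← mul_assoc (star (V j)), hVo j k hjk, zero_mul, mul_zero]
          rw [h1, h2, map_zero]
  have hLstar : ∀ x, L (star x) = star (L x) := by
    intro x
    induction hspan x using Submodule.span_induction with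
    | zero => simp
    | add x x' _ _ hx hx' => rw [star_add, map_add, map_add, hx, hx', star_add]
    | smul a x _ hx => rw [star_smul, map_smul, map_smul, hx, star_smul]
    | mem x hx =>
      obtain ⟨i, j, hij, rfl⟩ := hx
      rw [hL i j hij, star_mul, star_star, hL j i hij.symm, star_mul, star_star]
  have hLθ : ∀ x, eta B (L x) = θ x := by
    intro x
    induction hspan x using Submodule.span_induction with
    | zero => simp
    | add x x' _ _ hx hx' => rw [map_add, map_add, map_add, hx, hx']
    | smul a x _ hx => rw [map_smul, map_smul, map_smul, hx]
    | mem x hx =>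
      obtain ⟨i, j, hij, rfl⟩ := hx
      rw [hL i j hij, map_mul, map_star, hV, hV, map_mul, map_star]
  have hone : ∑ i, v i * star (v i) = 1 := by
    have key : ∀ x, (∑ i, v i * star (v i)) * x = x := by
      intro x
      induction hspan x using Submodule.span_induction with
      | zero => simp
      | add x x' _ _ hx hx' => rw [mul_add, hx, hx']
      | smul a x _ hx => rw [mul_smul_comm, hx]
      | mem x hx =>
        obtain ⟨i, j, hij, rfl⟩ := hx
        rw [Finset.sum_mul, Finset.sum_eq_single i]
        · rw [mul_assoc, ← mul_assoc (star (v i)), hvv, hij, hev]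
        · intro k _ hki
          rw [mul_assoc, ← mul_assoc (star (v k)), hvo k i hki, zero_mul, mul_zero]
        · simp
    simpa using key 1
  refine ⟨{ toFun := L, map_smul' := map_smul L, map_zero' := map_zero L, map_add' := map_add L,
            map_mul' := hLmul, map_star' := hLstar }, hLθ, fun h hh hhc hh1 => ?_⟩
  obtain ⟨a, ha, hah⟩ := exists_selfAdjoint_lift hh
  -- An arbitrary lift `a` of `h` need not commute with `Θ`, but this sum does so exactly: `V j *
  -- star (V k)` carries the `k`-th summand to the `j`-th. In the quotient it becomes `h * θ 1 = h`.
  refine ⟨∑ i, V i * a * star (V i), ?_, fun x => ?_, ?_⟩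
  · rw [isSelfAdjoint_iff, star_sum]
    refine Finset.sum_congr rfl fun i _ => ?_
    rw [star_mul, star_mul, star_star, ha.star_eq, mul_assoc]
  · change (∑ i, V i * a * star (V i)) * L x = L x * ∑ i, V i * a * star (V i)
    induction hspan x using Submodule.span_induction with
    | zero => simp
    | add x x' _ _ hx hx' => rw [map_add, mul_add, add_mul, hx, hx']
    | smul a x _ hx => rw [map_smul, mul_smul_comm, smul_mul_assoc, hx]
    | mem x hx =>
      obtain ⟨j, k, hjk, rfl⟩ := hx
      rw [hL j k hjk, Finset.sum_mul, Finset.mul_sum, Finset.sum_eq_single j,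
        Finset.sum_eq_single k]
      · have h1 : star (V j) * V j = q (c j) := hVV j
        have h2 : star (V k) * V k = q (c k) := hVV k
        calc V j * a * star (V j) * (V j * star (V k))
            = V j * a * ((star (V j) * V j) * star (V k)) := by simp only [mul_assoc]
          _ = V j * a * star (V k) := by rw [h1, hjk, hqV]
          _ = V j * (star (V k) * V k) * a * star (V k) := by rw [h2, ← hjk, hVq]
          _ = V j * star (V k) * (V k * a * star (V k)) := by simp only [mul_assoc]
      · intro i _ hik
        rw [mul_assoc, ← mul_assoc (star (V k)), ← mul_assoc (star (V k)), hVo k i hik.symm]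
        simp
      · simp
      · intro i _ hij
        rw [mul_assoc, ← mul_assoc (star (V i)), hVo i j hij]
        simp
      · simp
  · rw [map_sum]
    calc ∑ i, eta B (V i * a * star (V i)) = ∑ i, h * θ (v i * star (v i)) := by
          refine Finset.sum_congr rfl fun i _ => ?_
          rw [map_mul, map_mul, map_star, hV, hah, ← (hhc _).eq, mul_assoc, map_mul, map_star]
      _ = h := by rw [← Finset.mul_sum, ← map_sum, hone, hh1]

/-- The restriction of `θ` to constant functions is lifted first, and then the coordinate function
inside the commutant of that lift. -/
theorem exists_interval_lift {E B : Type*} [CStarAlgebra E] [FiniteDimensional ℂ E]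
    [CStarAlgebra B] (θ : C(unitInterval, E) →⋆ₙₐ[ℂ] SeqAlg B) :
    ∃ Θ : C(unitInterval, E) →⋆ₙₐ[ℂ] (ℕ →ᵇ B), ∀ f, eta B (Θ f) = θ f := by
  let θE : E →⋆ₙₐ[ℂ] SeqAlg B :=
    { toFun := fun x => θ (tmulFun 1 x)
      map_smul' := fun a x => by
        rw [MonoidHom.id_apply, ← map_smul]
        congr 1
        ext t; simp
      map_zero' := by
        have : tmulFun (1 : C(unitInterval, ℂ)) (0 : E) = 0 := by ext; simp
        rw [this, map_zero]
      map_add' := fun x y => by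
        rw [← map_add]
        congr 1
        ext t; simp
      map_mul' := fun x y => by rw [← map_mul, tmulFun_mul, one_mul]
      map_star' := fun x => by rw [← map_star, star_tmulFun, star_one] }
  obtain ⟨Θ, hΘ, hcomm⟩ := exists_finiteDim_lift θE
  obtain ⟨H, hH, hHc, hHθ⟩ := hcomm
    (θ (tmulFun ⟨fun t => ((t : ℝ) : ℂ), by fun_prop⟩ 1)) (by
      rw [isSelfAdjoint_iff, ← map_star, star_tmulFun, star_one]
      congr 2
      ext t
      simp) (fun x => by
      change θ _ * θ _ = θ _ * θ _
      rw [← map_mul, ← map_mul, tmulFun_mul, tmulFun_mul, mul_comm, one_mul, mul_one, one_mul]) (by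
      change θ _ * θ _ = θ _
      rw [← map_mul, tmulFun_mul, mul_one, one_mul])
  exact exists_lift_of_commutant_lift (eta B) θ Θ hΘ H hH hHc hHθ

end Interval

/-! ### Simplicity and tracial rank of sequentially split subalgebras -/

section Simple

variable {A : Type*} [CStarAlgebra A]

theorem isUnit_of_norm_sub_one_lt {x : A} (h : ‖x - 1‖ < 1) : IsUnit x := by
  have := isUnit_one_sub_of_norm_lt_one (x := 1 - x) (by rwa [norm_sub_rev])
  rwa [sub_sub_cancel] at this

theorem isSimpleCStar_of_isSimpleRing [IsSimpleRing A] : IsSimpleCStar A :=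
  ⟨inferInstance, fun I _ => eq_bot_or_eq_top I⟩

/-- In a unital algebra a dense ideal contains an element at distance less than `1` from the unit,
hence an invertible one. Topological and algebraic simplicity therefore agree. -/
theorem IsSimpleCStar.isSimpleRing (h : IsSimpleCStar A) : IsSimpleRing A := by
  obtain ⟨hA, hI⟩ := h
  have hone : ∀ I : TwoSidedIdeal A, (1 : A) ∈ I → I = ⊤ := fun I h => by
    rw [eq_top_iff]
    intro x _
    simpa using I.mul_mem_left x 1 h
  refine ⟨⟨fun I => ?_⟩⟩
  let J : TwoSidedIdeal A := TwoSidedIdeal.mk' (closure (I : Set A)) (subset_closure I.zero_mem)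
    (fun hx hy => map_mem_closure₂ continuous_add hx hy fun a ha b hb => I.add_mem ha hb)
    (fun hx => map_mem_closure continuous_neg hx fun a ha => I.neg_mem ha)
    (fun {x _} hy => map_mem_closure (continuous_const_mul x) hy fun a ha => I.mul_mem_left x a ha)
    (fun {_ y} hx => map_mem_closure (f := fun z => z * y) (continuous_mul_const y) hx
      fun a ha => I.mul_mem_right a y ha)
  have hJ : ∀ x, x ∈ J ↔ x ∈ closure (I : Set A) := fun x => TwoSidedIdeal.mem_mk' ..
  have hJc : IsClosed (J : Set A) := by
    have : (J : Set A) = closure (I : Set A) := Set.ext hJ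
    rw [this]
    exact isClosed_closure
  rcases hI J hJc with h | h
  · left
    rw [eq_bot_iff]
    intro x hx
    rw [← h]
    exact (hJ x).2 (subset_closure hx)
  · right
    have h1 : (1 : A) ∈ closure (I : Set A) := (hJ 1).1 (h ▸ trivial)
    obtain ⟨y, hy, hy1⟩ := Metric.mem_closure_iff.1 h1 1 one_pos
    rw [dist_comm, dist_eq_norm] at hy1
    obtain ⟨u, rfl⟩ := isUnit_of_norm_sub_one_lt hy1
    refine hone I ?_
    simpa using I.mul_mem_left (↑u⁻¹) _ hy

theorem map_ne_zero_of_isSimpleRing {R Q : Type*} [Ring R] [Ring Q] [IsSimpleRing R] [Nontrivial Q]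
    (f : R →+* Q) {x : R} (hx : x ≠ 0) : f x ≠ 0 := fun h =>
  hx (RingHom.injective f (h.trans (map_zero f).symm))

end Simple

/-! ### Permanence under sequentially split homomorphisms. -/

section SequentiallySplit

variable {B R : Type*} [CStarAlgebra B] [CStarAlgebra R]

/-- For a nonzero ideal `I` of `B`, the `r` for which `ψ r` is represented by a sequence in `I` form
an ideal of `R` containing `ι x` for every `x ∈ I`. By simplicity it contains `1`, so `I` has
elements arbitrarily close to `1`. -/
theorem isSimpleRing_of_sequentiallySplit [IsSimpleRing R] (ι : B →⋆ₐ[ℂ] R) (ψ : R →⋆ₐ[ℂ] SeqAlg B)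
    (hψ : ∀ b, ψ (ι b) = diag b) : IsSimpleRing B := by
  have hB : Nontrivial B := by
    by_contra h
    rw [not_nontrivial_iff_subsingleton] at h
    have h1 : (ι 1 : R) = ι 0 := congrArg ι (Subsingleton.elim _ _)
    rw [map_one, map_zero] at h1
    exact one_ne_zero h1
  refine ⟨⟨fun I => or_iff_not_imp_left.2 fun hI => ?_⟩⟩
  obtain ⟨x, hx, hx0⟩ : ∃ x ∈ I, x ≠ 0 := by
    by_contra! h
    exact hI (eq_bot_iff.2 fun x hx => (TwoSidedIdeal.mem_bot _).2 (h x hx))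
  let J : TwoSidedIdeal R := TwoSidedIdeal.mk' {r | ∃ y : ℕ →ᵇ B, eta B y = ψ r ∧ ∀ n, y n ∈ I}
    ⟨0, by simp, fun _ => I.zero_mem⟩
    (by
      rintro r s ⟨y, hy, hyI⟩ ⟨z, hz, hzI⟩
      exact ⟨y + z, by rw [map_add, map_add, hy, hz], fun n => I.add_mem (hyI n) (hzI n)⟩)
    (by
      rintro r ⟨y, hy, hyI⟩
      exact ⟨-y, by rw [map_neg, map_neg, hy], fun n => I.neg_mem (hyI n)⟩)
    (by
      rintro r s ⟨y, hy, hyI⟩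
      obtain ⟨z, hz⟩ := eta_surjective (ψ r)
      exact ⟨z * y, by rw [map_mul, map_mul, hy, hz], fun n => I.mul_mem_left _ _ (hyI n)⟩)
    (by
      rintro r s ⟨y, hy, hyI⟩
      obtain ⟨z, hz⟩ := eta_surjective (ψ s)
      exact ⟨y * z, by rw [map_mul, map_mul, hy, hz], fun n => I.mul_mem_right _ _ (hyI n)⟩)
  have hJ : ∀ r, r ∈ J ↔ ∃ y : ℕ →ᵇ B, eta B y = ψ r ∧ ∀ n, y n ∈ I :=
    fun r => TwoSidedIdeal.mem_mk' ..
  have hιx : ι x ≠ 0 := fun h => hx0 (diag_injective (by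
    rw [← hψ, h, map_zero]
    exact (map_zero (diagHom B)).symm))
  have h1 : (1 : R) ∈ J := IsSimpleRing.one_mem_of_ne_zero_mem J hιx
    ((hJ _).2 ⟨BoundedContinuousFunction.const ℕ x, (hψ x).symm, fun _ => hx⟩)
  obtain ⟨y, hy, hyI⟩ := (hJ 1).1 h1
  rw [map_one] at hy
  obtain ⟨n, hn⟩ := (eventually_norm_lt (x := y - 1) (r := 1) (by
    rw [map_sub, map_one, hy, sub_self, norm_zero]
    exact one_pos)).exists
  obtain ⟨u, hu⟩ := isUnit_of_norm_sub_one_lt (x := y n) hn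
  rw [eq_top_iff]
  intro z _
  have := I.mul_mem_left (z * ↑u⁻¹) _ (hu ▸ hyI n)
  rwa [mul_assoc, Units.inv_mul, mul_one] at this

/-- Take `h = x (x + δ)⁻¹`, so that `1 - h = δ (x + δ)⁻¹`. The two factorizations through `x` later
place elements in `x B x` itself. -/
theorem exists_approxUnit {x : B} (hx : ∃ y, x = star y * y) {δ : ℝ} (hδ : 0 < δ) :
    ∃ h r : B, h = x * r ∧ h = r * x ∧ IsSelfAdjoint h ∧ ‖1 - h‖ ≤ 1 ∧ ‖(1 - h) * x‖ ≤ δ := by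
  let _ := CStarAlgebra.spectralOrder B
  let _ := CStarAlgebra.spectralOrderedRing B
  obtain ⟨y, hy⟩ := hx
  have hx0 : 0 ≤ x := hy ▸ star_mul_self_nonneg y
  have hxs : IsSelfAdjoint x := IsSelfAdjoint.of_nonneg hx0
  have hsp : ∀ t ∈ spectrum ℝ x, 0 ≤ t := fun t ht => spectrum_nonneg_of_nonneg hx0 ht
  have hne : ∀ t ∈ spectrum ℝ x, t + δ ≠ 0 := fun t ht => by
    have := hsp t ht
    positivity
  have hr : ContinuousOn (fun t : ℝ => (t + δ)⁻¹) (spectrum ℝ x) :=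
    ContinuousOn.inv₀ (by fun_prop) hne
  have hh : ContinuousOn (fun t : ℝ => t * (t + δ)⁻¹) (spectrum ℝ x) :=
    ContinuousOn.mul (by fun_prop) hr
  have e1 : cfc (fun t : ℝ => t * (t + δ)⁻¹) x = x * cfc (fun t : ℝ => (t + δ)⁻¹) x := by
    rw [cfc_mul (fun t : ℝ => t) _ x (by fun_prop) hr, cfc_id' ℝ x]
  have e2 : 1 - cfc (fun t : ℝ => t * (t + δ)⁻¹) x = cfc (fun t : ℝ => δ * (t + δ)⁻¹) x := by
    rw [← cfc_const_one ℝ x, ← cfc_sub (fun _ : ℝ => (1 : ℝ)) _ x (by fun_prop) hh]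
    refine cfc_congr fun t ht => ?_
    have := hne t ht
    field_simp
    ring
  refine ⟨cfc (fun t : ℝ => t * (t + δ)⁻¹) x, cfc (fun t : ℝ => (t + δ)⁻¹) x, e1, ?_,
    cfc_predicate _ _, ?_, ?_⟩
  · have := (cfc_commute_cfc (fun t : ℝ => t) (fun t : ℝ => (t + δ)⁻¹) x).eq
    rw [cfc_id' ℝ x] at this
    rw [e1, this]
  · rw [e2]
    refine norm_cfc_le zero_le_one fun t ht => ?_
    have h0 := hsp t ht
    rw [Real.norm_of_nonneg (by positivity), ← div_eq_mul_inv]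
    exact div_le_one_of_le₀ (by linarith) (by positivity)
  · rw [e2]
    nth_rewrite 2 [← cfc_id' ℝ x]
    rw [← cfc_mul _ (fun t : ℝ => t) x (by fun_prop) (by fun_prop)]
    refine norm_cfc_le hδ.le fun t ht => ?_
    have h0 := hsp t ht
    rw [Real.norm_of_nonneg (by positivity), mul_assoc, mul_comm _ t, ← div_eq_mul_inv]
    exact mul_le_of_le_one_right hδ.le (div_le_one_of_le₀ (by linarith) (by positivity))

theorem norm_projection_le_one {p : B} (hp : IsStarProjection p) : ‖p‖ ≤ 1 := by
  have h1 : ‖p‖ = ‖p‖ * ‖p‖ := by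
    conv_lhs => rw [← hp.isIdempotentElem.eq]
    nth_rewrite 1 [← hp.isSelfAdjoint.star_eq]
    rw [CStarRing.norm_star_mul_self]
  by_contra h
  nlinarith

theorem isStarProjection_mul_star {v f : B} (hf : IsStarProjection f) (h : star v * v = f) :
    IsStarProjection (v * star v) := by
  refine ⟨?_, by rw [isSelfAdjoint_iff, star_mul, star_star]⟩
  change v * star v * (v * star v) = v * star v
  rw [mul_assoc, ← mul_assoc (star v), h, ← mul_assoc, mul_eq_self_of_star_mul_self hf h]

/-- If `D` lifts along `ℓ^∞ → ℓ^∞ / c₀`, then tracial approximations by `D` pass to sequentially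
split subalgebras. -/
theorem exists_isTracialApprox_of_sequentiallySplit {D : Type*} [CStarAlgebra D] [IsSimpleRing R]
    (ι : B →⋆ₐ[ℂ] R) (ψ : R →⋆ₐ[ℂ] SeqAlg B) (hψ : ∀ b, ψ (ι b) = diag b)
    (hlift : ∀ θ : D →⋆ₙₐ[ℂ] SeqAlg B, ∃ Θ : D →⋆ₙₐ[ℂ] (ℕ →ᵇ B), ∀ d, eta B (Θ d) = θ d)
    {F : Finset B} {F' : Finset R} (hF : ∀ a ∈ F, ι a ∈ F') {ε : ℝ}
    {x : B} (hx : ∃ y, x = star y * y) {p : R} {φ : D →⋆ₙₐ[ℂ] R}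
    (h : IsTracialApprox F' ε (ι x) p φ) :
    ∃ (p' : B) (φ' : D →⋆ₙₐ[ℂ] B), IsTracialApprox F ε x p' φ' := by
  obtain ⟨hp, hp0, hφ1, hcomm, hdist, q, hq, hqx, v, hv1, hv2⟩ := h
  have hB : Nontrivial B :=
    have := isSimpleRing_of_sequentiallySplit ι ψ hψ
    inferInstance
  have hBs : Nontrivial (SeqAlg B) := diag_injective.nontrivial
  obtain ⟨Θ, hΘ⟩ := hlift ((ψ : R →⋆ₙₐ[ℂ] SeqAlg B).comp φ)
  replace hΘ : ∀ d, eta B (Θ d) = ψ (φ d) := hΘ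
  set P : ℕ →ᵇ B := Θ 1 with hP
  have hPp : IsStarProjection P := (IsStarProjection.one D).map Θ
  have hPη : eta B P = ψ p := by rw [hΘ, hφ1]
  have hψle : ∀ r, ‖ψ r‖ ≤ ‖r‖ := fun r => NonUnitalStarAlgHom.norm_apply_le ψ r
  have hconst : ∀ b : B, eta B (BoundedContinuousFunction.const ℕ b) = ψ (ι b) :=
    fun b => (hψ b).symm
  -- almost central
  have ev1 : ∀ a ∈ F, ∀ᶠ n in atTop, ‖a * P n - P n * a‖ < ε := by
    intro a ha
    refine eventually_norm_lt (x := BoundedContinuousFunction.const ℕ a * P -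
      P * BoundedContinuousFunction.const ℕ a) ?_
    rw [map_sub, map_mul, map_mul, hconst, hPη, ← map_mul, ← map_mul, ← map_sub]
    exact (hψle _).trans_lt (hcomm _ (hF a ha))
  -- close to the image
  choose! d hd using hdist
  have ev2 : ∀ a ∈ F, ∀ᶠ n in atTop, ‖P n * a * P n - Θ (d (ι a)) n‖ < ε := by
    intro a ha
    refine eventually_norm_lt (x := P * BoundedContinuousFunction.const ℕ a * P - Θ (d (ι a))) ?_
    rw [map_sub, map_mul, map_mul, hconst, hPη, hΘ, ← map_mul, ← map_mul, ← map_sub]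
    exact (hψle _).trans_lt (hd _ (hF a ha))
  -- the complement is small
  obtain ⟨hh, r, hhr, hhr', hhsa, hhq⟩ : ∃ hh r : B, hh = x * r ∧ hh = r * x ∧ IsSelfAdjoint hh ∧
      ‖ι hh * q - q‖ ≤ 1 / 8 ∧ ‖hh‖ ≤ 2 := by
    obtain ⟨z, ⟨a, rfl⟩, hz⟩ := Metric.mem_closure_iff.1 hqx (1 / 16) (by norm_num)
    -- `q` is within `1/16` of `x a x` (with `x` viewed in `R`), and this `δ` keeps `(1 - hh) x a x`
    -- below `1/16`; together `hh` moves `q` by at most `1/8`.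
    obtain ⟨hh, r, h1, h2, h3, h4, h5⟩ := exists_approxUnit hx
      (δ := (1 / 16) / (‖a * ι x‖ + 1)) (by positivity)
    refine ⟨hh, r, h1, h2, h3, ?_, ?_⟩
    · rw [dist_eq_norm] at hz
      have e : ι hh * q - q = -(ι (1 - hh) * (q - ι x * a * ι x)) -
          ι ((1 - hh) * x) * (a * ι x) := by
        rw [map_mul, map_sub, map_one]
        noncomm_ring
      have n1 : ‖ι (1 - hh)‖ ≤ 1 := (NonUnitalStarAlgHom.norm_apply_le ι _).trans h4
      have n2 : ‖ι ((1 - hh) * x)‖ ≤ (1 / 16) / (‖a * ι x‖ + 1) :=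
        (NonUnitalStarAlgHom.norm_apply_le ι _).trans h5
      rw [e]
      calc _ ≤ ‖-(ι (1 - hh) * (q - ι x * a * ι x))‖ + ‖ι ((1 - hh) * x) * (a * ι x)‖ :=
            norm_sub_le _ _
        _ ≤ 1 * (1 / 16) + (1 / 16) / (‖a * ι x‖ + 1) * ‖a * ι x‖ := by
            rw [norm_neg]
            refine add_le_add ((norm_mul_le _ _).trans ?_) ((norm_mul_le _ _).trans ?_)
            · gcongr
            · gcongr
        _ ≤ 1 * (1 / 16) + (1 / 16) := by
            gcongr
            rw [div_mul_eq_mul_div]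
            exact div_le_of_le_mul₀ (by positivity) (by norm_num)
              (mul_le_mul_of_nonneg_left (by linarith) (by norm_num))
        _ = 1 / 8 := by norm_num
    · calc ‖hh‖ = ‖1 - (1 - hh)‖ := by rw [sub_sub_cancel]
        _ ≤ ‖(1 : B)‖ + ‖1 - hh‖ := norm_sub_le _ _
        _ ≤ 1 + 1 := by rw [CStarRing.norm_one]; gcongr
        _ = 2 := by norm_num
  obtain ⟨hhq, hhn⟩ := hhq
  obtain ⟨w, hw⟩ := eta_surjective (ψ v)
  have hvq : q * v = v := by
    rw [← hv2, mul_assoc, hv1]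
    exact mul_eq_self_of_star_mul_self hp.one_sub hv1
  have hvn : ‖v‖ ≤ 1 := by
    have h1 := CStarRing.norm_star_mul_self (x := v)
    rw [hv1] at h1
    have h2 := norm_projection_le_one hp.one_sub
    by_contra h3
    nlinarith
  -- In the limit this is an estimate for `ι hh * v`. Since `v = q v` and `ι hh` nearly fixes `q`,
  -- the error is at most `2 · 1/8 + 1/8 = 3/8`, below the tolerance `1/2` of `polar_corner`.
  have ev3 : ∀ᶠ n in atTop, ‖star (hh * (w n * (1 - P n))) * (hh * (w n * (1 - P n))) -
      (1 - P n)‖ < 1 / 2 := by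
    let c := BoundedContinuousFunction.const ℕ hh
    refine eventually_norm_lt (x := star (c * (w * (1 - P))) * (c * (w * (1 - P))) - (1 - P)) ?_
    have hvp : v * (1 - p) = v := mul_eq_self_of_star_mul_self hp.one_sub hv1
    have e1 : eta B (c * (w * (1 - P))) = ψ (ι hh * v) := by
      rw [map_mul, map_mul, map_sub, map_one, hPη, hw, hconst, ← map_one ψ, ← map_sub, ← map_mul,
        hvp, map_mul]
    rw [map_sub, map_mul, map_star, e1, map_sub, map_one, hPη, ← map_one ψ, ← map_sub ψ 1 p, ← hv1,
      ← map_star, ← map_mul, ← map_sub]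
    have e2 : star (ι hh * v) * (ι hh * v) - star v * v =
        star (ι hh * v) * ((ι hh * q - q) * v) + star ((ι hh * q - q) * v) * v := by
      rw [sub_mul, mul_assoc _ q v, hvq, star_sub]
      noncomm_ring
    have n0 : ‖(ι hh * q - q) * v‖ ≤ 1 / 8 := by
      calc _ ≤ ‖ι hh * q - q‖ * ‖v‖ := norm_mul_le _ _
        _ ≤ 1 / 8 * 1 := by gcongr
        _ = 1 / 8 := mul_one _
    have n1 : ‖star (ι hh * v)‖ ≤ 2 := by
      rw [norm_star]
      calc _ ≤ ‖ι hh‖ * ‖v‖ := norm_mul_le _ _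
        _ ≤ 2 * 1 := by
          gcongr
          exact (NonUnitalStarAlgHom.norm_apply_le ι _).trans hhn
        _ = 2 := mul_one _
    calc _ ≤ ‖star (ι hh * v) * (ι hh * v) - star v * v‖ := hψle _
      _ ≤ ‖star (ι hh * v) * ((ι hh * q - q) * v)‖ + ‖star ((ι hh * q - q) * v) * v‖ := by
          rw [e2]
          exact norm_add_le _ _
      _ ≤ 2 * (1 / 8) + 1 / 8 * 1 := by
          refine add_le_add ((norm_mul_le _ _).trans ?_) ((norm_mul_le _ _).trans ?_)
          · gcongr
          · rw [norm_star]
            gcongr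
      _ < 1 / 2 := by norm_num
  -- the projections do not vanish
  have ev4 : ∃ᶠ n in atTop, P n ≠ 0 := by
    intro hev
    refine map_ne_zero_of_isSimpleRing (ψ : R →+* SeqAlg B) hp0 ?_
    change ψ p = 0
    rw [← hPη, eta_eq_zero_iff]
    refine tendsto_const_nhds.congr' ?_
    filter_upwards [hev] with n hn
    rw [not_not.1 hn, norm_zero]
  have ev : ∀ᶠ n in atTop, (∀ a ∈ F, ‖a * P n - P n * a‖ < ε) ∧
      (∀ a ∈ F, ‖P n * a * P n - Θ (d (ι a)) n‖ < ε) ∧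
      ‖star (hh * (w n * (1 - P n))) * (hh * (w n * (1 - P n))) - (1 - P n)‖ < 1 / 2 :=
    ((Finset.eventually_all F).2 ev1).and (((Finset.eventually_all F).2 ev2).and ev3)
  obtain ⟨n, hn0, hn1, hn2, hn3⟩ := (ev4.and_eventually ev).exists
  have hPn : IsStarProjection (P n) := hPp.map (evalSeq B n)
  refine ⟨P n, (evalSeq B n : (ℕ →ᵇ B) →⋆ₙₐ[ℂ] B).comp Θ, hPn, hn0, rfl, hn1,
    fun a ha => ⟨d (ι a), hn2 a ha⟩, ?_⟩
  set y := hh * (w n * (1 - P n)) with hy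
  have hyf : y * (1 - P n) = y := by
    rw [hy, mul_assoc, mul_assoc, hPn.one_sub.isIdempotentElem.eq]
  obtain ⟨h1, -⟩ := polar_corner hPn.one_sub hyf hn3.le
  generalize invSqrtCorner y (1 - P n) = z at h1
  refine ⟨_, isStarProjection_mul_star hPn.one_sub h1, subset_closure ?_, _, h1, rfl⟩
  generalize w n * (1 - P n) = u at hy
  -- Using `hh = x r` on the left and `hh = r x` on the right exhibits the range projection as an
  -- element of `x B x`.
  have e1 : star y = star u * (r * x) := by rw [hy, star_mul, hhsa.star_eq, hhr']
  rw [star_mul, e1, hy, hhr]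
  exact ⟨r * u * z * (star z * star u * r), by simp only [mul_assoc]⟩

theorem tracialRankLEOne_of_sequentiallySplit [IsSimpleRing R]
    (ι : B →⋆ₐ[ℂ] R) (ψ : R →⋆ₐ[ℂ] SeqAlg B) (hψ : ∀ b, ψ (ι b) = diag b)
    (hR : TracialRankLEOne R) : TracialRankLEOne B := by
  classical
  rintro F ε hε x ⟨y, hy⟩ hx0
  have hιx : ι x ≠ 0 := fun h => hx0 (diag_injective (by
    rw [← hψ, h, map_zero]
    exact (map_zero (diagHom B)).symm))
  obtain ⟨E, _, _, p, φ, h⟩ := hR (F.image ι) ε hε (ι x) ⟨ι y, by rw [hy, map_mul, map_star]⟩ hιx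
  obtain ⟨p', φ', h'⟩ := exists_isTracialApprox_of_sequentiallySplit ι ψ hψ
    (exists_interval_lift) (fun a ha => Finset.mem_image_of_mem ι ha) ⟨y, hy⟩ h
  exact ⟨E, _, inferInstance, p', φ', h'⟩

theorem tracialRankZero_of_sequentiallySplit [IsSimpleRing R]
    (ι : B →⋆ₐ[ℂ] R) (ψ : R →⋆ₐ[ℂ] SeqAlg B) (hψ : ∀ b, ψ (ι b) = diag b)
    (hR : TracialRankZero R) : TracialRankZero B := by
  classical
  rintro F ε hε x ⟨y, hy⟩ hx0
  have hιx : ι x ≠ 0 := fun h => hx0 (diag_injective (by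
    rw [← hψ, h, map_zero]
    exact (map_zero (diagHom B)).symm))
  obtain ⟨E, _, _, p, φ, h⟩ := hR (F.image ι) ε hε (ι x) ⟨ι y, by rw [hy, map_mul, map_star]⟩ hιx
  obtain ⟨p', φ', h'⟩ := exists_isTracialApprox_of_sequentiallySplit ι ψ hψ
    (fun θ => (exists_finiteDim_lift θ).imp fun _ h => h.1)
    (fun a ha => Finset.mem_image_of_mem ι ha) ⟨y, hy⟩ h
  exact ⟨E, _, inferInstance, p', φ', h'⟩

end SequentiallySplit

/-! ### The Rokhlin homomorphism into the sequence algebra -/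

section LiftInjective

variable {P Q R : Type*} [Ring P] [StarRing P] [Algebra ℂ P] [Ring Q] [StarRing Q] [Algebra ℂ Q]
  [Ring R] [StarRing R] [Algebra ℂ R]

/-- A `*`-homomorphism whose range is contained in the range of an injective one factors. -/
theorem exists_starAlgHom_lift (j : P →⋆ₐ[ℂ] Q) (hj : Function.Injective j) (ψ : R →⋆ₐ[ℂ] Q)
    (h : ∀ r, ∃ p, j p = ψ r) : ∃ χ : R →⋆ₐ[ℂ] P, ∀ r, j (χ r) = ψ r := by
  choose χ hχ using h
  exact ⟨{ toFun := χ
           map_one' := hj (by rw [hχ, map_one, map_one])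
           map_mul' := fun a b => hj (by rw [hχ, map_mul, map_mul, hχ, hχ])
           map_zero' := hj (by rw [hχ, map_zero, map_zero])
           map_add' := fun a b => hj (by rw [hχ, map_add, map_add, hχ, hχ])
           commutes' := fun c => hj (by rw [hχ, AlgHomClass.commutes, AlgHomClass.commutes])
           map_star' := fun a => hj (by rw [hχ, map_star, map_star, hχ]) }, hχ⟩

end LiftInjective

section RokhlinHom

variable {A G : Type*} [CStarAlgebra A] [TopologicalSpace.SeparableSpace A] [Group G]
  [TopologicalSpace G] [IsTopologicalGroup G] (α : G →* (A ≃⋆ₐ[ℂ] A))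

/-- Take `D = A`. Since `A` has a unit its annihilator in `A_∞` is zero, so `F(A, A)` is just `A_∞ ∩
A'`. -/
theorem exists_rokhlinHom (hRok : HasRokhlinProperty α) :
    ∃ φ : C(G, ℂ) →⋆ₐ[ℂ] SeqAlg A, (∀ f a, Commute (φ f) (diag a)) ∧
      (∀ f, φ f ∈ contSeqAlg α) ∧
      ∀ g f, φ (leftTranslate g f) = seqAlgMap (α g) (φ f) := by
  have hD : IsInvariant α (⊤ : NonUnitalStarSubalgebra ℂ A) := fun _ _ _ => trivial
  obtain ⟨φ, hφ⟩ := hRok ⊤ isClosed_univ (TopologicalSpace.IsSeparable.of_separableSpace _) hD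
  have hinj : Function.Injective (kappa (⊤ : NonUnitalStarSubalgebra ℂ A)) := by
    rw [injective_iff_map_eq_zero]
    intro x hx
    have hx' : x ∈ ann (⊤ : NonUnitalStarSubalgebra ℂ A) := Ideal.Quotient.eq_zero_iff_mem.1 hx
    have h1 : (x : SeqAlg A) * diag 1 = 0 := (hx' 1 trivial).1
    exact Subtype.ext ((mul_one (x : SeqAlg A)).symm.trans h1)
  have hmem : ∀ f, ∃ x : commutant (⊤ : NonUnitalStarSubalgebra ℂ A),
      (x : SeqAlg A) ∈ contSeqAlg α ∧ kappa ⊤ x = (φ f : CentralSeq _) := fun f => (φ f).2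
  obtain ⟨χ, hχ⟩ := exists_starAlgHom_lift (kappa ⊤) hinj ((contCentralSeq α ⊤).subtype.comp φ)
    fun f => (hmem f).imp fun _ h => h.2
  replace hχ : ∀ f, kappa ⊤ (χ f) = (φ f : CentralSeq _) := hχ
  refine ⟨(commutant ⊤).subtype.comp χ, fun f a => ?_, fun f => ?_, fun g f => ?_⟩
  · exact ((mem_commutant_iff _ _).1 (χ f).2 a trivial).symm
  · obtain ⟨x, hx, hxφ⟩ := hmem f
    have : χ f = x := hinj ((hχ f).trans hxφ.symm)
    change (χ f : SeqAlg A) ∈ _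
    rwa [this]
  · have : χ (leftTranslate g f) = commutantAct hD g (χ f) := hinj (by
      rw [hχ, hφ, ← hχ]
      rfl)
    exact congrArg Subtype.val this

end RokhlinHom

/-! ### Norm estimates for sums over partitions of unity. -/

section PartitionEstimates

/-- Cauchy–Schwarz in the Hilbert module of families in `Q`: the sum is the inner product of `(star
(s i))` with `(star (s i) * x i)`, of norms at most `1` and `ε`. -/
theorem norm_sum_conj_le {Q ι : Type*} [CStarAlgebra Q] [Fintype ι] (s x : ι → Q) {ε : ℝ}
    (hε : 0 ≤ ε) (hs : ∑ i, star (s i) * s i = 1) (hx : ∀ i, ‖x i‖ ≤ ε) :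
    ‖∑ i, star (s i) * x i * s i‖ ≤ ε := by
  let _ := CStarAlgebra.spectralOrder Q
  let _ := CStarAlgebra.spectralOrderedRing Q
  let X : WithCStarModule Q (ι → Q) := (WithCStarModule.equiv Q (ι → Q)).symm fun i => star (s i)
  let Y : WithCStarModule Q (ι → Q) := (WithCStarModule.equiv Q (ι → Q)).symm fun i => star (s i) * x i
  have hXY : inner Q X Y = ∑ i, star (s i) * x i * s i := by
    rw [WithCStarModule.pi_inner]
    refine Finset.sum_congr rfl fun i _ => ?_
    change (star (s i) * x i) * star (star (s i)) = _
    rw [star_star]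
  have h1 : ‖(1 : Q)‖ ≤ 1 := norm_projection_le_one (IsStarProjection.one Q)
  have hX : ‖X‖ ≤ 1 := by
    rw [← abs_of_nonneg (CStarModule.norm_nonneg Q (x := X)), ← sq_le_one_iff_abs_le_one,
      WithCStarModule.pi_norm_sq]
    have : ∑ i, inner Q (X i) (X i) = 1 := by
      rw [← hs]
      refine Finset.sum_congr rfl fun i _ => ?_
      change star (s i) * star (star (s i)) = _
      rw [star_star]
    rw [this]
    exact h1
  have hY : ‖Y‖ ≤ ε := by
    refine (sq_le_sq₀ (CStarModule.norm_nonneg Q) hε).1 ?_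
    rw [WithCStarModule.pi_norm_sq]
    have hi : ∀ i, inner Q (Y i) (Y i) = star (s i) * (x i * star (x i)) * s i := by
      intro i
      change (star (s i) * x i) * star (star (s i) * x i) = _
      rw [star_mul, star_star]
      simp only [mul_assoc]
    simp only [hi]
    have hle : ∑ i, star (s i) * (x i * star (x i)) * s i ≤ (ε ^ 2) • (1 : Q) := by
      rw [← hs, Finset.smul_sum]
      refine Finset.sum_le_sum fun i _ => ?_
      refine (CStarAlgebra.star_left_conjugate_le_norm_smul
        (IsSelfAdjoint.mul_star_self (x i))).trans ?_
      refine smul_le_smul_of_nonneg_right ?_ (star_mul_self_nonneg _)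
      rw [CStarRing.norm_self_mul_star, sq]
      exact mul_self_le_mul_self (norm_nonneg _) (hx i)
    refine (CStarAlgebra.norm_le_norm_of_nonneg_of_le ?_ hle).trans ?_
    · refine Finset.sum_nonneg fun i _ => ?_
      exact star_left_conjugate_nonneg (mul_star_self_nonneg _) _
    · rw [norm_smul, Real.norm_of_nonneg (by positivity)]
      exact mul_le_of_le_one_right (by positivity) h1
  rw [← hXY]
  calc ‖inner Q X Y‖ ≤ ‖X‖ * ‖Y‖ := CStarModule.norm_inner_le _
    _ ≤ 1 * ε := mul_le_mul hX hY (CStarModule.norm_nonneg Q) zero_le_one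
    _ = ε := one_mul ε

variable {A X : Type*} [CStarAlgebra A] [TopologicalSpace X]

/-- A real-valued continuous function as a complex-valued one. -/
def toComplexFun (f : C(X, ℝ)) : C(X, ℂ) := ⟨fun t => (f t : ℂ), by fun_prop⟩

@[simp] theorem toComplexFun_apply (f : C(X, ℝ)) (t : X) : toComplexFun f t = (f t : ℂ) := rfl

theorem toComplexFun_mul (f g : C(X, ℝ)) :
    toComplexFun (f * g) = toComplexFun f * toComplexFun g := by
  ext t
  simp

theorem star_toComplexFun (f : C(X, ℝ)) : star (toComplexFun f) = toComplexFun f := by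
  ext t
  simp

theorem sum_toComplexFun {ι : Type*} [Fintype ι] {e : ι → C(X, ℝ)} (h1 : ∑ i, e i = 1) :
    ∑ i, toComplexFun (e i) = 1 := by
  ext t
  have := DFunLike.congr_fun h1 t
  simp only [ContinuousMap.sum_apply, toComplexFun_apply, ContinuousMap.one_apply] at this ⊢
  exact_mod_cast this

variable (φ : C(X, ℂ) →⋆ₐ[ℂ] SeqAlg A)

/-- Writing `φ (e i)` as the square of `φ (√(e i))` and commuting one factor past `diag (c i)` gives
a sum as in `norm_sum_conj_le`. Coefficients at indices with `e i = 0` do not matter. -/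
theorem norm_sum_partition_le (hφ : ∀ f a, Commute (φ f) (diag a))
    {ι : Type*} [Fintype ι] (e : ι → C(X, ℝ)) (h0 : ∀ i t, 0 ≤ e i t)
    (h1 : ∑ i, e i = 1) (c : ι → A) {ε : ℝ} (hε : 0 ≤ ε) (hc : ∀ i t, e i t ≠ 0 → ‖c i‖ ≤ ε) :
    ‖∑ i, φ (toComplexFun (e i)) * diag (c i)‖ ≤ ε := by
  classical
  let r : ι → C(X, ℝ) := fun i => ⟨fun t => √(e i t), by fun_prop⟩
  have hr : ∀ i, r i * r i = e i := fun i => by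
    ext t
    exact Real.mul_self_sqrt (h0 i t)
  have hsa : ∀ i, star (φ (toComplexFun (r i))) = φ (toComplexFun (r i)) := fun i => by
    rw [← map_star, star_toComplexFun]
  have hss : ∀ i, φ (toComplexFun (r i)) * φ (toComplexFun (r i)) = φ (toComplexFun (e i)) :=
    fun i => by rw [← map_mul, ← toComplexFun_mul, hr]
  have key := norm_sum_conj_le (fun i => φ (toComplexFun (r i)))
    (fun i => if e i = 0 then 0 else diag (c i)) hε (by
      simp only [hsa, hss]
      rw [← map_sum, sum_toComplexFun h1, map_one]) (fun i => by
      split_ifs with hi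
      · simpa using hε
      · obtain ⟨t, ht⟩ : ∃ t, e i t ≠ 0 := by
          by_contra! h
          exact hi (ContinuousMap.ext h)
        exact (norm_diag_le _).trans (hc i t ht))
  convert key using 3 with i
  split_ifs with hi
  · have : toComplexFun (0 : C(X, ℝ)) = 0 := by ext; simp
    rw [hi, this, map_zero, zero_mul, mul_zero, zero_mul]
  · rw [hsa, mul_assoc, ← (hφ _ _).eq, ← mul_assoc, hss]

/-- Pass to the common refinement `e i * e' j`: where it is nonzero, `c i` and `c' j` both
approximate `u` at the same point. Thus all Riemann-type sums for one function `u` are close to each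
other, which yields convergence, multiplicativity and invariance of the splitting. -/
theorem norm_sum_partition_sub_le (hφ : ∀ f a, Commute (φ f) (diag a))
    {ι ι' : Type*} [Fintype ι] [Fintype ι'] (u : X → A)
    {ε ε' : ℝ} (hε : 0 ≤ ε) (hε' : 0 ≤ ε')
    (e : ι → C(X, ℝ)) (h0 : ∀ i t, 0 ≤ e i t) (h1 : ∑ i, e i = 1) (c : ι → A)
    (hc : ∀ i t, e i t ≠ 0 → ‖c i - u t‖ ≤ ε)
    (e' : ι' → C(X, ℝ)) (h0' : ∀ i t, 0 ≤ e' i t) (h1' : ∑ i, e' i = 1) (c' : ι' → A)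
    (hc' : ∀ i t, e' i t ≠ 0 → ‖c' i - u t‖ ≤ ε') :
    ‖∑ i, φ (toComplexFun (e i)) * diag (c i) - ∑ i, φ (toComplexFun (e' i)) * diag (c' i)‖ ≤
      ε + ε' := by
  have key := norm_sum_partition_le φ hφ (fun p : ι × ι' => e p.1 * e' p.2)
    (fun p t => mul_nonneg (h0 _ t) (h0' _ t))
    (by rw [Fintype.sum_prod_type, ← Finset.sum_mul_sum, h1, h1', one_mul])
    (fun p => c p.1 - c' p.2) (add_nonneg hε hε') (fun p t hp => by
      have h2 : e p.1 t ≠ 0 := fun h => hp (by simp [h])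
      have h3 : e' p.2 t ≠ 0 := fun h => hp (by simp [h])
      calc ‖c p.1 - c' p.2‖ = ‖(c p.1 - u t) - (c' p.2 - u t)‖ := by rw [sub_sub_sub_cancel_right]
        _ ≤ _ := (norm_sub_le _ _).trans (add_le_add (hc _ t h2) (hc' _ t h3)))
  convert key using 2
  have hd : ∀ a b : A, diag (a - b) = diag a - diag b := map_sub (diagHom A)
  simp only [toComplexFun_mul, map_mul, hd, mul_sub, Finset.sum_sub_distrib]
  rw [Fintype.sum_prod_type, Fintype.sum_prod_type_right]
  congr 1
  · refine Finset.sum_congr rfl fun i _ => ?_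
    change _ = ∑ j, φ (toComplexFun (e i)) * φ (toComplexFun (e' j)) * diag (c i)
    rw [← Finset.sum_mul, ← Finset.mul_sum, ← map_sum, sum_toComplexFun h1', map_one, mul_one]
  · refine Finset.sum_congr rfl fun i _ => ?_
    change _ = ∑ j, φ (toComplexFun (e j)) * φ (toComplexFun (e' i)) * diag (c' i)
    rw [← Finset.sum_mul, ← Finset.sum_mul, ← map_sum, sum_toComplexFun h1, map_one, one_mul]

end PartitionEstimates

/-! ### Compact group actions with the Rokhlin property: splitting over the fixed points -/

section FinePartition

variable {G : Type*} [Group G] [TopologicalSpace G] [IsTopologicalGroup G] [CompactSpace G]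
  [T2Space G]

/-- A partition of unity subordinate to finitely many left translates of `V` that cover the compact
group. -/
theorem exists_fine_partition {V : Set G} (hV : V ∈ 𝓝 (1 : G)) :
    ∃ (n : ℕ) (e : Fin n → C(G, ℝ)) (g : Fin n → G), (∀ i t, 0 ≤ e i t) ∧ ∑ i, e i = 1 ∧
      ∀ i t, e i t ≠ 0 → (g i)⁻¹ * t ∈ V := by
  let U : G → Set G := fun g => interior {t | g⁻¹ * t ∈ V}
  have hU : ∀ g, U g ∈ 𝓝 g := fun g => by
    refine interior_mem_nhds.2 ?_
    have : Tendsto (fun t => g⁻¹ * t) (𝓝 g) (𝓝 1) := by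
      have h := (continuous_const_mul g⁻¹).tendsto g
      rwa [inv_mul_cancel] at h
    exact this hV
  obtain ⟨t, ht⟩ := CompactSpace.elim_nhds_subcover U hU
  let γ : Fin t.card → G := fun i => t.equivFin.symm i
  have hcov : (Set.univ : Set G) ⊆ ⋃ i, U (γ i) := by
    intro x _
    have hx : x ∈ ⋃ y ∈ t, U y := ht ▸ trivial
    simp only [Set.mem_iUnion] at hx ⊢
    obtain ⟨y, hy, hxy⟩ := hx
    exact ⟨t.equivFin ⟨y, hy⟩, by simpa [γ] using hxy⟩
  obtain ⟨f, hf⟩ := PartitionOfUnity.exists_isSubordinate isClosed_univ (fun i => U (γ i))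
    (fun _ => isOpen_interior) hcov
  refine ⟨t.card, fun i => f i, γ, fun i x => f.nonneg i x, ?_, fun i x hx => ?_⟩
  · ext x
    have := f.sum_eq_one (Set.mem_univ x)
    rw [finsum_eq_sum_of_fintype] at this
    simpa using this
  · have h : x ∈ U (γ i) := hf i (subset_tsupport _ hx)
    have h' : x ∈ {t | (γ i)⁻¹ * t ∈ V} := interior_subset h
    exact h'

end FinePartition

/-! ### Sequences on which the action is norm-continuous. -/

section ContSeq

variable {A G : Type*} [CStarAlgebra A] [Group G] [TopologicalSpace G] {α : G →* (A ≃⋆ₐ[ℂ] A)}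

theorem mem_contSeq_iff {x : ℕ →ᵇ A} : x ∈ contSeq α ↔ Continuous fun g => seqMap (α g) x := Iff.rfl

theorem norm_seqMap (σ : A ≃⋆ₐ[ℂ] A) (x : ℕ →ᵇ A) : ‖seqMap σ x‖ ≤ ‖x‖ :=
  NonUnitalStarAlgHom.norm_apply_le (seqMap σ) x

theorem seqMap_apply (σ : A ≃⋆ₐ[ℂ] A) (x : ℕ →ᵇ A) (n : ℕ) : seqMap σ x n = σ (x n) := rfl

theorem mem_contSeq_of_approx {x : ℕ →ᵇ A} (h : ∀ ε > 0, ∃ y ∈ contSeq α, ‖x - y‖ < ε) :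
    x ∈ contSeq α := by
  rw [mem_contSeq_iff]
  refine continuous_of_uniform_approx_of_continuous fun u hu => ?_
  obtain ⟨ε, hε, hu⟩ := Metric.mem_uniformity_dist.1 hu
  obtain ⟨y, hy, hxy⟩ := h ε hε
  refine ⟨fun g => seqMap (α g) y, hy, fun g => hu ?_⟩
  rw [dist_eq_norm, ← map_sub]
  exact (norm_seqMap _ _).trans_lt hxy

/-- The orbit of the single element `a` controls all entries at once. This covers constant sequences
and sequences with one nonzero entry. -/
theorem mem_contSeq_of_dominated (hα : ∀ a : A, Continuous fun g : G => α g a) {x : ℕ →ᵇ A} (a : A)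
    (h : ∀ n g k, ‖α g (x n) - α k (x n)‖ ≤ ‖α g a - α k a‖) : x ∈ contSeq α := by
  rw [mem_contSeq_iff, continuous_iff_continuousAt]
  intro k
  refine tendsto_iff_norm_sub_tendsto_zero.2 (squeeze_zero (fun _ => norm_nonneg _) (fun g => ?_)
    (tendsto_iff_norm_sub_tendsto_zero.1 ((hα a).tendsto k)))
  exact (BoundedContinuousFunction.norm_le (norm_nonneg _)).2 fun n => h n g k

/-- Null sequences are norm limits of finitely supported ones. Hence every representative of an
element of `A_{∞,α}` is itself a sequence with continuous action. -/
theorem c0_le_contSeq (hα : ∀ a : A, Continuous fun g : G => α g a) {x : ℕ →ᵇ A}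
    (hx : eta A x = 0) : x ∈ contSeq α := by
  refine mem_contSeq_of_approx fun ε hε => ?_
  obtain ⟨N, hN⟩ := exists_norm_cut_le (half_pos hε) hx
  refine ⟨x - cut A N x, ?_, by rw [sub_sub_cancel]; linarith⟩
  -- a finitely supported sequence
  have hfin : x - cut A N x =
      ∑ k ∈ Finset.range N, bddSeq (fun n => if n = k then x k else 0) ‖x‖ (fun n => by
        split_ifs
        · exact x.norm_coe_le_norm k
        · simp) := by
    ext n
    rw [BoundedContinuousFunction.sum_apply]
    simp only [bddSeq_apply, Finset.sum_ite_eq, Finset.mem_range]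
    change x n - cut A N x n = _
    rw [cut_apply]
    by_cases h : N ≤ n
    · rw [if_pos h, if_neg (by omega), sub_self]
    · rw [if_neg h, if_pos (by omega), sub_zero]
  rw [hfin]
  refine sum_mem fun k _ => ?_
  refine mem_contSeq_of_dominated hα (x k) fun n g l => ?_
  rw [bddSeq_apply]
  split_ifs
  · exact le_rfl
  · simp

theorem isClosed_contSeqAlg (hα : ∀ a : A, Continuous fun g : G => α g a) :
    IsClosed (contSeqAlg α : Set (SeqAlg A)) := by
  refine isClosed_of_closure_subset fun z hz => ?_
  obtain ⟨x, rfl⟩ := eta_surjective z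
  refine ⟨x, mem_contSeq_of_approx fun ε hε => ?_, rfl⟩
  obtain ⟨_, ⟨y, hy, rfl⟩, hxy⟩ := Metric.mem_closure_iff.1 hz ε hε
  rw [dist_eq_norm] at hxy
  change ‖eta A x - eta A y‖ < ε at hxy
  obtain ⟨m, hm, hmr⟩ := Submodule.Quotient.norm_mk_lt (eta A x - eta A y) (sub_pos.2 hxy)
  rw [add_sub_cancel] at hmr
  have h0 : eta A (x - y - m) = 0 := by
    rw [map_sub, map_sub, sub_eq_zero]
    exact hm.symm
  refine ⟨y + (x - y - m), add_mem hy (c0_le_contSeq hα h0), ?_⟩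
  have : x - (y + (x - y - m)) = m := by abel
  rwa [this]

theorem seqAlgMap_eta (σ : A ≃⋆ₐ[ℂ] A) (x : ℕ →ᵇ A) :
    seqAlgMap σ (eta A x) = eta A (seqMap σ x) := rfl

end ContSeq

/-! ### The splitting through orbit functions. -/

section Splitting

variable {A G : Type*} [CStarAlgebra A] [TopologicalSpace.SeparableSpace A] [Group G]
  [TopologicalSpace G] [IsTopologicalGroup G] [CompactSpace G] [T2Space G]
  [FirstCountableTopology G] (α : G →* (A ≃⋆ₐ[ℂ] A))

/-- `ψ a` is the image of the orbit function `g ↦ α_g(a)` under the map `C(G, A) → A_∞` built from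
`φ` and the constant sequences, obtained as the limit of the sums `T m a`. Orbit functions are
invariant under left translation combined with `α`, and equivariance of `φ` carries this over to `ψ
a`; for fixed `a` they are constant. -/
theorem exists_invariant_splitting (hα : ∀ a : A, Continuous fun g : G => α g a)
    (hRok : HasRokhlinProperty α) :
    ∃ ψ : A →⋆ₐ[ℂ] SeqAlg A, (∀ g a, seqAlgMap (α g) (ψ a) = ψ a) ∧
      (∀ a, ψ a ∈ contSeqAlg α) ∧ ∀ b ∈ fixedPoints α, ψ b = diag b := by
  obtain ⟨φ, hφ, hφc, hφe⟩ := exists_rokhlinHom α hRok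
  -- First countability allows ever finer partitions to be indexed by `ℕ`.
  obtain ⟨V, hV⟩ := (𝓝 (1 : G)).exists_antitone_basis
  choose N e g h0 h1 hV' using fun m => exists_fine_partition (hV.1.mem_of_mem (i := m) trivial)
  let T : ℕ → A → SeqAlg A := fun m a => ∑ i, φ (toComplexFun (e m i)) * diag (α (g m i) a)
  -- the orbit function of `a` is approximated on the partition
  have happ : ∀ a : A, ∀ ε > 0, ∀ᶠ m in atTop, ∀ i t, ∀ k s : G, k⁻¹ * s = (g m i)⁻¹ * t →
      e m i t ≠ 0 → ‖α k a - α s a‖ ≤ ε := by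
    intro a ε hε
    have hc : Tendsto (fun v => ‖a - α v a‖) (𝓝 1) (𝓝 0) := by
      have : Continuous fun v => ‖a - α v a‖ := (continuous_const.sub (hα a)).norm
      simpa using this.tendsto 1
    obtain ⟨m₀, -, hm₀⟩ := hV.1.mem_iff.1 (hc (gt_mem_nhds hε))
    filter_upwards [eventually_ge_atTop m₀] with m hm i t k s hks ht
    have hv : ‖a - α (k⁻¹ * s) a‖ < ε := by
      rw [hks]
      exact hm₀ (hV.2 hm (hV' m i t ht))
    have hs : α s a = α k (α (k⁻¹ * s) a) := by
      rw [← StarAlgEquiv.mul_apply, ← map_mul, mul_inv_cancel_left]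
    rw [hs, ← map_sub, StarAlgEquiv.norm_map]
    exact hv.le
  have happ' : ∀ a : A, ∀ ε > 0, ∀ᶠ m in atTop, ∀ i t, e m i t ≠ 0 →
      ‖α (g m i) a - α t a‖ ≤ ε := fun a ε hε => by
    filter_upwards [happ a ε hε] with m hm i t ht
    exact hm i t _ _ rfl ht
  have hdadd : ∀ a b : A, diag (a + b) = diag a + diag b := map_add (diagHom A)
  have hdmul : ∀ a b : A, diag (a * b) = diag a * diag b := map_mul (diagHom A)
  have hdsmul : ∀ (c : ℂ) (a : A), diag (c • a) = c • diag a := map_smul (diagHom A)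
  have hsum : ∀ m, ∑ i, φ (toComplexFun (e m i)) = 1 := fun m => by
    rw [← map_sum, sum_toComplexFun (h1 m), map_one]
  have hTadd : ∀ m a b, T m (a + b) = T m a + T m b := fun m a b => by
    simp only [T, map_add, hdadd, mul_add, Finset.sum_add_distrib]
  have hTsmul : ∀ m (c : ℂ) a, T m (c • a) = c • T m a := fun m c a => by
    simp only [T, map_smul, hdsmul, mul_smul_comm, Finset.smul_sum]
  have hTstar : ∀ m a, T m (star a) = star (T m a) := fun m a => by
    simp only [T, map_star, diag_star, star_sum, star_mul]
    refine Finset.sum_congr rfl fun i _ => ?_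
    rw [← diag_star, ← map_star φ, star_toComplexFun]
    exact (hφ _ _).eq
  have hTfix : ∀ m, ∀ b ∈ fixedPoints α, T m b = diag b := fun m b hb => by
    have : ∀ k, α k b = b := hb
    simp only [T, this]
    rw [← Finset.sum_mul, hsum, one_mul]
  have hTcauchy : ∀ a, CauchySeq fun m => T m a := by
    intro a
    rw [Metric.cauchySeq_iff']
    intro ε hε
    obtain ⟨M, hM⟩ := eventually_atTop.1 (happ' a (ε / 3) (by positivity))
    refine ⟨M, fun m hm => ?_⟩
    rw [dist_eq_norm]
    refine (norm_sum_partition_sub_le φ hφ (fun t => α t a) (by positivity) (by positivity)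
      (e m) (h0 m) (h1 m) _ (hM m hm) (e M) (h0 M) (h1 M) _ (hM M le_rfl)).trans_lt ?_
    linarith
  choose ψ hψ using fun a => cauchySeq_tendsto_of_complete (hTcauchy a)
  -- The product `T m a * T m b` is a sum over the partition `e m i * e m j` with coefficients close
  -- to the orbit of `a * b`, so it is compared with `T m (a * b)` as another Riemann-type sum.
  have hTmul : ∀ a b, Tendsto (fun m => T m a * T m b - T m (a * b)) atTop (𝓝 0) := by
    intro a b
    rw [tendsto_zero_iff_norm_tendsto_zero, Metric.tendsto_atTop]
    intro ε hε
    -- The product estimate costs `δ (‖a‖ + ‖b‖) ≤ ε/2`, the sum for `a * b` another `ε/4`; the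
    -- added `2` keeps the denominator positive.
    set δ := min 1 (ε / (2 * (‖a‖ + ‖b‖ + 2))) with hδ
    have hδ0 : 0 < δ := by positivity
    obtain ⟨M, hM⟩ := eventually_atTop.1 ((happ' a δ hδ0).and
      ((happ' b δ hδ0).and (happ' (a * b) (ε / 4) (by positivity))))
    refine ⟨M, fun m hm => ?_⟩
    obtain ⟨ha, hb, hab⟩ := hM m hm
    rw [Real.dist_0_eq_abs, abs_norm]
    have hprod : T m a * T m b = ∑ p : Fin (N m) × Fin (N m),
        φ (toComplexFun (e m p.1 * e m p.2)) * diag (α (g m p.1) a * α (g m p.2) b) := by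
      rw [Finset.sum_mul_sum, Fintype.sum_prod_type]
      refine Finset.sum_congr rfl fun i _ => Finset.sum_congr rfl fun j _ => ?_
      rw [toComplexFun_mul, map_mul, hdmul, mul_assoc, ← mul_assoc (diag _),
        ← (hφ _ (α (g m i) a)).eq]
      simp only [mul_assoc]
    rw [hprod]
    refine (norm_sum_partition_sub_le φ hφ (fun t => α t (a * b)) (ε := ε / 2) (ε' := ε / 4)
      (by positivity) (by positivity) (fun p : Fin (N m) × Fin (N m) => e m p.1 * e m p.2)
      (fun p t => mul_nonneg (h0 m _ t) (h0 m _ t)) (by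
        rw [Fintype.sum_prod_type, ← Finset.sum_mul_sum, h1, one_mul]) _ (fun p t hp => ?_)
      (e m) (h0 m) (h1 m) _ hab).trans_lt (by linarith)
    have h2 : e m p.1 t ≠ 0 := fun h => hp (by simp [h])
    have h3 : e m p.2 t ≠ 0 := fun h => hp (by simp [h])
    have e1 : α (g m p.1) a * α (g m p.2) b - α t (a * b) =
        (α (g m p.1) a - α t a) * α (g m p.2) b + α t a * (α (g m p.2) b - α t b) := by
      rw [map_mul]
      noncomm_ring
    rw [e1]
    calc _ ≤ δ * ‖b‖ + ‖a‖ * δ := by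
          refine (norm_add_le _ _).trans (add_le_add ((norm_mul_le _ _).trans ?_)
            ((norm_mul_le _ _).trans ?_))
          · rw [StarAlgEquiv.norm_map]
            exact mul_le_mul_of_nonneg_right (ha _ t h2) (norm_nonneg _)
          · rw [StarAlgEquiv.norm_map]
            exact mul_le_mul_of_nonneg_left (hb _ t h3) (norm_nonneg _)
      _ ≤ δ * (‖a‖ + ‖b‖ + 2) := by nlinarith
      _ ≤ ε / (2 * (‖a‖ + ‖b‖ + 2)) * (‖a‖ + ‖b‖ + 2) := by
          gcongr
          exact min_le_right _ _
      _ = ε / 2 := by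
          field_simp
  have huniq : ∀ {u : ℕ → SeqAlg A} {x y}, Tendsto u atTop (𝓝 x) → Tendsto u atTop (𝓝 y) → x = y :=
    fun h h' => tendsto_nhds_unique h h'
  have hψfix : ∀ b ∈ fixedPoints α, ψ b = diag b := fun b hb =>
    huniq (hψ b) (by simpa only [hTfix _ b hb] using tendsto_const_nhds)
  have hψsmul : ∀ (c : ℂ) a, ψ (c • a) = c • ψ a := fun c a =>
    huniq (hψ _) (by simpa only [hTsmul] using (hψ a).const_smul c)
  have hψ1 : ψ 1 = 1 := hψfix 1 (one_mem _)
  let Ψ : A →⋆ₐ[ℂ] SeqAlg A :=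
    { toFun := ψ
      map_one' := hψ1
      map_mul' := fun a b => by
        have h := ((hψ a).mul (hψ b)).sub (hTmul a b)
        simp only [sub_sub_cancel, sub_zero] at h
        exact huniq (hψ _) h
      map_zero' := hψfix 0 (zero_mem _)
      map_add' := fun a b => huniq (hψ _) (by simpa only [hTadd] using (hψ a).add (hψ b))
      commutes' := fun c => by
        rw [Algebra.algebraMap_eq_smul_one, hψsmul, hψ1, Algebra.algebraMap_eq_smul_one]
      map_star' := fun a => huniq (hψ _) (by simpa only [hTstar] using (hψ a).star) }
  refine ⟨Ψ, fun k a => ?_, fun a => ?_, hψfix⟩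
  · -- translation of a partition by `k`
    have hcont : Continuous (seqAlgMap (α k)) := continuous_starAlgHom _
    have hT : Tendsto (fun m => seqAlgMap (α k) (T m a) - T m a) atTop (𝓝 0) := by
      rw [tendsto_zero_iff_norm_tendsto_zero, Metric.tendsto_atTop]
      intro ε hε
      obtain ⟨M, hM⟩ := eventually_atTop.1 (happ a (ε / 3) (by positivity))
      refine ⟨M, fun m hm => ?_⟩
      rw [Real.dist_0_eq_abs, abs_norm]
      let e' : Fin (N m) → C(G, ℝ) := fun i =>
        (e m i).comp ⟨fun h => k⁻¹ * h, continuous_const_mul k⁻¹⟩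
      have htr : seqAlgMap (α k) (T m a) =
          ∑ i, φ (toComplexFun (e' i)) * diag (α (k * g m i) a) := by
        simp only [T, map_sum, map_mul, seqAlgMap_diag, ← hφe]
        rfl
      rw [htr]
      refine (norm_sum_partition_sub_le φ hφ (fun t => α t a) (by positivity) (by positivity)
        e' (fun i t => h0 m i _) ?_ _ (fun i t ht => ?_)
        (e m) (h0 m) (h1 m) _ (fun i t ht => hM m hm i t _ _ rfl ht)).trans_lt
        (show ε / 3 + ε / 3 < ε by linarith)
      · ext t
        have := DFunLike.congr_fun (h1 m) (k⁻¹ * t)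
        simpa [e'] using this
      -- Translating the partition keeps the quotient `(k g_i)⁻¹ t = g_i⁻¹ (k⁻¹ t)`, and `happ`
      -- depends only on this quotient.
      · exact hM m hm i (k⁻¹ * t) _ _ (by group) ht
    have h := ((hcont.tendsto _).comp (hψ a)).sub (hψ a)
    exact sub_eq_zero.1 (huniq h hT)
  · refine (isClosed_contSeqAlg hα).mem_of_tendsto (hψ a) (Eventually.of_forall fun m => ?_)
    refine sum_mem fun i _ => mul_mem (hφc _) ?_
    refine ⟨BoundedContinuousFunction.const ℕ (α (g m i) a), ?_, rfl⟩
    exact mem_contSeq_of_dominated hα (α (g m i) a) fun n g l => le_rfl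

end Splitting

/-! ### Averaging over a compact group -/

section Average

open MeasureTheory

variable {A G : Type*} [CStarAlgebra A] [Group G] [TopologicalSpace G] [IsTopologicalGroup G]
  [CompactSpace G] {α : G →* (A ≃⋆ₐ[ℂ] A)}

/-- The average is the Haar integral of the orbit, fixed by left invariance. The last clause holds
because the measure has mass one; it is used with `c = 0` to bound the average and with `c` the
averaged element to show that an almost invariant element barely moves. -/
theorem exists_average (hα : ∀ a : A, Continuous fun g : G => α g a) (a : A) :
    ∃ b ∈ fixedPoints α, ∀ C : ℝ, ∀ c : A, (∀ g, ‖α g a - c‖ ≤ C) → ‖b - c‖ ≤ C := by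
  let _ : MeasurableSpace G := borel G
  have : BorelSpace G := ⟨rfl⟩
  let μ : Measure G := Measure.haarMeasure ⊤
  have : IsProbabilityMeasure μ := ⟨by
    have := Measure.haarMeasure_self (K₀ := (⊤ : TopologicalSpace.PositiveCompacts G))
    simpa using this⟩
  have hint : Integrable (fun g => α g a) μ :=
    (hα a).integrable_of_hasCompactSupport (HasCompactSupport.of_compactSpace _)
  refine ⟨∫ g, α g a ∂μ, fun k => ?_, fun C c hC => ?_⟩
  · let L : A →L[ℂ] A := ⟨(α k : A →ₗ[ℂ] A),
      (AddMonoidHomClass.isometry_of_norm (α k) (StarAlgEquiv.norm_map (α k))).continuous⟩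
    have h1 : α k (∫ g, α g a ∂μ) = ∫ g, α k (α g a) ∂μ := (L.integral_comp_comm hint).symm
    have h2 : ∀ g, α k (α g a) = α (k * g) a := fun g => by rw [map_mul, StarAlgEquiv.mul_apply]
    rw [h1]
    simp only [h2]
    exact integral_mul_left_eq_self (fun g => α g a) k
  · have h : (∫ g, α g a ∂μ) - c = ∫ g, (α g a - c) ∂μ := by
      rw [integral_sub hint (integrable_const c)]
      simp
    rw [h]
    refine (norm_integral_le_of_norm_le_const (Eventually.of_forall hC)).trans ?_
    simp

/-- For each single `g` the late entries are almost fixed. Norm-continuity of the action on the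
whole sequence extends this to a neighbourhood of `g`, and compactness makes it uniform on `G`. -/
theorem eventually_norm_sub_lt {A G : Type*} [CStarAlgebra A] [Group G] [TopologicalSpace G]
    [CompactSpace G] {α : G →* (A ≃⋆ₐ[ℂ] A)} {x : ℕ →ᵇ A} (hx : x ∈ contSeq α)
    (hfix : ∀ g, eta A (seqMap (α g) x) = eta A x) {ε : ℝ} (hε : 0 < ε) :
    ∀ᶠ n in atTop, ∀ g, ‖α g (x n) - x n‖ < ε := by
  have hcomp : IsCompact (Set.univ : Set G) := isCompact_univ
  have key : ∀ᶠ n in atTop, ∀ g ∈ (Set.univ : Set G), ‖α g (x n) - x n‖ < ε := by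
    refine hcomp.induction_on (p := fun s => ∀ᶠ n in atTop, ∀ g ∈ s, ‖α g (x n) - x n‖ < ε)
      (by simp) (fun s t hst h => h.mono fun n hn g hg => hn g (hst hg))
      (fun s t hs ht => ?_) (fun k _ => ?_)
    · filter_upwards [hs, ht] with n h1 h2 g hg
      exact hg.elim (h1 g) (h2 g)
    · have hc := tendsto_iff_norm_sub_tendsto_zero.1 ((mem_contSeq_iff.1 hx).tendsto k)
      refine ⟨{g | ‖seqMap (α g) x - seqMap (α k) x‖ < ε / 2},
        mem_nhdsWithin_of_mem_nhds (hc (gt_mem_nhds (half_pos hε))), ?_⟩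
      have h0 : ‖eta A (seqMap (α k) x - x)‖ < ε / 2 := by
        rw [map_sub, hfix, sub_self, norm_zero]
        exact half_pos hε
      filter_upwards [eventually_norm_lt h0] with n hn g hg
      have h1 : ‖α g (x n) - α k (x n)‖ ≤ ‖seqMap (α g) x - seqMap (α k) x‖ :=
        (seqMap (α g) x - seqMap (α k) x).norm_coe_le_norm n
      have h2 : ‖α k (x n) - x n‖ < ε / 2 := hn
      calc ‖α g (x n) - x n‖ ≤ ‖α g (x n) - α k (x n)‖ + ‖α k (x n) - x n‖ :=
            norm_sub_le_norm_sub_add_norm_sub _ _ _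
        _ < ε := by
            have : ‖seqMap (α g) x - seqMap (α k) x‖ < ε / 2 := hg
            linarith
  exact key.mono fun n hn g => hn g trivial

theorem exists_fixedPoints_lift (hα : ∀ a : A, Continuous fun g : G => α g a) {x : ℕ →ᵇ A}
    (hx : x ∈ contSeq α) (hfix : ∀ g, eta A (seqMap (α g) x) = eta A x) :
    ∃ y : ℕ →ᵇ fixedPoints α, seqAlgHom (fixedPoints α).subtype (eta _ y) = eta A x := by
  choose b hb hbc using fun n => exists_average hα (x n)
  have hbound : ∀ n, ‖b n‖ ≤ ‖x‖ := fun n => by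
    have := hbc n ‖x‖ 0 fun g => by
      rw [sub_zero, StarAlgEquiv.norm_map]
      exact x.norm_coe_le_norm n
    rwa [sub_zero] at this
  refine ⟨bddSeq (fun n => ⟨b n, hb n⟩) ‖x‖ hbound, ?_⟩
  rw [seqAlgHom_eta, ← sub_eq_zero, ← map_sub, eta_eq_zero_iff, Metric.tendsto_atTop]
  intro ε hε
  obtain ⟨N, hN⟩ := eventually_atTop.1 (eventually_norm_sub_lt hx hfix (half_pos hε))
  refine ⟨N, fun n hn => ?_⟩
  rw [Real.dist_0_eq_abs, abs_norm]
  have : ‖b n - x n‖ ≤ ε / 2 := hbc n _ _ fun g => (hN n hn g).le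
  exact lt_of_le_of_lt this (half_lt_self hε)

end Average

/-! ### The fixed point inclusion is sequentially split. -/

section FixedPointAlgebra

variable {A G : Type*} [CStarAlgebra A] [TopologicalSpace.SeparableSpace A] [Group G]
  [TopologicalSpace G] [IsTopologicalGroup G] [CompactSpace G] [T2Space G]
  [FirstCountableTopology G] {α : G →* (A ≃⋆ₐ[ℂ] A)}

/-- The inclusion of the fixed point algebra is sequentially split. -/
theorem exists_sequentialSplitting_fixedPoints (hα : ∀ a : A, Continuous fun g : G => α g a)
    (hRok : HasRokhlinProperty α) :
    ∃ χ : A →⋆ₐ[ℂ] SeqAlg (fixedPoints α), ∀ b : fixedPoints α, χ (b : A) = diag b := by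
  obtain ⟨ψ, hψ, hψc, hψfix⟩ := exists_invariant_splitting α hα hRok
  have hinj : Function.Injective (seqAlgHom (fixedPoints α).subtype) :=
    seqAlgHom_injective _ Subtype.val_injective
  obtain ⟨χ, hχ⟩ := exists_starAlgHom_lift _ hinj ψ fun a => by
    obtain ⟨x, hx, hxa⟩ := hψc a
    have hxa' : eta A x = ψ a := hxa
    obtain ⟨y, hy⟩ := exists_fixedPoints_lift hα hx fun g => by
      rw [← seqAlgMap_eta, hxa', hψ]
    exact ⟨_, hy.trans hxa'⟩
  refine ⟨χ, fun b => hinj ?_⟩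
  rw [hχ, hψfix b b.2, seqAlgHom_diag]
  rfl

end FixedPointAlgebra

theorem separableSpace_fixedPoints {A G : Type*} [CStarAlgebra A]
    [TopologicalSpace.SeparableSpace A] [Group G] (α : G →* (A ≃⋆ₐ[ℂ] A)) :
    TopologicalSpace.SeparableSpace (fixedPoints α) := by
  have := UniformSpace.secondCountable_of_separable A
  exact inferInstanceAs (TopologicalSpace.SeparableSpace {a // a ∈ fixedPoints α})

/-! ### Matrix units and homomorphisms from matrix algebras -/

section MatrixUnits

variable {ι A S : Type*} [Fintype ι] [DecidableEq ι] [CStarAlgebra A] [CStarAlgebra S]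

/-- The homomorphism `M ↦ ∑ D (M i j) * E i j` given by matrix units `E` that commute with the
range of `D`. -/
def matrixHom (D : A →⋆ₐ[ℂ] S) (E : ι → ι → S)
    (hmul : ∀ i j k l, E i j * E k l = if j = k then E i l else 0)
    (hstar : ∀ i j, star (E i j) = E j i) (hone : ∑ i, E i i = 1)
    (hcomm : ∀ a i j, Commute (D a) (E i j)) : CStarMatrix ι ι A →⋆ₐ[ℂ] S where
  toFun M := ∑ i, ∑ j, D (M i j) * E i j
  map_one' := by
    simp [CStarMatrix.one_apply, apply_ite D, ite_mul, hone]
  map_mul' M N := by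
    have h : ∀ i j k l, D (M i j) * E i j * (D (N k l) * E k l) =
        if j = k then D (M i j * N k l) * E i l else 0 := fun i j k l => by
      rw [mul_assoc, ← mul_assoc (E i j), ← (hcomm _ i j).eq, mul_assoc, hmul, map_mul]
      split_ifs
      · rw [mul_assoc]
      · simp
    simp only [CStarMatrix.mul_apply, map_sum, Finset.sum_mul_sum, h]
    refine Finset.sum_congr rfl fun i _ => ?_
    rw [Finset.sum_comm (γ := ι) (f := fun k j => ∑ l, if j = k then D (M i j * N k l) * E i l else 0)]
    simp only [Finset.sum_ite_irrel, Finset.sum_const_zero, Finset.sum_ite_eq, Finset.mem_univ,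
      if_true, Finset.sum_mul]
    exact Finset.sum_comm
  map_zero' := by simp
  map_add' M N := by simp [add_mul, Finset.sum_add_distrib]
  commutes' c := by
    rw [Algebra.algebraMap_eq_smul_one, Algebra.algebraMap_eq_smul_one, ← hone]
    simp [CStarMatrix.one_apply, apply_ite D, ite_mul, Finset.smul_sum]
  map_star' M := by
    simp only [star_sum, star_mul, hstar, CStarMatrix.star_apply, map_star]
    rw [Finset.sum_comm]
    refine Finset.sum_congr rfl fun i _ => Finset.sum_congr rfl fun j _ => ?_
    rw [← map_star, (hcomm _ _ _).eq]

end MatrixUnits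

/-! ### The crossed product by a finite group -/

section CrossedProductSplitting

variable {A G : Type*} [CStarAlgebra A] [Group G] [DecidableEq G]

namespace CrossedProduct

variable (α : G →* (A ≃⋆ₐ[ℂ] A))

/-- The canonical unitaries. -/
def unit (g : G) : CrossedProduct α := fun h => if h = g then 1 else 0

/-- The inclusion of the coefficient algebra. -/
def coeffFun (a : A) : CrossedProduct α := fun h => if h = 1 then a else 0

theorem unit_apply (g h : G) : unit α g h = if h = g then 1 else 0 := rfl

theorem coeffFun_apply (a : A) (h : G) : coeffFun α a h = if h = 1 then a else 0 := rfl

theorem star_unit (g : G) : star (unit α g) = unit α g⁻¹ := by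
  ext k
  simp only [star_apply, unit_apply, apply_ite star, star_one, star_zero, apply_ite (α k), map_one,
    map_zero, inv_eq_iff_eq_inv]

variable [Fintype G]

theorem unit_mul_unit (g h : G) : unit α g * unit α h = unit α (g * h) := by
  ext k
  simp only [mul_apply, unit_apply, ite_mul, zero_mul, one_mul, Finset.sum_ite_eq',
    Finset.mem_univ, if_true, apply_ite (α g), map_one, map_zero, inv_mul_eq_iff_eq_mul]

theorem coeffFun_mul_unit_apply (a : A) (g k : G) :
    (coeffFun α a * unit α g) k = if k = g then a else 0 := by
  simp only [mul_apply, coeffFun_apply, unit_apply, ite_mul, zero_mul, Finset.sum_ite_eq',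
    Finset.mem_univ, if_true, map_one, StarAlgEquiv.one_apply, inv_one, one_mul, mul_ite, mul_one,
    mul_zero]

theorem unit_mul_coeffFun (g : G) (a : A) :
    unit α g * coeffFun α a = coeffFun α (α g a) * unit α g := by
  ext k
  rw [coeffFun_mul_unit_apply]
  simp only [mul_apply, coeffFun_apply, unit_apply, ite_mul, zero_mul, Finset.sum_ite_eq',
    Finset.mem_univ, if_true, one_mul, apply_ite (α g), map_zero, inv_mul_eq_one]
  simp only [eq_comm]

theorem sum_apply {κ : Type*} (s : Finset κ) (x : κ → CrossedProduct α) (k : G) :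
    (∑ i ∈ s, x i) k = ∑ i ∈ s, x i k :=
  Finset.sum_apply k s x

theorem eq_sum (x : CrossedProduct α) : x = ∑ g, coeffFun α (x g) * unit α g := by
  ext k
  simp only [sum_apply, coeffFun_mul_unit_apply]
  exact (Fintype.sum_ite_eq k (x : G → A)).symm

/-- The inclusion of the coefficient algebra as a homomorphism. -/
def coeff : A →⋆ₐ[ℂ] CrossedProduct α where
  toFun := coeffFun α
  map_one' := rfl
  map_mul' a b := by
    ext k
    simp only [mul_apply, coeffFun_apply, ite_mul, zero_mul, Finset.sum_ite_eq',
      Finset.mem_univ, if_true, map_one, StarAlgEquiv.one_apply, inv_one, one_mul, mul_ite,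
      mul_zero]
  map_zero' := by
    ext k
    exact ite_self _
  map_add' a b := by
    ext k
    rw [add_apply]
    simp only [coeffFun_apply]
    split_ifs <;> simp
  commutes' c := by
    rw [Algebra.algebraMap_eq_smul_one, Algebra.algebraMap_eq_smul_one]
    ext k
    rw [smul_apply, one_apply, coeffFun_apply]
    split_ifs <;> simp
  map_star' a := by
    ext k
    rw [star_apply]
    simp only [coeffFun_apply, inv_eq_one]
    split_ifs with h
    · simp [h]
    · simp

theorem separableSpace [TopologicalSpace.SeparableSpace A] :
    TopologicalSpace.SeparableSpace (CrossedProduct α) := by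
  let _ := matrixCStarAlgebra G A
  have := UniformSpace.secondCountable_of_separable A
  have : SecondCountableTopology (CStarMatrix G G A) :=
    inferInstanceAs (SecondCountableTopology (G → G → A))
  have hu : IsUniformInducing (regRep : CrossedProduct α → CStarMatrix G G A) := ⟨rfl⟩
  have := hu.isInducing.secondCountableTopology
  infer_instance

end CrossedProduct

/-- The translates of a point mass. -/
def pointMass [TopologicalSpace G] [DiscreteTopology G] (g : G) : C(G, ℂ) :=
  ⟨fun h => if h = g then 1 else 0, continuous_of_discreteTopology⟩

variable [Fintype G] [TopologicalSpace G] [IsTopologicalGroup G] [T2Space G] [TopologicalSpace.SeparableSpace A] {α : G →* (A ≃⋆ₐ[ℂ] A)}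

/-- A finite Hausdorff group is discrete, so the point masses are continuous; their images are the
projections, and left translation permutes them. -/
theorem exists_rokhlinProjections (hRok : HasRokhlinProperty α) :
    ∃ p : G → SeqAlg A, (∀ g, star (p g) = p g) ∧
      (∀ g h, p g * p h = if g = h then p g else 0) ∧ ∑ g, p g = 1 ∧
      (∀ g a, Commute (p g) (diag a)) ∧ ∀ g h, seqAlgMap (α g) (p h) = p (g * h) := by
  have : DiscreteTopology G := inferInstance
  obtain ⟨φ, hφ, -, hφe⟩ := exists_rokhlinHom α hRok
  refine ⟨fun g => φ (pointMass g), fun g => ?_, fun g h => ?_, ?_, fun g a => hφ _ _,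
    fun g h => ?_⟩
  · rw [← map_star]
    congr 1
    ext k
    simp [pointMass, apply_ite]
  · rw [← map_mul, ← map_zero φ, ← apply_ite φ]
    congr 1
    ext k
    split_ifs with hgh
    · subst hgh
      simp [pointMass]
    · by_cases hk : k = g
      · subst hk
        simp [pointMass, hgh]
      · simp [pointMass, hk]
  · rw [← map_sum, ← map_one φ]
    congr 1
    ext k
    simp [pointMass]
  · rw [← hφe]
    congr 1
    ext k
    simp [pointMass, leftTranslate, inv_mul_eq_iff_eq_mul]

open CrossedProduct in
/-- The regular representation of the crossed product is sequentially split. -/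
theorem exists_sequentialSplitting_regRepHom (hRok : HasRokhlinProperty α) :
    ∃ ψ : CStarMatrix G G A →⋆ₐ[ℂ] SeqAlg (CrossedProduct α), ∀ x, ψ (regRepHom α x) = diag x := by
  obtain ⟨p, hstar, hmul, hsum, hcomm, htr⟩ := exists_rokhlinProjections hRok
  have hdmul : ∀ a b : CrossedProduct α, diag (a * b) = diag a * diag b := map_mul (diagHom _)
  let J := seqAlgHom (coeff α)
  let U : G → SeqAlg (CrossedProduct α) := fun g => diag (unit α g)
  have hU1 : U 1 = 1 := map_one (diagHom _)
  have hUU : ∀ g h, U g * U h = U (g * h) := fun g h => by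
    rw [← hdmul, unit_mul_unit]
  have hUstar : ∀ g, star (U g) = U g⁻¹ := fun g => by
    rw [← diag_star, star_unit]
  have hUJ : ∀ g x, U g * J x = J (seqAlgMap (α g) x) * U g := by
    intro g x
    obtain ⟨x, rfl⟩ := eta_surjective x
    change eta _ _ * eta _ _ = eta _ _ * eta _ _
    rw [← map_mul, ← map_mul]
    congr 1
    ext n : 1
    exact unit_mul_coeffFun α g (x n)
  -- These are matrix units: `u_g p_h = p_(g h) u_g`, so the product of two of them either
  -- telescopes or contains orthogonal `p`'s.
  let E : G → G → SeqAlg (CrossedProduct α) := fun s t => J (p s) * U (s * t⁻¹)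
  have hE : ∀ s t, E s t = U (s * t⁻¹) * J (p t) := fun s t => by
    rw [hUJ, htr, inv_mul_cancel_right]
  have hpf : ∀ s (f : G → SeqAlg A), p s * ∑ t, p t * f t = p s * f s := fun s f => by
    simp only [Finset.mul_sum, ← mul_assoc, hmul, ite_mul, zero_mul, Finset.sum_ite_eq,
      Finset.mem_univ, if_true]
  have hcomm' : ∀ s (f : G → A), Commute (p s) (∑ t, p t * diagHom A (f t)) := fun s f => by
    refine Commute.sum_right _ _ _ fun t _ => Commute.mul_right ?_ (hcomm s _)
    rw [commute_iff_eq, hmul, hmul]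
    by_cases h : s = t
    · rw [if_pos h, if_pos h.symm, h]
    · rw [if_neg h, if_neg (Ne.symm h)]
  -- The finite form of the splitting by orbit functions. Its values are fixed by `α` in `A_∞` and
  -- commute with the `p s`, hence `J ∘ D₀` commutes with the matrix units.
  let D₀ : A →⋆ₐ[ℂ] SeqAlg A :=
    { toFun := fun a => ∑ s, p s * diagHom A (α s a)
      map_one' := by
        simp only [map_one]
        rw [← Finset.sum_mul, hsum, one_mul]
      map_mul' := fun a b => by
        rw [Finset.sum_mul]
        refine Finset.sum_congr rfl fun s _ => ?_
        have hc : Commute (p s) (diagHom A (α s a)) := hcomm s _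
        rw [hc.eq, mul_assoc, hpf, ← mul_assoc, ← hc.eq, map_mul, map_mul, mul_assoc]
      map_zero' := by
        simp only [map_zero, mul_zero, Finset.sum_const_zero]
      map_add' := fun a b => by
        simp only [map_add, mul_add, Finset.sum_add_distrib]
      commutes' := fun c => by
        simp only [AlgHomClass.commutes]
        rw [← Finset.sum_mul, hsum, one_mul]
      map_star' := fun a => by
        simp only [star_sum, star_mul, ← map_star, hstar]
        exact Finset.sum_congr rfl fun s _ => (hcomm s _).eq }
  have hpD : ∀ s a, p s * D₀ a = p s * diag (α s a) := fun s a => by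
    exact hpf s _
  have hDp : ∀ s a, D₀ a * p s = p s * diag (α s a) := fun s a =>
    (hcomm' s fun t => α t a).eq.symm.trans (hpD s a)
  let ψ := matrixHom (J.comp D₀) E (fun i j k l => by
      rw [hE i j]
      change U (i * j⁻¹) * J (p j) * (J (p k) * U (k * l⁻¹)) = _
      rw [mul_assoc, ← mul_assoc (J (p j)), ← map_mul, hmul]
      split_ifs with h
      · subst h
        rw [← mul_assoc, ← hE]
        change J (p i) * _ * _ = J (p i) * _
        rw [mul_assoc, hUU, ← mul_assoc, inv_mul_cancel_right]
      · simp) (fun i j => by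
      rw [hE j i]
      change star (J (p i) * _) = _
      rw [star_mul, ← map_star, hstar, hUstar, mul_inv_rev, inv_inv]) (by
      simp only [E, mul_inv_cancel, hU1, mul_one]
      rw [← map_sum, hsum, map_one]) (fun a i j => by
      change J (D₀ a) * (J (p i) * U _) = (J (p i) * U _) * J (D₀ a)
      rw [← mul_assoc, ← map_mul, hDp]
      change _ = E i j * _
      rw [hE, mul_assoc, ← map_mul, hpD, hUJ, map_mul (seqAlgMap _), htr, seqAlgMap_diag,
        inv_mul_cancel_right, ← StarAlgEquiv.mul_apply, ← map_mul, inv_mul_cancel_right])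
  refine ⟨ψ, fun x => ?_⟩
  change ∑ s, ∑ t, J (D₀ (α s⁻¹ (x (s * t⁻¹)))) * (J (p s) * U (s * t⁻¹)) = _
  -- The factor `p s` selects the `s`-th summand of `D₀`, where `α s` undoes the twist `α s⁻¹` of
  -- the regular representation. Row `s` then contributes `p s` times `diag x`, and the `p s` add up
  -- to `1`.
  have h1 : ∀ s t, J (D₀ (α s⁻¹ (x (s * t⁻¹)))) * (J (p s) * U (s * t⁻¹)) =
      J (p s) * (J (diag (x (s * t⁻¹))) * U (s * t⁻¹)) := fun s t => by
    rw [← mul_assoc, ← map_mul, hDp, apply_apply_inv, map_mul, mul_assoc]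
  have h2 : ∀ s, ∑ t, J (diag (x (s * t⁻¹))) * U (s * t⁻¹) = diag x := fun s => by
    have h3 : diag x = ∑ g, J (diag (x g)) * U g := by
      conv_lhs => rw [eq_sum α x]
      exact (map_sum (diagHom _) _ _).trans (Finset.sum_congr rfl fun g _ => hdmul _ _)
    rw [h3]
    exact Fintype.sum_equiv ((Equiv.inv G).trans (Equiv.mulLeft s)) _ _ fun t => rfl
  simp only [h1, ← Finset.mul_sum, h2]
  rw [← Finset.sum_mul, ← map_sum, hsum, map_one, one_mul]

end CrossedProductSplitting

/-! ### Orthogonal elements in hereditary subalgebras -/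

section Hereditary

variable {A : Type*} [CStarAlgebra A]

/-- Simple rings are prime: the right annihilator of `h A` is a two-sided ideal that does not
contain `1`. -/
theorem exists_mul_mul_ne_zero [IsSimpleRing A] {h z : A} (hh : h ≠ 0) (hz : z ≠ 0) :
    ∃ a, h * a * z ≠ 0 := by
  by_contra! hcon
  let I : TwoSidedIdeal A := TwoSidedIdeal.mk' {z | ∀ a, h * a * z = 0}
    (fun a => by simp) (fun {x y} hx hy a => by rw [mul_add, hx, hy, add_zero])
    (fun {x} hx a => by rw [mul_neg, hx, neg_zero])
    (fun {x y} hy a => by rw [← mul_assoc, mul_assoc h, hy])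
    (fun {x y} hx a => by rw [← mul_assoc, hx, zero_mul])
  have hI : ∀ x, x ∈ I ↔ ∀ a, h * a * x = 0 := fun x => TwoSidedIdeal.mem_mk' _ _ _ _ _ _ _
  rcases eq_bot_or_eq_top I with hI' | hI'
  · exact hz ((TwoSidedIdeal.mem_bot A).1 (hI' ▸ (hI z).2 hcon))
  · have h1 : (1 : A) ∈ I := hI' ▸ trivial
    exact hh (by simpa using (hI 1).1 h1 1)

theorem exists_ne_zero_mem_spectrum {b : A} (hb : IsSelfAdjoint b) (hb0 : b ≠ 0) :
    ∃ s ∈ spectrum ℝ b, s ≠ 0 := by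
  by_contra! h
  refine hb0 ?_
  rw [← cfc_id' ℝ b, ← cfc_zero (R := ℝ) b]
  exact cfc_congr h

theorem cfc_ne_zero {b : A} (hb : IsSelfAdjoint b) {f : ℝ → ℝ} (hf : Continuous f) {s : ℝ}
    (hs : s ∈ spectrum ℝ b) (hfs : f s ≠ 0) : cfc f b ≠ 0 := by
  intro h
  rw [← cfc_const_zero ℝ b] at h
  exact hfs (eqOn_of_cfc_eq_cfc h hf.continuousOn continuousOn_const hb hs)

theorem mul_cfc_self {b : A} (hb : IsSelfAdjoint b) {f : ℝ → ℝ} (hf : Continuous f) :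
    b * cfc f b = cfc (fun x => x * f x) b := by
  conv_lhs => rw [← cfc_id' ℝ b hb]
  rw [cfc_id' ℝ b hb, cfc_mul (fun x => x) f b continuousOn_id hf.continuousOn, cfc_id' ℝ b hb]

/-- For `z ≠ 0` there are `t ∈ z A` and a nonzero positive `y ∈ z* A z` with `t* t y = y`. -/
theorem exists_localIsometry {z : A} (hz : z ≠ 0) :
    ∃ r k c : A, c ≠ 0 ∧ star c * c = star z * k * z ∧
      star (z * r) * (z * r) * (star c * c) = star c * c := by
  let _ := CStarAlgebra.spectralOrder A
  let _ := CStarAlgebra.spectralOrderedRing A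
  set b := star z * z with hb
  have hb0 : b ≠ 0 := by rwa [hb, ne_eq, CStarRing.star_mul_self_eq_zero_iff]
  have hbs : IsSelfAdjoint b := IsSelfAdjoint.star_mul_self z
  have hbn : 0 ≤ b := star_mul_self_nonneg z
  obtain ⟨s, hs, hs0⟩ := exists_ne_zero_mem_spectrum hbs hb0
  have hspos : 0 < s := lt_of_le_of_ne (spectrum_nonneg_of_nonneg hbn hs) hs0.symm
  -- `x * g(x)² = 1` for `x ≥ s/2`, while `m` vanishes for `x ≤ s/2` and not at `s`. So `z * g(b)`
  -- acts isometrically wherever `c = b * m(b)` lives, and `c ≠ 0`.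
  let g : ℝ → ℝ := fun x => (√(max x (s / 2)))⁻¹
  let m : ℝ → ℝ := fun x => √(max 0 (x - s / 2))
  have hg : Continuous g := by
    refine Continuous.inv₀ (by fun_prop) fun x => (Real.sqrt_pos.2 ?_).ne'
    exact lt_max_of_lt_right (half_pos hspos)
  have hm : Continuous m := by fun_prop
  let c := cfc (fun x => x * m x) b
  have hcs : star c = c := (cfc_predicate (R := ℝ) _ b : IsSelfAdjoint c).star_eq
  have hgs : star (cfc g b) = cfc g b := (cfc_predicate (R := ℝ) _ b : IsSelfAdjoint _).star_eq
  have hcc : c = b * cfc m b := (mul_cfc_self hbs hm).symm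
  have hmb : Commute (cfc m b) b := by
    have h := cfc_commute_cfc m (fun x => x) b
    rwa [cfc_id' ℝ b hbs] at h
  refine ⟨cfc g b, z * cfc m b * cfc m b * star z, c, ?_, ?_, ?_⟩
  · refine cfc_ne_zero hbs (by fun_prop) hs (mul_ne_zero hs0 (Real.sqrt_ne_zero'.2 ?_))
    exact lt_max_of_lt_right (by linarith)
  · have h1 : star z * (z * cfc m b * cfc m b * star z) * z = b * cfc m b * (cfc m b * b) := by
      simp only [hb, mul_assoc]
    rw [hcs, h1, hmb.eq, hcc]
  · have h1 : star (z * cfc g b) * (z * cfc g b) = cfc g b * (b * cfc g b) := by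
      rw [star_mul, hgs]
      simp only [hb, mul_assoc]
    have h2 : cfc g b * (b * cfc g b) * c = c := by
      rw [mul_cfc_self hbs hg, ← cfc_mul g _ b hg.continuousOn (by fun_prop),
        ← cfc_mul _ _ b (by fun_prop) (by fun_prop)]
      refine cfc_congr fun x _ => ?_
      rcases le_total x (s / 2) with hx | hx
      · have : m x = 0 := by
          simp only [m]
          rw [max_eq_left (by linarith), Real.sqrt_zero]
        simp [this]
      · have hx0 : 0 < x := lt_of_lt_of_le (half_pos hspos) hx
        have : g x * (x * g x) = 1 := by
          simp only [g]
          rw [max_eq_left hx]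
          have h := Real.mul_self_sqrt hx0.le
          have h' := (Real.sqrt_pos.2 hx0).ne'
          field_simp
          nlinarith
        rw [this, one_mul]
    rw [h1, hcs, ← mul_assoc, h2]

/-- If no two nonzero elements of `y A` have orthogonal ranges, then `y A` contains a minimal
projection. -/
theorem exists_isMinimalProjection {y : A} (hy : y ≠ 0)
    (h : ∀ a b : A, star (y * a) * (y * b) = 0 → y * a = 0 ∨ y * b = 0) :
    ∃ e a : A, e = y * a ∧ IsMinimalProjection e := by
  -- every self-adjoint element of `y A` is a multiple of a projection
  have key : ∀ b a : A, IsSelfAdjoint b → b = y * a → ∃ μ : ℝ, b * b = μ • b := by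
    intro b a hb hba
    by_contra! hcon
    obtain ⟨s, hs, t, ht, hs0, ht0, hst⟩ :
        ∃ s ∈ spectrum ℝ b, ∃ t ∈ spectrum ℝ b, s ≠ 0 ∧ t ≠ 0 ∧ s ≠ t := by
      by_contra! hno
      obtain ⟨s, hs, hs0⟩ := exists_ne_zero_mem_spectrum hb fun h0 => hcon 0 (by simp [h0])
      refine hcon s ?_
      conv_lhs => rw [← cfc_id' ℝ b]
      conv_rhs => rw [← cfc_id' ℝ b]
      rw [← cfc_mul _ _ b, ← cfc_smul s _ b]
      refine cfc_congr fun t ht => ?_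
      by_cases ht0 : t = 0
      · simp [ht0]
      · simp [hno s hs t ht hs0 ht0]
    -- Bumps of radius `|s - t| / 2` about `s` and `t` have disjoint supports. They give two nonzero
    -- elements of `y A` with orthogonal ranges, against the hypothesis.
    let k : ℝ → ℝ → ℝ := fun r x => max 0 (|s - t| / 2 - |x - r|)
    have hk : ∀ r, Continuous (k r) := fun r => by fun_prop
    have hpos : 0 < |s - t| := abs_pos.2 (sub_ne_zero.2 hst)
    have hkr : ∀ r, k r r ≠ 0 := fun r => by
      have : 0 < k r r := lt_max_of_lt_right (by simpa using hpos)
      exact this.ne'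
    have hkk : ∀ x, k s x * k t x = 0 := fun x => by
      by_contra hne
      have h1 : 0 < |s - t| / 2 - |x - s| := by
        by_contra hle
        exact hne (by simp only [k]; rw [max_eq_left (not_lt.1 hle), zero_mul])
      have h2 : 0 < |s - t| / 2 - |x - t| := by
        by_contra hle
        exact hne (by simp only [k]; rw [max_eq_left (not_lt.1 hle), mul_zero])
      have := abs_sub_le s x t
      rw [abs_sub_comm s x] at this
      linarith
    have hsplit : ∀ r, y * (a * cfc (k r) b) = cfc (fun x => x * k r x) b := fun r => by
      rw [← mul_assoc, ← hba, mul_cfc_self hb (hk r)]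
    have hsa : star (cfc (fun x => x * k s x) b) = cfc (fun x => x * k s x) b :=
      (cfc_predicate (R := ℝ) _ b : IsSelfAdjoint _).star_eq
    have h0 : ∀ r, r ∈ spectrum ℝ b → r ≠ 0 → cfc (fun x => x * k r x) b ≠ 0 := fun r hr hr0 =>
      cfc_ne_zero hb (by fun_prop) hr (mul_ne_zero hr0 (hkr r))
    rcases h (a * cfc (k s) b) (a * cfc (k t) b) (by
      rw [hsplit, hsplit, hsa, ← cfc_mul _ _ b, ← cfc_zero ℝ b]
      refine cfc_congr fun x _ => ?_
      have := hkk x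
      simp only [Pi.zero_apply]
      linear_combination x * x * this) with h' | h'
    · exact h0 s hs hs0 (hsplit s ▸ h')
    · exact h0 t ht ht0 (hsplit t ▸ h')
  have hyy : y * star y ≠ 0 := by rwa [ne_eq, CStarRing.mul_star_self_eq_zero_iff]
  have hyys : IsSelfAdjoint (y * star y) := IsSelfAdjoint.mul_star_self y
  obtain ⟨l, hl⟩ := key _ _ hyys rfl
  have hl0 : l ≠ 0 := by
    rintro rfl
    rw [zero_smul] at hl
    nth_rewrite 1 [← hyys.star_eq] at hl
    exact hyy (CStarRing.star_mul_self_eq_zero_iff _ |>.1 hl)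
  have hproj : ∀ {b : A} {μ : ℝ}, IsSelfAdjoint b → μ ≠ 0 → b * b = μ • b →
      IsStarProjection (μ⁻¹ • b) := fun {b μ} hb hμ hbb => by
    refine ⟨?_, ?_⟩
    · change μ⁻¹ • b * μ⁻¹ • b = μ⁻¹ • b
      rw [smul_mul_smul_comm, hbb, smul_smul]
      congr 1
      field_simp
    · rw [isSelfAdjoint_iff, star_smul, hb.star_eq]
      simp
  set e := l⁻¹ • (y * star y) with he
  have hep : IsStarProjection e := hproj hyys hl0 hl
  have hee : e * e = e := hep.isIdempotentElem
  have hes : star e = e := hep.isSelfAdjoint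
  have hey : e = y * (l⁻¹ • star y) := by rw [mul_smul_comm]
  have he0 : e ≠ 0 := smul_ne_zero (inv_ne_zero hl0) hyy
  clear_value e
  have hsa : ∀ x : A, IsSelfAdjoint x → ∃ c : ℂ, e * x * e = c • e := by
    intro x hx
    set b := e * x * e with hb
    have hbs : IsSelfAdjoint b := by
      rw [isSelfAdjoint_iff, hb, star_mul, star_mul, hes, hx.star_eq, mul_assoc]
    have heb : e * b = b := by rw [hb, ← mul_assoc, ← mul_assoc, hee]
    obtain ⟨μ, hμ⟩ := key b (l⁻¹ • star y * (x * e)) hbs (by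
      rw [← mul_assoc, ← hey, hb, mul_assoc])
    by_cases hμ0 : μ = 0
    · refine ⟨0, ?_⟩
      rw [hμ0, zero_smul] at hμ
      nth_rewrite 1 [← hbs.star_eq] at hμ
      rw [zero_smul]
      exact CStarRing.star_mul_self_eq_zero_iff _ |>.1 hμ
    · have hf := hproj hbs hμ0 hμ
      set f := μ⁻¹ • b with hfdef
      have hef : e * f = f := by rw [hfdef, mul_smul_comm, heb]
      have hff : f * f = f := hf.isIdempotentElem
      have hfs : star f = f := hf.isSelfAdjoint
      have hbf : b = (μ : ℂ) • f := by
        rw [Complex.coe_smul, hfdef, smul_smul, mul_inv_cancel₀ hμ0, one_smul]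
      have hfe : f * e = f := by
        have := congrArg star hef
        rwa [star_mul, hes, hfs] at this
      have e1 : y * (l⁻¹ • star y * f) = f := by rw [← mul_assoc, ← hey, hef]
      have e2 : y * (l⁻¹ • star y * (e - f)) = e - f := by
        rw [← mul_assoc, ← hey, mul_sub, hee, hef]
      -- `f` and `e - f` are elements of `y A` with orthogonal ranges, so one of them vanishes and
      -- `b` is a multiple of `e`.
      rcases h (l⁻¹ • star y * f) (l⁻¹ • star y * (e - f)) (by rw [e1, e2, hfs, mul_sub, hfe, hff, sub_self]) with h' | h'
      · refine ⟨0, ?_⟩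
        rw [e1] at h'
        rw [hbf, h', smul_zero, zero_smul]
      · rw [e2, sub_eq_zero] at h'
        exact ⟨μ, by rw [hbf, h']⟩
  refine ⟨e, _, hey, hep, he0, fun x => ?_⟩
  obtain ⟨a, ha⟩ := hsa _ (realPart x).2
  obtain ⟨b, hb⟩ := hsa _ (imaginaryPart x).2
  refine ⟨a + Complex.I * b, ?_⟩
  conv_lhs => rw [← realPart_add_I_smul_imaginaryPart x]
  rw [mul_add, add_mul, ha, mul_smul_comm, smul_mul_assoc, hb, smul_smul, add_smul]

end Hereditary

/-! ### Orthogonal families from the Rokhlin property -/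

section OrthogonalFamilies

/-- Split `y` into two orthogonal pieces, keep the first and continue inside the second. -/
theorem exists_orthogonal_fin {A : Type*} [CStarAlgebra A]
    (hpair : ∀ y : A, y ≠ 0 → ∃ a b, star (y * a) * (y * b) = 0 ∧ y * a ≠ 0 ∧ y * b ≠ 0) (n : ℕ) :
    ∀ y : A, y ≠ 0 → ∃ a : Fin n → A, (∀ i, y * a i ≠ 0) ∧
      ∀ i j, i ≠ j → star (y * a i) * (y * a j) = 0 := by
  induction n with
  | zero => exact fun y _ => ⟨fun _ => 0, fun i => i.elim0, fun i => i.elim0⟩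
  | succ n ih =>
    intro y hy
    obtain ⟨a, b, hab, ha, hb⟩ := hpair y hy
    obtain ⟨c, hc, hcc⟩ := ih (y * b) hb
    simp only [mul_assoc y b] at hc hcc
    have h0 : ∀ j, star (y * a) * (y * (b * c j)) = 0 := fun j => by
      rw [← mul_assoc y, ← mul_assoc, hab, zero_mul]
    have h0' : ∀ j, star (y * (b * c j)) * (y * a) = 0 := fun j => by
      rw [← star_star (y * a), ← star_mul, h0, star_zero]
    refine ⟨Fin.cons a fun i => b * c i, fun i => ?_, fun i j => ?_⟩
    · refine Fin.cases ?_ (fun i => ?_) i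
      · exact ha
      · exact hc i
    · refine Fin.cases (fun j => ?_) (fun i j => ?_) i j
      · refine Fin.cases (fun h => (h rfl).elim) (fun j _ => ?_) j
        exact h0 j
      · refine Fin.cases (fun _ => ?_) (fun j h => ?_) j
        · exact h0' i
        · exact hcc i j fun hij => h (congrArg Fin.succ hij)

/-- Finitely many nonzero elements dominate, up to local isometries, a common nonzero positive
element. -/
theorem exists_common_localIsometry {A κ : Type*} [CStarAlgebra A] [IsSimpleRing A] (h : κ → A)
    (hh : ∀ i, h i ≠ 0) (s : Finset κ) :
    ∃ (c : A) (r : κ → A), c ≠ 0 ∧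
      ∀ i ∈ s, star (h i * r i) * (h i * r i) * (star c * c) = star c * c := by
  classical
  induction s using Finset.induction_on with
  | empty => exact ⟨1, 0, one_ne_zero, by simp⟩
  | insert i s his ih =>
    obtain ⟨c, r, hc, hr⟩ := ih
    have hw : star c * c ≠ 0 := by rwa [ne_eq, CStarRing.star_mul_self_eq_zero_iff]
    -- Simplicity links `h i` to the common element found so far. The new `star c' * c'` has the
    -- form `star c * c * _`, so the relations already obtained persist.
    obtain ⟨a, ha⟩ := exists_mul_mul_ne_zero (hh i) hw
    obtain ⟨r', k, c', hc', hk, hr'⟩ := exists_localIsometry ha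
    refine ⟨c', Function.update r i (a * (star c * c) * r'), hc', fun j hj => ?_⟩
    by_cases hji : j = i
    · subst hji
      rw [Function.update_self]
      simpa only [mul_assoc] using hr'
    · have hz : star (h i * a * (star c * c)) = star c * c * star (h i * a) := by
        rw [star_mul, (IsSelfAdjoint.star_mul_self c).star_eq]
      rw [Function.update_of_ne hji, hk, hz, mul_assoc _ k, mul_assoc (star c * c),
        ← mul_assoc _ (star c * c), hr j ((Finset.mem_insert.1 hj).resolve_left hji)]

variable {A G : Type*} [CStarAlgebra A] [Group G] [Fintype G] [DecidableEq G] [TopologicalSpace G]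
  [IsTopologicalGroup G] [T2Space G] [TopologicalSpace.SeparableSpace A]
  {α : G →* (A ≃⋆ₐ[ℂ] A)}

/-- Otherwise `A` has a minimal projection `e`, and `e * P n * e` is a multiple of `e` for any lift
`P` of a Rokhlin projection. By simplicity each `p g` is then the class of a scalar sequence, so `α`
fixes it and `p (g * h) = p h`. For `g ≠ 1` orthogonality gives `p h = 0`, although the `p h` sum to
`1`. -/
theorem exists_orthogonal_pair [IsSimpleRing A] [Nontrivial G] (hRok : HasRokhlinProperty α) {y : A}
    (hy : y ≠ 0) : ∃ a b, star (y * a) * (y * b) = 0 ∧ y * a ≠ 0 ∧ y * b ≠ 0 := by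
  by_contra! hcon
  obtain ⟨e, -, -, he⟩ := exists_isMinimalProjection hy fun a b hab =>
    or_iff_not_imp_left.2 (hcon a b hab)
  obtain ⟨p, hstar, hmul, hsum, hcomm, htr⟩ := exists_rokhlinProjections hRok
  have hdmul : ∀ a b : A, diag (a * b) = diag a * diag b := map_mul (diagHom A)
  have hee : e * e = e := he.isStarProjection.isIdempotentElem
  -- the Rokhlin projections are sequences of scalars
  have hscalar : ∀ g, ∃ x : ℕ →ᵇ A, eta A x = p g ∧ ∀ n, ∃ c : ℂ, x n = c • 1 := fun g => by
    obtain ⟨P, hP⟩ := eta_surjective (p g)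
    choose ζ hζ using fun n => he.corner (P n)
    have he0 : 0 < ‖e‖ := norm_pos_iff.2 he.ne_zero
    have he1 : ‖e‖ ≤ 1 := norm_projection_le_one he.isStarProjection
    have hb : ∀ n, ‖ζ n • (1 : A)‖ ≤ ‖P‖ := fun n => by
      rw [norm_smul, CStarRing.norm_one, mul_one]
      refine le_of_mul_le_mul_right ?_ he0
      calc ‖ζ n‖ * ‖e‖ = ‖e * P n * e‖ := by rw [hζ, norm_smul]
        _ ≤ ‖e‖ * ‖P n‖ * ‖e‖ := norm_mul₃_le
        _ ≤ 1 * ‖P‖ * ‖e‖ := by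
          gcongr
          exact P.norm_coe_le_norm n
        _ = ‖P‖ * ‖e‖ := by rw [one_mul]
    let x : ℕ →ᵇ A := bddSeq (fun n => ζ n • (1 : A)) ‖P‖ hb
    have hxc : ∀ a, Commute (eta A x) (diag a) := fun a => by
      change eta A x * eta A _ = eta A _ * eta A x
      rw [← map_mul, ← map_mul]
      congr 1
      ext n : 1
      change ζ n • 1 * a = a * ζ n • 1
      simp
    have hrc : ∀ a, Commute (p g - eta A x) (diag a) := fun a => (hcomm g a).sub_left (hxc a)
    have hre : (p g - eta A x) * diag e = 0 := by
      have h1 : p g * diag e = diag e * p g * diag e := by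
        conv_lhs => rw [← hee, hdmul, ← mul_assoc, (hcomm g e).eq]
      have h2 : diag e * p g * diag e = eta A x * diag e := by
        rw [← hP]
        change eta A _ * eta A P * eta A _ = eta A x * eta A _
        rw [← map_mul, ← map_mul, ← map_mul]
        congr 1
        ext n : 1
        change e * P n * e = ζ n • 1 * e
        rw [hζ, smul_mul_assoc, one_mul]
      rw [sub_mul, h1, h2, sub_self]
    -- The difference `p g - eta A x` commutes with the constant sequences, so the elements of `A`
    -- it annihilates form an ideal. That ideal contains `e ≠ 0`, hence also `1`.
    let I : TwoSidedIdeal A := TwoSidedIdeal.mk' {a | (p g - eta A x) * diag a = 0}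
      ((congrArg _ (map_zero (diagHom A))).trans (mul_zero _))
      (fun {a b} ha hb => by
        change _ * diagHom A (a + b) = 0
        rw [map_add, mul_add]
        exact (congrArg₂ _ ha hb).trans (add_zero _))
      (fun {a} ha => by
        change _ * diagHom A (-a) = 0
        rw [map_neg, mul_neg]
        exact (congrArg _ ha).trans neg_zero)
      (fun {a b} hb => by
        change _ * diag (a * b) = 0
        rw [hdmul, ← mul_assoc, (hrc a).eq, mul_assoc]
        exact (congrArg _ hb).trans (mul_zero _))
      (fun {a b} ha => by
        change _ * diag (a * b) = 0
        rw [hdmul, ← mul_assoc]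
        exact (congrArg (· * diag b) ha).trans (zero_mul _))
    have hI : ∀ a, a ∈ I ↔ (p g - eta A x) * diag a = 0 := fun a =>
      TwoSidedIdeal.mem_mk' _ _ _ _ _ _ _
    refine ⟨x, ?_, fun n => ⟨ζ n, rfl⟩⟩
    rcases eq_bot_or_eq_top I with hI' | hI'
    · exact (he.ne_zero ((TwoSidedIdeal.mem_bot A).1 (hI' ▸ (hI e).2 hre))).elim
    · have h1 : (1 : A) ∈ I := hI' ▸ trivial
      have h2 : (p g - eta A x) * diagHom A 1 = 0 := (hI 1).1 h1
      rw [map_one, mul_one, sub_eq_zero] at h2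
      exact h2.symm
  have hfix : ∀ g h, p (g * h) = p h := fun g h => by
    obtain ⟨x, hx, hxn⟩ := hscalar h
    rw [← htr, ← hx, seqAlgMap_eta]
    congr 1
    ext n : 1
    obtain ⟨c, hc⟩ := hxn n
    rw [seqMap_apply, hc, map_smul, map_one]
  obtain ⟨g, hg⟩ := exists_ne (1 : G)
  have hzero : ∀ h, p h = 0 := fun h => by
    have h1 := hmul (g * h) h
    have h2 := hmul h h
    rw [if_neg (by simpa using hg), hfix] at h1
    rwa [h1, if_pos rfl, eq_comm] at h2
  simp only [hzero, Finset.sum_const_zero] at hsum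
  have : (diag (0 : A)) = diag 1 := (map_zero (diagHom A)).trans (hsum.trans (map_one (diagHom A)).symm)
  exact zero_ne_one (diag_injective this)

/-- For trivial `G` the algebra may have minimal projections, but then only one element is needed.
-/
theorem exists_orthogonal_family [IsSimpleRing A] (hRok : HasRokhlinProperty α) {y : A}
    (hy : y ≠ 0) :
    ∃ a : G → A, (∀ g, y * a g ≠ 0) ∧ ∀ g h, g ≠ h → star (y * a g) * (y * a h) = 0 := by
  rcases subsingleton_or_nontrivial G with hG | hG
  · exact ⟨fun _ => 1, fun _ => by rwa [mul_one], fun g h hgh => (hgh (Subsingleton.elim g h)).elim⟩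
  · obtain ⟨a, ha, hab⟩ := exists_orthogonal_fin (fun y hy => exists_orthogonal_pair hRok hy)
      (Fintype.card G) y hy
    exact ⟨fun g => a (Fintype.equivFin G g), fun g => ha _, fun g h hgh =>
      hab _ _ fun h' => hgh ((Fintype.equivFin G).injective h')⟩

/-- Over a nonzero `y` there are local isometries with mutually orthogonal ranges and a common
nonzero positive element in their initial spaces. -/
theorem exists_orthogonal_localIsometries [IsSimpleRing A] (hRok : HasRokhlinProperty α) {y : A}
    (hy : y ≠ 0) :
    ∃ (c : A) (t : G → A), c ≠ 0 ∧ (∀ g, ∃ a, t g = y * a) ∧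
      ∀ g h, star (t g) * t h * (star c * c) = if g = h then star c * c else 0 := by
  obtain ⟨a, ha, hab⟩ := exists_orthogonal_family hRok hy
  obtain ⟨c, r, hc, hr⟩ := exists_common_localIsometry _ ha Finset.univ
  refine ⟨c, fun g => y * a g * r g, hc, fun g => ⟨a g * r g, mul_assoc _ _ _⟩, fun g h => ?_⟩
  split_ifs with hgh
  · subst hgh
    exact hr g (Finset.mem_univ g)
  · rw [star_mul, mul_assoc (star (r g)), ← mul_assoc (star (y * a g)), hab g h hgh, zero_mul,
      mul_zero, zero_mul]

end OrthogonalFamilies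

/-! ### Tracial approximation of matrix algebras -/

section MatrixTracialRank

open CrossedProduct

attribute [local instance] matrixCStarAlgebra

variable {A G : Type*} [CStarAlgebra A]

theorem isSimpleRing_cstarMatrix [Fintype G] [Nonempty G] [IsSimpleRing A] :
    IsSimpleRing (CStarMatrix G G A) :=
  IsSimpleRing.of_ringEquiv (CStarMatrix.ofMatrixRingEquiv (n := G) (A := A)) inferInstance

/-- The diagonal matrix with constant entry `a`. -/
def scalarMatrix [DecidableEq G] (a : A) : CStarMatrix G G A :=
  CStarMatrix.ofMatrix (Matrix.diagonal fun _ => a)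

theorem scalarMatrix_apply [DecidableEq G] (a : A) (i j : G) :
    (scalarMatrix a : CStarMatrix G G A) i j = if i = j then a else 0 :=
  Matrix.diagonal_apply _ _ _

variable [Fintype G] [DecidableEq G]

/-- The topology of the matrix algebra is the entrywise one, so its `C*`-norm is continuous at `0`
in the entries. -/
theorem exists_norm_lt_of_entries {ε : ℝ} (hε : 0 < ε) :
    ∃ δ > 0, ∀ M : CStarMatrix G G A, (∀ i j, ‖M i j‖ < δ) → ‖M‖ < ε := by
  have hc : Continuous fun M : G → G → A => ‖(CStarMatrix.ofMatrix M : CStarMatrix G G A)‖ :=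
    continuous_norm.comp (continuous_id : Continuous (id : CStarMatrix G G A → CStarMatrix G G A))
  obtain ⟨δ, hδ, hδ'⟩ := Metric.continuousAt_iff.1 (hc.continuousAt (x := 0)) ε hε
  refine ⟨δ, hδ, fun M hM => ?_⟩
  have h := @hδ' (fun i j => M i j) (by
    rw [dist_zero_right, pi_norm_lt_iff hδ]
    intro i
    rw [pi_norm_lt_iff hδ]
    exact hM i)
  have h0 : (CStarMatrix.ofMatrix (0 : G → G → A) : CStarMatrix G G A) = 0 := rfl
  rw [h0, norm_zero, dist_zero_right, norm_norm] at h
  exact h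

/-- The matrix with a single entry. -/
def entry (i j : G) (a : A) : CStarMatrix G G A := CStarMatrix.ofMatrix (Matrix.single i j a)

theorem mul_entry (M : CStarMatrix G G A) (i j k l : G) (a : A) :
    (M * entry i j a) k l = if l = j then M k i * a else 0 := by
  split_ifs with h
  · subst h
    exact Matrix.mul_single_apply_same a i l k M
  · exact Matrix.mul_single_apply_of_ne a i j k l h M

theorem entry_mul (M : CStarMatrix G G A) (i j k l : G) (a : A) :
    (entry i j a * M) k l = if k = i then a * M j l else 0 := by
  split_ifs with h
  · subst h
    exact Matrix.single_mul_apply_same a k j l M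
  · exact Matrix.single_mul_apply_of_ne a i j k l h M

theorem star_entry {A G : Type*} [CStarAlgebra A] [DecidableEq G] (i j : G) (a : A) : star (entry i j a) = entry j i (star a) :=
  Matrix.conjTranspose_single i j a

theorem entry_mul_mul_entry (M : CStarMatrix G G A) (i j k l : G) (a b : A) :
    entry i j a * M * entry k l b = entry i l (a * M j k * b) :=
  Matrix.single_mul_mul_single i j k l a M b

/-- A nonzero matrix dominates, up to a local isometry, a nonzero matrix with a single entry. -/
theorem exists_localIsometry_entry {x : CStarMatrix G G A} (hx : x ≠ 0) :
    ∃ (r : CStarMatrix G G A) (i : G) (y : A), y ≠ 0 ∧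
      star (x * r) * (x * r) * entry i i y = entry i i y := by
  obtain ⟨i, j, hij⟩ : ∃ i j, x i j ≠ 0 := by
    by_contra! h
    exact hx (CStarMatrix.ext h)
  have hz : x * entry j i 1 ≠ 0 := fun h => by
    have := congrFun (congrFun h i) i
    rw [mul_entry, if_pos rfl, mul_one] at this
    exact hij this
  obtain ⟨r, k, c, hc, hk, hr⟩ := exists_localIsometry hz
  -- With `z = x * entry j i 1`, any `star z * k * z` is concentrated in the entry `(i, i)`.
  have hk' : star c * c = entry i i ((star x * k * x) j j) := by
    rw [hk, star_mul, star_entry, star_one]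
    have := entry_mul_mul_entry (star x * k * x) i j j i 1 1
    simpa only [mul_assoc, one_mul, mul_one] using this
  refine ⟨entry j i 1 * r, i, (star x * k * x) j j, fun h => ?_, ?_⟩
  · rw [h] at hk'
    have h0 : entry i i (0 : A) = 0 := congrArg CStarMatrix.ofMatrix (Matrix.single_zero i i)
    rw [h0, CStarRing.star_mul_self_eq_zero_iff] at hk'
    exact hc hk'
  · rw [← hk', ← mul_assoc x]
    exact hr

theorem scalarMatrix_mul_apply (a : A) (M : CStarMatrix G G A) (i j : G) :
    (scalarMatrix a * M : CStarMatrix G G A) i j = a * M i j :=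
  Matrix.diagonal_mul _ _ _ _

theorem mul_scalarMatrix_apply (a : A) (M : CStarMatrix G G A) (i j : G) :
    (M * scalarMatrix a : CStarMatrix G G A) i j = M i j * a :=
  Matrix.mul_diagonal _ _ _ _

/-- The projection `p` and `φ` are amplified entrywise; `κ` only allows another model `D'` for the
matrices over `D`. The complement consists of `|G|` copies of `1 - p`, each equivalent to `q`. The
orthogonal local isometries `t g` place these copies side by side in one corner, and `x * r` carries
them isometrically below `x`. -/
theorem isTracialApprox_matrix {D D' : Type*} [CStarAlgebra D] [CStarAlgebra D'] [Nonempty G]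
    (κ : D' →⋆ₐ[ℂ] CStarMatrix G G D) (hκ : Function.Surjective κ)
    {F : Finset (CStarMatrix G G A)} {F' : Finset A} (hF : ∀ M ∈ F, ∀ i j, M i j ∈ F') {ε δ : ℝ}
    (hδ : ∀ M : CStarMatrix G G A, (∀ i j, ‖M i j‖ < δ) → ‖M‖ < ε)
    {x r : CStarMatrix G G A} (hx : IsSelfAdjoint x) {i₀ : G} {y : A}
    (hr : star (x * r) * (x * r) * entry i₀ i₀ y = entry i₀ i₀ y) {w : A} {t : G → A}
    (ht : ∀ g, ∃ a, t g = y * a)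
    (htw : ∀ g h, star (t g) * t h * w = if g = h then w else 0)
    {p : A} {φ : D →⋆ₙₐ[ℂ] A} (h : IsTracialApprox F' δ w p φ) :
    IsTracialApprox F ε x (scalarMatrix p : CStarMatrix G G A)
      ((CStarMatrix.mapₙₐ φ).comp (κ : D' →⋆ₙₐ[ℂ] CStarMatrix G G D)) := by
  obtain ⟨hp, hp0, hφ1, hcomm, happ, q, hq, hqw, v, hv, hvq⟩ := h
  have hP : IsStarProjection (scalarMatrix p : CStarMatrix G G A) := by
    refine ⟨?_, ?_⟩
    · ext i j
      rw [scalarMatrix_mul_apply, scalarMatrix_apply, mul_ite, mul_zero, hp.isIdempotentElem.eq]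
    · ext i j
      rw [CStarMatrix.star_apply, scalarMatrix_apply, scalarMatrix_apply, apply_ite star, star_zero,
        hp.isSelfAdjoint.star_eq]
      simp only [eq_comm]
  refine ⟨hP, ?_, ?_, fun M hM => hδ _ fun i j => ?_, fun M hM => ?_, ?_⟩
  · intro h0
    have i : G := Classical.arbitrary G
    have := congrFun (congrFun h0 i) i
    rw [scalarMatrix_apply, if_pos rfl] at this
    exact hp0 this
  · change (CStarMatrix.mapₙₐ φ) (κ 1) = _
    rw [map_one]
    ext i j
    change φ ((1 : CStarMatrix G G D) i j) = _
    rw [CStarMatrix.one_apply, scalarMatrix_apply, apply_ite φ, hφ1, map_zero]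
  · rw [CStarMatrix.sub_apply, mul_scalarMatrix_apply, scalarMatrix_mul_apply]
    exact hcomm _ (hF M hM i j)
  · choose b hb using fun i j => happ _ (hF M hM i j)
    obtain ⟨d, hd⟩ := hκ (CStarMatrix.ofMatrix fun i j => b i j)
    refine ⟨d, hδ _ fun i j => ?_⟩
    rw [CStarMatrix.sub_apply, mul_scalarMatrix_apply, scalarMatrix_mul_apply]
    change ‖p * M i j * p - φ (κ d i j)‖ < δ
    rw [hd]
    exact hb i j
  · have htq : ∀ g h, star (t g) * t h * q = if g = h then q else 0 := fun g h => by
      have hcl : IsClosed {z : A | star (t g) * t h * z = if g = h then z else 0} := by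
        refine isClosed_eq (by fun_prop) ?_
        split_ifs <;> fun_prop
      refine closure_minimal ?_ hcl hqw
      rintro _ ⟨a, rfl⟩
      change star (t g) * t h * (w * a * w) = if g = h then w * a * w else 0
      rw [mul_assoc w, ← mul_assoc _ w, htw]
      split_ifs <;> simp
    choose a ha using ht
    -- Only row `i₀` is nonzero, so the `(g, h)` entry of `star W * W` is `star (q v) * (star (t g)
    -- * t h) * (q v)`. The factorization through `entry i₀ i₀ y` lets `hr` apply to `W`.
    let W : CStarMatrix G G A := CStarMatrix.ofMatrix fun i j => if i = i₀ then t j * (q * v) else 0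
    let W' : CStarMatrix G G A := CStarMatrix.ofMatrix fun i j => if i = i₀ then a j * (q * v) else 0
    have hW : W = entry i₀ i₀ y * W' := by
      ext k j
      rw [entry_mul]
      change (if k = i₀ then _ else _) = if k = i₀ then y * (if i₀ = i₀ then _ else _) else 0
      rw [if_pos rfl, ha, mul_assoc]
    have h1p : (1 - p) * (1 - p) = 1 - p := hp.one_sub.isIdempotentElem
    have hqv : star (q * v) * (q * v) = 1 - p := by
      rw [star_mul, hq.isSelfAdjoint.star_eq, mul_assoc, ← mul_assoc q, hq.isIdempotentElem.eq, ← hvq,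
        mul_assoc v, hv, ← mul_assoc, hv, h1p]
    have hWW : star W * W = 1 - (scalarMatrix p : CStarMatrix G G A) := by
      ext g h
      rw [CStarMatrix.mul_apply, CStarMatrix.sub_apply, CStarMatrix.one_apply, scalarMatrix_apply]
      have hk : ∀ k, star W g k * W k h =
          if k = i₀ then star (t g * (q * v)) * (t h * (q * v)) else 0 := fun k => by
        rw [CStarMatrix.star_apply]
        change star (if k = i₀ then _ else _) * (if k = i₀ then _ else _) = _
        split_ifs <;> simp
      have hgh : star (t g * (q * v)) * (t h * (q * v)) = if g = h then 1 - p else 0 := by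
        have : star (t g * (q * v)) * (t h * (q * v)) =
            star (q * v) * ((star (t g) * t h * q) * v) := by
          rw [star_mul]
          simp only [mul_assoc]
        rw [this, htq]
        split_ifs
        · exact hqv
        · simp
      simp only [hk, Finset.sum_ite_eq', Finset.mem_univ, if_true, hgh]
      split_ifs <;> simp
    have hV : star (x * r * W) * (x * r * W) = 1 - (scalarMatrix p : CStarMatrix G G A) := by
      rw [star_mul, ← mul_assoc, mul_assoc (star W), hW, mul_assoc (star _), ← mul_assoc _ (entry _ _ _), hr,
        ← hW, hWW]
    have hproj : IsStarProjection (1 - scalarMatrix p : CStarMatrix G G A) :=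
      IsStarProjection.one_sub hP
    refine ⟨x * r * W * star (x * r * W), isStarProjection_mul_star hproj hV, subset_closure ?_,
      x * r * W, hV, rfl⟩
    refine ⟨r * W * (star W * star r), ?_⟩
    rw [star_mul, star_mul, hx.star_eq]
    simp only [mul_assoc]

/-- Reindexing of matrices as a homomorphism. -/
def reindexHom {H : Type*} [Fintype H] [DecidableEq H] (e : G ≃ H) :
    CStarMatrix H H A →⋆ₐ[ℂ] CStarMatrix G G A where
  toFun M := CStarMatrix.ofMatrix fun i j => M (e i) (e j)
  map_one' := by
    ext i j
    change (1 : CStarMatrix H H A) (e i) (e j) = _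
    simp only [CStarMatrix.one_apply, e.apply_eq_iff_eq]
  map_mul' M N := by
    ext i j
    exact (Fintype.sum_equiv e _ _ fun k => rfl).symm
  map_zero' := rfl
  map_add' M N := rfl
  commutes' c := by
    ext i j
    change (algebraMap ℂ (CStarMatrix H H A) c) (e i) (e j) = _
    simp only [CStarMatrix.algebraMap_apply, e.apply_eq_iff_eq]
  map_star' M := rfl

theorem reindexHom_surjective {H : Type*} [Fintype H] [DecidableEq H] (e : G ≃ H) :
    Function.Surjective (reindexHom (A := A) e) := fun M =>
  ⟨CStarMatrix.ofMatrix fun i j => M (e.symm i) (e.symm j), by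
    ext i j
    change M (e.symm (e i)) (e.symm (e j)) = _
    simp⟩

/-- Matrix-valued continuous functions as matrices of continuous functions. -/
def functionMatrixHom (X : Type*) [TopologicalSpace X] [CompactSpace X] :
    C(X, CStarMatrix G G A) →⋆ₐ[ℂ] CStarMatrix G G C(X, A) where
  toFun f := CStarMatrix.ofMatrix fun i j =>
    ⟨fun x => f x i j, (continuous_apply j).comp ((continuous_apply i).comp f.continuous)⟩
  map_one' := by
    ext i j x
    change (1 : CStarMatrix G G A) i j = (1 : CStarMatrix G G C(X, A)) i j x
    simp only [CStarMatrix.one_apply]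
    split_ifs <;> rfl
  map_mul' f g := by
    ext i j x
    rw [CStarMatrix.mul_apply, ContinuousMap.sum_apply]
    rfl
  map_zero' := rfl
  map_add' f g := rfl
  commutes' c := by
    ext i j x
    change (algebraMap ℂ (CStarMatrix G G A) c) i j = (algebraMap ℂ (CStarMatrix G G C(X, A)) c) i j x
    simp only [CStarMatrix.algebraMap_apply]
    split_ifs <;> rfl
  map_star' f := rfl

theorem functionMatrixHom_surjective (X : Type*) [TopologicalSpace X] [CompactSpace X] :
    Function.Surjective (functionMatrixHom (A := A) (G := G) X) := fun M =>
  ⟨⟨fun x => CStarMatrix.ofMatrix fun i j => M i j x,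
    continuous_pi fun i => continuous_pi fun j => (M i j).continuous⟩, rfl⟩

/-- The data `F'`, `δ`, `w` are chosen before the model algebras, so one argument serves interval
algebras and finite-dimensional ones. -/
theorem exists_isTracialApprox_matrix [Group G] [TopologicalSpace G] [IsTopologicalGroup G]
    [T2Space G] [TopologicalSpace.SeparableSpace A] [IsSimpleRing A] {α : G →* (A ≃⋆ₐ[ℂ] A)}
    (hRok : HasRokhlinProperty α) (F : Finset (CStarMatrix G G A)) {ε : ℝ} (hε : 0 < ε)
    {x : CStarMatrix G G A} (hx : ∃ y, x = star y * y) (hx0 : x ≠ 0) :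
    ∃ (F' : Finset A) (δ : ℝ) (w : A), 0 < δ ∧ (∃ y, w = star y * y) ∧ w ≠ 0 ∧
      ∀ (D D' : Type) [CStarAlgebra D] [CStarAlgebra D'] (κ : D' →⋆ₐ[ℂ] CStarMatrix G G D)
        (_ : Function.Surjective κ) (p : A) (φ : D →⋆ₙₐ[ℂ] A), IsTracialApprox F' δ w p φ →
          ∃ (P : CStarMatrix G G A) (Φ : D' →⋆ₙₐ[ℂ] CStarMatrix G G A), IsTracialApprox F ε x P Φ := by
  classical
  obtain ⟨r, i₀, y, hy, hr⟩ := exists_localIsometry_entry hx0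
  obtain ⟨c, t, hc, ht, htc⟩ := exists_orthogonal_localIsometries hRok hy
  obtain ⟨δ, hδ, hδε⟩ := exists_norm_lt_of_entries (A := A) (G := G) hε
  refine ⟨(F ×ˢ Finset.univ).image fun M : CStarMatrix G G A × G × G => M.1 M.2.1 M.2.2, δ,
    star c * c, hδ, ⟨c, rfl⟩, by rwa [ne_eq, CStarRing.star_mul_self_eq_zero_iff],
    fun D D' _ _ κ hκ p φ h => ⟨_, _, isTracialApprox_matrix κ hκ (fun M hM i j => ?_) hδε ?_ hr ht
      htc h⟩⟩
  · exact Finset.mem_image.2 ⟨(M, i, j), by simp [hM], rfl⟩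
  · obtain ⟨y, rfl⟩ := hx
    exact IsSelfAdjoint.star_mul_self y

theorem finiteDimensional_cstarMatrix {G : Type*} [Fintype G] {E : Type*} [CStarAlgebra E] [FiniteDimensional ℂ E] :
    FiniteDimensional ℂ (CStarMatrix G G E) :=
  inferInstanceAs (FiniteDimensional ℂ (Matrix G G E))

variable [Group G] [TopologicalSpace G] [IsTopologicalGroup G] [T2Space G]
  [TopologicalSpace.SeparableSpace A] [IsSimpleRing A] {α : G →* (A ≃⋆ₐ[ℂ] A)}

theorem tracialRankLEOne_matrix (hRok : HasRokhlinProperty α) (hA : TracialRankLEOne A) :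
    TracialRankLEOne (CStarMatrix G G A) := by
  intro F ε hε x hx hx0
  obtain ⟨F', δ, w, hδ, hw, hw0, H⟩ := exists_isTracialApprox_matrix hRok F hε hx hx0
  obtain ⟨E, _, _, p, φ, h⟩ := hA F' δ hδ w hw hw0
  -- Indexing by `Fin (Fintype.card G)` keeps the matrix algebra over `E` in `Type`, as
  -- `TracialRankLEOne` demands, whatever the universe of `G`.
  obtain ⟨P, Φ, hΦ⟩ := H C(unitInterval, E)
    C(unitInterval, CStarMatrix (Fin (Fintype.card G)) (Fin (Fintype.card G)) E)
    ((reindexHom (Fintype.equivFin G)).comp (functionMatrixHom unitInterval))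
    ((reindexHom_surjective _).comp (functionMatrixHom_surjective _)) p φ h
  exact ⟨_, _, finiteDimensional_cstarMatrix, P, Φ, hΦ⟩

theorem tracialRankZero_matrix (hRok : HasRokhlinProperty α) (hA : TracialRankZero A) :
    TracialRankZero (CStarMatrix G G A) := by
  intro F ε hε x hx hx0
  obtain ⟨F', δ, w, hδ, hw, hw0, H⟩ := exists_isTracialApprox_matrix hRok F hε hx hx0
  obtain ⟨E, _, _, p, φ, h⟩ := hA F' δ hδ w hw hw0
  obtain ⟨P, Φ, hΦ⟩ := H E (CStarMatrix (Fin (Fintype.card G)) (Fin (Fintype.card G)) E)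
    (reindexHom (Fintype.equivFin G)) (reindexHom_surjective _) p φ h
  exact ⟨_, _, finiteDimensional_cstarMatrix, P, Φ, hΦ⟩

theorem crossedProduct_properties (hRok : HasRokhlinProperty α) (hA : TracialRankLEOne A) :
    IsSimpleCStar (CrossedProduct α) ∧ TracialRankLEOne (CrossedProduct α) ∧
      (TracialRankZero A → TracialRankZero (CrossedProduct α)) := by
  obtain ⟨ψ, hψ⟩ := exists_sequentialSplitting_regRepHom hRok
  have : IsSimpleRing (CStarMatrix G G A) := isSimpleRing_cstarMatrix
  have := isSimpleRing_of_sequentiallySplit (regRepHom α) ψ hψ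
  exact ⟨isSimpleCStar_of_isSimpleRing,
    tracialRankLEOne_of_sequentiallySplit (regRepHom α) ψ hψ (tracialRankLEOne_matrix hRok hA),
    fun h0 => tracialRankZero_of_sequentiallySplit (regRepHom α) ψ hψ
      (tracialRankZero_matrix hRok h0)⟩

end MatrixTracialRank

end

end RokhlinAction

theorem mainTheorem7 {A G : Type*} [CStarAlgebra A] [TopologicalSpace.SeparableSpace A]
    (hsimple : RokhlinAction.IsSimpleCStar A) (hTR : RokhlinAction.TracialRankLEOne A)
    [Group G] [TopologicalSpace G] [IsTopologicalGroup G] [CompactSpace G] [T2Space G]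
    [SecondCountableTopology G]
    (α : G →* (A ≃⋆ₐ[ℂ] A)) (hα : ∀ a : A, Continuous fun g : G => α g a)
    (hRok : RokhlinAction.HasRokhlinProperty α) :
    (TopologicalSpace.SeparableSpace (RokhlinAction.fixedPoints α) ∧
      RokhlinAction.IsSimpleCStar (RokhlinAction.fixedPoints α) ∧
      RokhlinAction.TracialRankLEOne (RokhlinAction.fixedPoints α) ∧
      (RokhlinAction.TracialRankZero A →
        RokhlinAction.TracialRankZero (RokhlinAction.fixedPoints α))) ∧
    ∀ [Fintype G] [DecidableEq G],
      TopologicalSpace.SeparableSpace (RokhlinAction.CrossedProduct α) ∧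
      RokhlinAction.IsSimpleCStar (RokhlinAction.CrossedProduct α) ∧
      RokhlinAction.TracialRankLEOne (RokhlinAction.CrossedProduct α) ∧
      (RokhlinAction.TracialRankZero A →
        RokhlinAction.TracialRankZero (RokhlinAction.CrossedProduct α)) := by
  have : IsSimpleRing A := hsimple.isSimpleRing
  obtain ⟨χ, hχ⟩ := RokhlinAction.exists_sequentialSplitting_fixedPoints hα hRok
  have := RokhlinAction.isSimpleRing_of_sequentiallySplit
    (RokhlinAction.fixedPoints α).subtype χ hχ
  refine ⟨⟨RokhlinAction.separableSpace_fixedPoints α, RokhlinAction.isSimpleCStar_of_isSimpleRing,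
    RokhlinAction.tracialRankLEOne_of_sequentiallySplit (RokhlinAction.fixedPoints α).subtype χ hχ hTR,
    RokhlinAction.tracialRankZero_of_sequentiallySplit (RokhlinAction.fixedPoints α).subtype χ hχ⟩, ?_⟩
  intro _ _
  exact ⟨RokhlinAction.CrossedProduct.separableSpace α,
    RokhlinAction.crossedProduct_properties hRok hTR⟩
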